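/- Let $\mathbb F$ be a field of characteristic $0$. For $f\in\mathbb F[x]$ let $\mathrm{AffPow}_{\mathbb F}(f)$ be the least $s$ such that $f=\sum_{i=1}^s\alpha_i(x-a_i)^{e_i}$ for some $\alpha_i,a_i\in\mathbb F$, $e_i\in\mathbb N$. A shifted differential equation $\mathrm{SDE}(k,l)$ is an equation $\sum_{i=0}^kP_i\,g^{(i)}=0$ in the unknown $g$, where the $P_i\in\mathbb F[x]$ are not all zero and $\deg P_i\le i+l$. **Theorem.** Suppose that $f=\sum_{i=1}^s\alpha_i(x-a_i)^{e_i}$ with distinct $a_i\in\mathbb F$, with $\alpha_i\in\mathbb F\setminus\{0\}$, and with $e_i>5s^2/2$ for all $i$. Then $\mathrm{AffPow}_{\mathbb F}(f)=s$. Moreover, let $r$ be the least order such that $f$ satisfies an $\mathrm{SDE}(r,0)$, fix any $\mathrm{SDE}(r,0)$ satisfied by $f$, and let $B$ be the set of all pairs $(b,d)\in\mathbb F\times\mathbb N$ with $(r+1)^2/2\le d\le\deg f+r^2/2$ such that $(x-b)^d$ is a solution of this equation (here $\deg 0=0$). Then $B$ is finite with at most $r$ elements, $f$ can be written in exactly one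 way as $f=\sum_{(b,d)\in B}\beta_{b,d}\,(x-b)^d$ with $\beta_{b,d}\in\mathbb F$, and the triples $(\beta_{b,d},b,d)$ with $\beta_{b,d}\ne0$ are exactly the triples $(\alpha_i,a_i,e_i)$, $1\le i\le s$. Finally, there is a polynomial-time algorithm $\mathrm{Build}$ that carries this out. It is a single program, the same for all $\mathbb F$, which uses the constants $0,1$, arithmetic operations and equality tests in $\mathbb F$, calls to a root finder (which lists, without repetition and in some order, the roots in $\mathbb F$ of a nonzero polynomial given by its coefficients), and elementary operations on counters, pairs and lists. For every correct root finder, the number of its steps on every list of $n$ elements of $\mathbb F$ is at most $p(n)$, for a fixed polynomial $p$ (a root finder call is charged at least one step for each coefficient received and each root returned). On the coefficient list $(f_0,\dots,f_{\deg f})$ of any $f$ as above it outputs: 1. the least order $r$ such that $f$ satisfies an $\mathrm{SDE}(r,0)$, and the coefficients $P_0,\dots,P_r$ of one such equation; 2. the list, without repetition, of the elements $(b_1,d_1),\dots,(b_m,d_m)$ of the corresponding set $B$, where $m\le r$; 3. elements $\beta_1,\dots,\beta_m\in\mathbb F$ with $f=\sum_{j=1}^m\beta_j(x-b_j)^{d_j}$;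 4. the list of the triples $(\beta_j,b_j,d_j)$ with $\beta_j\ne0$, which is, up to order, the list $(\alpha_1,a_1,e_1),\dots,(\alpha_s,a_s,e_s)$ of coefficients, nodes and exponents. -/

import Mathlib

open Polynomial

universe u

namespace AffinePowers

section Model

variable {F : Type u} [Field F]

/-- `affPow f` is the minimum `s` such that `f` is a sum of `s` affine powers
`α * (x - a) ^ e` (the set below is never empty: every `f` is a sum of monomials). -/
noncomputable def affPow (f : F[X]) : ℕ :=
  sInf {s : ℕ | ∃ (α a : Fin s → F) (e : Fin s → ℕ),
    f = ∑ i, C (α i) * (X - C (a i)) ^ e i}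

/-- `f = ∑ i, α i * (x - a i) ^ e i` with distinct nodes, nonzero coefficients, and all the
exponents larger than `5 s² / 2`. -/
structure IsBigExponentDecomposition (f : F[X]) (s : ℕ) (α a : Fin s → F) (e : Fin s → ℕ) :
    Prop where
  eq_sum : f = ∑ i, C (α i) * (X - C (a i)) ^ e i
  nodes_distinct : Function.Injective a
  coeff_ne_zero : ∀ i, α i ≠ 0
  exponent_big : ∀ i, 5 * (s : ℚ) ^ 2 / 2 < (e i : ℚ)

/-- `P 0, …, P k` are the coefficients of a shifted differential equation
`∑ i ≤ k, P i * g⁽ⁱ⁾ = 0` of order `k` and shift `l`: they do not all vanish and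
`deg (P i) ≤ i + l`.  The values of `P` beyond `k` play no role. -/
def IsSDE (k l : ℕ) (P : ℕ → F[X]) : Prop :=
  (∃ i ≤ k, P i ≠ 0) ∧ ∀ i ≤ k, (P i).natDegree ≤ i + l

/-- The polynomial `g` satisfies the differential equation `∑ i ≤ k, P i * g⁽ⁱ⁾ = 0`. -/
def Satisfies (k : ℕ) (P : ℕ → F[X]) (g : F[X]) : Prop :=
  ∑ i ∈ Finset.range (k + 1), P i * derivative^[i] g = 0

/-- `r` is the minimum order of an SDE of shift `0` satisfied by `f`, and `P` is one of the
SDEs of order `r` and shift `0` satisfied by `f`. -/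
def IsMinimalSDE (f : F[X]) (r : ℕ) (P : ℕ → F[X]) : Prop :=
  IsLeast {k : ℕ | ∃ Q : ℕ → F[X], IsSDE k 0 Q ∧ Satisfies k Q f} r ∧
    IsSDE r 0 P ∧ Satisfies r P f

/-- The solutions `(x - b) ^ d` of the SDE `P` of order `r` with
`(r + 1)² / 2 ≤ d ≤ deg f + r² / 2`, each given by its pair `(b, d)`
(as `d > 0`, the pair is determined by the polynomial). -/
def powerSolutions (f : F[X]) (r : ℕ) (P : ℕ → F[X]) : Set (F × ℕ) :=
  {q | ((r : ℚ) + 1) ^ 2 / 2 ≤ (q.2 : ℚ) ∧ (q.2 : ℚ) ≤ (f.natDegree : ℚ) + (r : ℚ) ^ 2 / 2 ∧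
    Satisfies r P ((X - C q.1) ^ q.2)}

/-- The polynomial `c₀ + c₁ x + c₂ x² + …` of a list `[c₀, c₁, c₂, …]`. -/
noncomputable def listPoly (l : List F) : F[X] :=
  l.foldr (fun c g => C c + X * g) 0

/-- The dense representation of a polynomial of degree `d`: the list of its coefficients
`[f₀, …, f_d]`, of length `d + 1`. -/
def denseRep (f : F[X]) : List F :=
  (List.range (f.natDegree + 1)).map f.coeff

/-- `R` is a root finder: given the coefficients of a nonzero polynomial, it lists the roots of
the polynomial in `F`, without repetition and in some order.  Nothing is said about the answer
on the zero polynomial. -/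
def IsRootFinder (R : List F → List F) : Prop :=
  ∀ l : List F, listPoly l ≠ 0 →
    (R l).Nodup ∧ ∀ b : F, b ∈ R l ↔ (listPoly l).IsRoot b

end Model

/-! ### Algorithms over a field

A small first order programming language for algorithms over an arbitrary field.  A program is a
finite syntactic object that does not depend on the field.  Its only operations on field elements
are the constants `0` and `1`, the arithmetic operations, the equality test, and a call to a root
finder; the rest is bookkeeping on counters, pairs and lists, with branching and bounded loops.
Every operation that is carried out costs at least one step, so the number of steps is at least the
number of arithmetic operations, tests and root finder calls. -/

/-- Data types: counters, field elements, pairs, lists. -/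
inductive Ty : Type
  | nat : Ty
  | fld : Ty
  | prod : Ty → Ty → Ty
  | list : Ty → Ty

/-- The values of a data type over the field `F`. -/
def Ty.Val (F : Type u) : Ty → Type u
  | .nat => ULift.{u} ℕ
  | .fld => F
  | .prod a b => a.Val F × b.Val F
  | .list a => List (a.Val F)

/-- Programs with input of type `σ` and output of type `τ`. -/
inductive Prog : Ty → Ty → Type
  /-- the input itself -/
  | arg {σ : Ty} : Prog σ σ
  /-- run the first program, then the second one on its result -/
  | comp {σ τ ρ : Ty} : Prog σ τ → Prog τ ρ → Prog σ ρ
  | pair {σ a b : Ty} : Prog σ a → Prog σ b → Prog σ (.prod a b)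
  | fst {σ a b : Ty} : Prog σ (.prod a b) → Prog σ a
  | snd {σ a b : Ty} : Prog σ (.prod a b) → Prog σ b
  | zero {σ : Ty} : Prog σ .nat
  | succ {σ : Ty} : Prog σ .nat → Prog σ .nat
  /-- branch on a counter: zero, or the successor of a counter that is handed to the branch -/
  | natCase {σ τ : Ty} : Prog σ .nat → Prog σ τ → Prog (.prod σ .nat) τ → Prog σ τ
  /-- `for i = 0, …, n - 1`, with an initial state and a body that updates the state -/
  | natLoop {σ τ : Ty} : Prog σ .nat → Prog σ τ → Prog (.prod σ (.prod .nat τ)) τ → Prog σ τ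
  | nil {σ a : Ty} : Prog σ (.list a)
  | cons {σ a : Ty} : Prog σ a → Prog σ (.list a) → Prog σ (.list a)
  /-- branch on a list: empty, or a head and a tail that are handed to the branch -/
  | listCase {σ a τ : Ty} :
      Prog σ (.list a) → Prog σ τ → Prog (.prod σ (.prod a (.list a))) τ → Prog σ τ
  /-- loop over the elements of a list, with an initial state and a body that updates the state -/
  | listLoop {σ a τ : Ty} :
      Prog σ (.list a) → Prog σ τ → Prog (.prod σ (.prod a τ)) τ → Prog σ τ
  | fzero {σ : Ty} : Prog σ .fld
  | fone {σ : Ty} : Prog σ .fld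
  | fadd {σ : Ty} : Prog σ .fld → Prog σ .fld → Prog σ .fld
  | fsub {σ : Ty} : Prog σ .fld → Prog σ .fld → Prog σ .fld
  | fmul {σ : Ty} : Prog σ .fld → Prog σ .fld → Prog σ .fld
  /-- division, with the convention `x / 0 = 0` -/
  | fdiv {σ : Ty} : Prog σ .fld → Prog σ .fld → Prog σ .fld
  /-- equality test: the counter `1` if the two field elements are equal, `0` otherwise -/
  | feq {σ : Ty} : Prog σ .fld → Prog σ .fld → Prog σ .nat
  /-- call to the root finder on the polynomial with the given list of coefficients -/
  | roots {σ : Ty} : Prog σ (.list .fld) → Prog σ (.list .fld)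

/-- The total number of steps of a loop over `l` with initial state `t`, when the body maps the
element `x` and the state `t` to the state `body x t` in `cost x t` steps. -/
def loopSteps {A : Type*} {T : Type*} (body : A → T → T) (cost : A → T → ℕ) : List A → T → ℕ
  | [], _ => 0
  | x :: l, t => cost x t + 1 + loopSteps body cost l (body x t)

section Semantics

variable {F : Type u} [Field F]

open Classical in
/-- The result of a program on an input, given the root finder `R`. -/
noncomputable def Prog.eval (R : List F → List F) :
    {σ τ : Ty} → Prog σ τ → σ.Val F → τ.Val F
  | _, _, .arg, x => x
  | _, _, .comp p q, x => q.eval R (p.eval R x)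
  | _, _, .pair p q, x => (p.eval R x, q.eval R x)
  | _, _, .fst p, x => (p.eval R x).1
  | _, _, .snd p, x => (p.eval R x).2
  | _, _, .zero, _ => ULift.up 0
  | _, _, .succ p, x => ULift.up ((p.eval R x).down + 1)
  | _, _, .natCase p q w, x =>
      match p.eval R x with
      | ⟨0⟩ => q.eval R x
      | ⟨n + 1⟩ => w.eval R (x, ULift.up n)
  | _, _, .natLoop p q w, x =>
      (List.range (p.eval R x).down).foldl (fun t i => w.eval R (x, (ULift.up i, t))) (q.eval R x)
  | _, _, .nil, _ => []
  | _, _, .cons p q, x => List.cons (p.eval R x) (q.eval R x)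
  | _, _, .listCase p q w, x =>
      match p.eval R x with
      | [] => q.eval R x
      | y :: l => w.eval R (x, (y, l))
  | _, _, .listLoop p q w, x =>
      List.foldl (fun t y => w.eval R (x, (y, t))) (q.eval R x) (p.eval R x)
  | _, _, .fzero, _ => (0 : F)
  | _, _, .fone, _ => (1 : F)
  | _, _, .fadd p q, x => @HAdd.hAdd F F F _ (p.eval R x) (q.eval R x)
  | _, _, .fsub p q, x => @HSub.hSub F F F _ (p.eval R x) (q.eval R x)
  | _, _, .fmul p q, x => @HMul.hMul F F F _ (p.eval R x) (q.eval R x)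
  | _, _, .fdiv p q, x => @HDiv.hDiv F F F _ (p.eval R x) (q.eval R x)
  | _, _, .feq p q, x => ULift.up (if @Eq F (p.eval R x) (q.eval R x) then 1 else 0)
  | _, _, .roots p, x => R (p.eval R x)

/-- The number of steps of a program on an input, given the root finder `R`.  Every operation
costs one step; a call to the root finder costs one step more for each entry of the list that
it receives and of the list that it returns; only the branch that is taken is counted. -/
noncomputable def Prog.steps (R : List F → List F) :
    {σ τ : Ty} → Prog σ τ → σ.Val F → ℕ
  | _, _, .arg, _ => 1
  | _, _, .comp p q, x => p.steps R x + q.steps R (p.eval R x) + 1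
  | _, _, .pair p q, x => p.steps R x + q.steps R x + 1
  | _, _, .fst p, x => p.steps R x + 1
  | _, _, .snd p, x => p.steps R x + 1
  | _, _, .zero, _ => 1
  | _, _, .succ p, x => p.steps R x + 1
  | _, _, .natCase p q w, x =>
      p.steps R x + 1 +
        match p.eval R x with
        | ⟨0⟩ => q.steps R x
        | ⟨n + 1⟩ => w.steps R (x, ULift.up n)
  | _, _, .natLoop p q w, x =>
      p.steps R x + q.steps R x + 1 +
        loopSteps (fun i t => w.eval R (x, (ULift.up i, t)))
          (fun i t => w.steps R (x, (ULift.up i, t)))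
          (List.range (p.eval R x).down) (q.eval R x)
  | _, _, .nil, _ => 1
  | _, _, .cons p q, x => p.steps R x + q.steps R x + 1
  | _, _, .listCase p q w, x =>
      p.steps R x + 1 +
        match p.eval R x with
        | [] => q.steps R x
        | y :: l => w.steps R (x, (y, l))
  | _, _, .listLoop p q w, x =>
      p.steps R x + q.steps R x + 1 +
        loopSteps (fun y t => w.eval R (x, (y, t))) (fun y t => w.steps R (x, (y, t)))
          (p.eval R x) (q.eval R x)
  | _, _, .fzero, _ => 1
  | _, _, .fone, _ => 1
  | _, _, .fadd p q, x => p.steps R x + q.steps R x + 1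
  | _, _, .fsub p q, x => p.steps R x + q.steps R x + 1
  | _, _, .fmul p q, x => p.steps R x + q.steps R x + 1
  | _, _, .fdiv p q, x => p.steps R x + q.steps R x + 1
  | _, _, .feq p q, x => p.steps R x + q.steps R x + 1
  | _, _, .roots p, x =>
      p.steps R x + 1 + List.length (p.eval R x) + List.length (R (p.eval R x))

end Semantics

open Classical in
/-- The triples `(β_i, b_i, d_i)` with `β_i ≠ 0`, for two lists of the same length with entries
`β_i` and `(b_i, d_i)`. -/
noncomputable def nonzeroTerms {F : Type u} [Field F] (β : List F) (B : List (F × ℕ)) :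
    List (F × F × ℕ) :=
  (β.zip B).filter (fun t => t.1 ≠ 0)

/-- The type of the output of the algorithm `Build`: the order `r`, the coefficients
`P₀, …, P_r` of an SDE, the list of the pairs `(b, d)`, the list of the coefficients `β`, and the
list of the triples `(coefficient, node, exponent)` of the decomposition. -/
def buildTy : Ty :=
  .prod .nat (.prod (.list (.list .fld)) (.prod (.list (.prod .fld .nat))
    (.prod (.list .fld) (.list (.prod .fld (.prod .fld .nat))))))

/-- The value of type `buildTy` that encodes the given data. -/
def encodeOutput {F : Type u} (r : ℕ) (P : List (List F)) (B : List (F × ℕ)) (β : List F)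
    (T : List (F × F × ℕ)) : buildTy.Val F :=
  (ULift.up r, P, B.map (fun q => (q.1, ULift.up q.2)), β,
    T.map (fun t => (t.1, t.2.1, ULift.up t.2.2)))

end AffinePowers

open AffinePowers

/-! The argument rests on one estimate. A linear relation among polynomials `g i`, where
`(x - a i) ^ m i` divides `g i` and `deg g i ≤ m i + L`, bounds the multiplicities: in a minimal
relation all the members but one are linearly independent, so their Wronskian is nonzero, while it
is highly divisible by each of the `x - a i`; comparing with its degree bounds the `m i` in terms of
`L` and of the number of terms only (`two_mul_add_le_of_relation`). For affine powers this says that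
a family whose exponents are large compared with the square of its size is linearly independent
(`linearIndependent_affinePower_of_card`). Optimality follows, since the difference of two
decompositions of `f` is a relation with fewer than `2 s` terms, one of them with a large exponent.

A dimension count gives an SDE of order `2 s - 1` that is satisfied by all the terms of `f`, hence
by `f`, so `r ≤ 2 s - 1` (`exists_isSDE_of_affinePowers`). Conversely, applying an SDE of order
`k ≤ 2 s - 1` to `f` yields a relation among the polynomials `cofactor * (x - a i) ^ (e i - k)`,
whose left factors have degree at most `k`; the exponents are too large for it, so all the cofactors
vanish and every term of `f` is itself a solution
(`IsBigExponentDecomposition.satisfies_affinePower`). The same count of zeros of a Wronskian, with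
`f` as an additional member of the family, keeps the exponents below `deg f + s² / 2`. As moreover
`s ≤ r`, all the terms are in `powerSolutions f r P`. The affine powers in this set are solutions of
an equation of order `r`, so any `r + 1` of them are linearly dependent
(`not_linearIndependent_of_satisfies`), but their exponents are so large that they are linearly
independent. So there are at most `r` of them, and `f` has only one expression in terms of them.

The algorithm is a program of the language of the statement. Its linear algebra is an elimination
that finds a nontrivial relation `∑ i, Q i * v i = 0` with bounds on the degrees of the `Q i`
whenever there is one (`findRelation_spec`). It is used with the derivatives of `f` to find an SDE
of minimal order, and with `f` and the affine powers of the SDE to find the coefficients. The nodes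
of these affine powers are roots of the leading coefficient of the SDE
(`eval_eq_zero_of_satisfies_affinePower`), which the root finder lists, and only polynomially many
exponents have to be tried. The time bound is assembled along the syntax of the program by instance
search for the class `PolyTime`; the measure of a value is its largest counter or list length, and
the only side condition is that a loop body enlarges the state by an amount that does not depend on
the state (`AddsBounded`). -/

-- The values of concrete data types have to be seen as lists, pairs and numbers by unification.
attribute [reducible] AffinePowers.Ty.Val

namespace AffinePowers

/-! ### Wronskians of families of polynomials -/

section Wronskian

variable {F : Type u} [Field F]

/-- In characteristic zero, the polynomial solutions of a nontrivial linear differential equation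
of order `k` span a space of dimension at most `k`: a solution that vanishes to order `k` at a
point where the leading coefficient does not vanish is zero. -/
theorem not_linearIndependent_of_satisfies [CharZero F] {k : ℕ} {P : ℕ → F[X]}
    (hP : ∃ i ≤ k, P i ≠ 0) {g : Fin (k + 1) → F[X]} (hg : ∀ i, Satisfies k P (g i)) :
    ¬ LinearIndependent F g := by
  classical
  intro hli
  obtain ⟨j, ⟨hjk, hj0⟩, hjmax⟩ : ∃ j, (j ≤ k ∧ P j ≠ 0) ∧ ∀ i ≤ k, P i ≠ 0 → i ≤ j := by
    obtain ⟨i, hi, hi0⟩ := hP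
    refine ⟨Nat.findGreatest (fun i => P i ≠ 0) k, ⟨Nat.findGreatest_le k,
      Nat.findGreatest_spec (P := fun i => P i ≠ 0) hi hi0⟩, fun i hi h => Nat.le_findGreatest hi h⟩
  obtain ⟨c, hc⟩ : ∃ c, (P j).eval c ≠ 0 := by
    by_contra! h
    exact hj0 (Polynomial.funext fun x => by simpa using h x)
  -- some nonzero combination `h` vanishes at `c` together with its first `j - 1` derivatives
  let φ : (Fin (k + 1) → F) →ₗ[F] (Fin j → F) :=
    LinearMap.pi fun i => ((Polynomial.leval c).comp
      ((Polynomial.derivative : F[X] →ₗ[F] F[X]) ^ (i : ℕ))).comp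
        (Fintype.linearCombination F g)
  have hker : LinearMap.ker φ ≠ ⊥ := by
    apply LinearMap.ker_ne_bot_of_finrank_lt
    simp; omega
  obtain ⟨w, hw, hw0⟩ := (Submodule.ne_bot_iff _).1 hker
  set h : F[X] := Fintype.linearCombination F g w with hh
  have hne : h ≠ 0 := by
    intro h0
    apply hw0
    ext i
    have := Fintype.linearIndependent_iff.1 hli w (by
      simpa [hh, Fintype.linearCombination_apply] using h0)
    simpa using this i
  have hroot : ∀ i < j, (derivative^[i] h).IsRoot c := by
    intro i hi
    have := congrFun (LinearMap.mem_ker.1 hw) ⟨i, hi⟩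
    simpa [φ, Module.End.pow_apply, IsRoot] using this
  have hsat : Satisfies k P h := by
    have : h = ∑ i, C (w i) * g i := by
      simp [hh, Fintype.linearCombination_apply, smul_eq_C_mul]
    unfold Satisfies
    rw [this]
    simp only [iterate_derivative_sum, iterate_derivative_C_mul, Finset.mul_sum]
    rw [Finset.sum_comm]
    refine Finset.sum_eq_zero fun i _ => ?_
    have := hg i
    unfold Satisfies at this
    calc _ = C (w i) * ∑ x ∈ Finset.range (k + 1), P x * derivative^[x] (g i) := by
            rw [Finset.mul_sum]; refine Finset.sum_congr rfl fun x _ => by ring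
      _ = 0 := by rw [this, mul_zero]
  set v := h.rootMultiplicity c with hv
  have hjv : j ≤ v := by
    rcases j with _ | j
    · omega
    · exact (lt_rootMultiplicity_iff_isRoot_iterate_derivative hne).2 fun m hm => hroot m (by omega)
  have hdv : (X - C c) ^ v ∣ h := pow_rootMultiplicity_dvd h c
  have hlow : (X - C c) ^ (v - j + 1) ∣ P j * derivative^[j] h := by
    have hs : P j * derivative^[j] h
        = - ∑ i ∈ (Finset.range (k + 1)).erase j, P i * derivative^[i] h := by
      rw [eq_neg_iff_add_eq_zero, Finset.add_sum_erase _ (fun i => P i * derivative^[i] h)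
        (Finset.mem_range.2 (by omega : j < k + 1))]
      exact hsat
    rw [hs, dvd_neg]
    refine Finset.dvd_sum fun i hi => ?_
    simp only [Finset.mem_erase, Finset.mem_range] at hi
    by_cases h0 : P i = 0
    · simp [h0]
    · have : i ≤ j := hjmax i (by omega) h0
      refine Dvd.dvd.mul_left ?_ _
      refine (pow_dvd_pow _ ?_).trans (pow_sub_dvd_iterate_derivative_of_pow_dvd i hdv)
      omega
  have hcop : IsCoprime ((X - C c) ^ (v - j + 1)) (P j) := by
    apply IsCoprime.pow_left
    refine (EuclideanDomain.dvd_or_coprime _ _ (irreducible_X_sub_C c)).resolve_left ?_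
    rw [dvd_iff_isRoot]; exact hc
  have h1 : (X - C c) ^ (v - j + 1) ∣ derivative^[j] h := hcop.dvd_of_dvd_mul_left hlow
  have h2 : (X - C c) ∣ derivative^[v] h := by
    have := pow_sub_dvd_iterate_derivative_of_pow_dvd (v - j) h1
    rw [← Function.iterate_add_apply] at this
    rw [show v - j + j = v by omega, show v - j + 1 - (v - j) = 1 by omega, pow_one] at this
    exact this
  have : v < v := by
    conv_rhs => rw [hv]
    refine (lt_rootMultiplicity_iff_isRoot_iterate_derivative hne).2 fun m hm => ?_
    rcases hm.lt_or_eq with hm | rfl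
    · have : (X - C c) ∣ derivative^[m] h :=
        (dvd_pow_self _ (by omega : v - m ≠ 0)).trans
          (pow_sub_dvd_iterate_derivative_of_pow_dvd m hdv)
      exact dvd_iff_isRoot.1 this
    · exact dvd_iff_isRoot.1 h2
  omega

/-- The Wronskian determinant of a finite family of polynomials. -/
noncomputable def wronskianDet {n : ℕ} (h : Fin n → F[X]) : F[X] :=
  (Matrix.of fun k i : Fin n => derivative^[(k : ℕ)] (h i)).det

theorem wronskianDet_ne_zero [CharZero F] {n : ℕ} {h : Fin n → F[X]}
    (hli : LinearIndependent F h) : wronskianDet h ≠ 0 := by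
  intro h0
  rcases n with _ | n
  · simp [wronskianDet] at h0
  obtain ⟨v, hv0, hv⟩ := Matrix.exists_vecMul_eq_zero_iff.2 h0
  obtain ⟨i, hi⟩ := Function.ne_iff.1 hv0
  refine not_linearIndependent_of_satisfies (k := n)
    (P := fun i => if hi : i < n + 1 then v ⟨i, hi⟩ else 0)
    ⟨i, by omega, by simpa [i.2] using hi⟩ (fun j => ?_) hli
  have := congrFun hv j
  simp only [Matrix.vecMul, dotProduct, Matrix.of_apply, Pi.zero_apply] at this
  unfold Satisfies
  refine Eq.trans ?_ this
  rw [Finset.sum_range]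
  exact Finset.sum_congr rfl fun x _ => by simp only [dif_pos x.2]

/-- In each term of the determinant, the derivatives lower the degree by `0 + 1 + … + (n - 1)`. -/
theorem natDegree_wronskianDet_add_le {n : ℕ} {h : Fin n → F[X]} (h0 : wronskianDet h ≠ 0) :
    (wronskianDet h).natDegree + ∑ i : Fin n, (i : ℕ) ≤ ∑ i, (h i).natDegree := by
  have key : ∀ σ : Equiv.Perm (Fin n), (∏ i, derivative^[(σ i : ℕ)] (h i)) ≠ 0 →
      (∏ i, derivative^[(σ i : ℕ)] (h i)).natDegree + ∑ i : Fin n, (i : ℕ)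
        ≤ ∑ i, (h i).natDegree := by
    intro σ hσ
    rw [← Equiv.sum_comp σ (fun i : Fin n => (i : ℕ)), natDegree_prod _ _ (by
      simpa [Finset.prod_ne_zero_iff] using hσ), ← Finset.sum_add_distrib]
    refine Finset.sum_le_sum fun i _ => ?_
    have hi : derivative^[(σ i : ℕ)] (h i) ≠ 0 := by
      have := Finset.prod_ne_zero_iff.1 hσ i (Finset.mem_univ i); exact this
    have h1 := natDegree_iterate_derivative (h i) (σ i)
    have h2 : ¬ (h i).natDegree < σ i := fun hlt => hi (iterate_derivative_eq_zero hlt)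
    omega
  have hdet : wronskianDet h
      = ∑ σ : Equiv.Perm (Fin n), Equiv.Perm.sign σ • ∏ i, derivative^[(σ i : ℕ)] (h i) := by
    simp [wronskianDet, Matrix.det_apply]
  have hle : ∑ i : Fin n, (i : ℕ) ≤ ∑ i, (h i).natDegree := by
    rw [hdet] at h0
    obtain ⟨σ, -, hσ⟩ := Finset.exists_ne_zero_of_sum_ne_zero h0
    have := key σ (fun hz => hσ (by rw [hz, smul_zero]))
    omega
  have : (wronskianDet h).natDegree ≤ ∑ i, (h i).natDegree - ∑ i : Fin n, (i : ℕ) := by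
    rw [hdet]
    refine natDegree_sum_le_of_forall_le _ _ fun σ _ => ?_
    have hs : (Equiv.Perm.sign σ • ∏ i, derivative^[(σ i : ℕ)] (h i)).natDegree
        = (∏ i, derivative^[(σ i : ℕ)] (h i)).natDegree := by
      rcases Int.units_eq_one_or (Equiv.Perm.sign σ) with h | h <;> simp [h, Units.smul_def]
    rw [hs]
    by_cases hz : (∏ i, derivative^[(σ i : ℕ)] (h i)) = 0
    · rw [hz]; simp
    · have := key σ hz; omega
  omega

theorem prod_dvd_wronskianDet {n : ℕ} {h : Fin n → F[X]} {q : F[X]} {m : Fin n → ℕ}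
    (hm : ∀ i, q ^ m i ∣ h i) : q ^ (∑ i, (m i - (n - 1))) ∣ wronskianDet h := by
  rw [wronskianDet, Matrix.det_apply]
  refine Finset.dvd_sum fun σ _ => ?_
  rw [Units.smul_def, zsmul_eq_mul, ← Finset.prod_pow_eq_pow_sum]
  refine Dvd.dvd.mul_left (Finset.prod_dvd_prod_of_dvd _ _ fun i _ => ?_) _
  refine (pow_dvd_pow q ?_).trans (pow_sub_dvd_iterate_derivative_of_pow_dvd (σ i : ℕ) (hm i))
  have := (σ i).2
  omega

/-- The Wronskians of the families obtained by leaving out one member of a linearly dependent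
family are proportional. -/
theorem wronskianDet_removeNth_dvd {n : ℕ} {g : Fin (n + 1) → F[X]} {c : Fin (n + 1) → F}
    (hc : ∑ i, C (c i) * g i = 0) {i : Fin (n + 1)} (hi : c i ≠ 0)
    (j : Fin (n + 1)) :
    wronskianDet (i.removeNth g) ∣ wronskianDet (j.removeNth g) := by
  classical
  let M : Matrix (Fin (n + 1)) (Fin (n + 1)) F[X] :=
    Matrix.of (Fin.cons 0 fun (k : Fin n) l => derivative^[(k : ℕ)] (g l))
  have hM : ∀ i, (M.updateRow 0 (Pi.single i 1)).det
      = (-1) ^ (i : ℕ) * wronskianDet (i.removeNth g) := by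
    intro i
    rw [Matrix.det_succ_row_zero, Finset.sum_eq_single i]
    · simp only [Matrix.updateRow_self, Pi.single_eq_same, mul_one]
      rfl
    · intro b _ hb
      simp [Pi.single_eq_of_ne hb]
    · simp
  -- the row `c i • e_j - c j • e_i` is orthogonal to the relation `c`
  have hdet : (M.updateRow 0 (C (c i) • Pi.single j 1 + (-C (c j)) • Pi.single i 1)).det = 0 := by
    refine Matrix.exists_mulVec_eq_zero_iff.1 ⟨fun l => C (c l), ?_, ?_⟩
    · intro h
      exact hi (by simpa using congrFun h i)
    · ext1 a
      refine Fin.cases ?_ (fun k => ?_) a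
      · simp only [Matrix.mulVec, Matrix.updateRow_self, add_dotProduct, smul_dotProduct,
          single_one_dotProduct, Pi.zero_apply, smul_eq_mul]
        ring
      · have : derivative^[(k : ℕ)] (∑ i, C (c i) * g i) = 0 := by rw [hc]; simp
        rw [iterate_derivative_sum] at this
        simp only [iterate_derivative_C_mul] at this
        simp only [Matrix.mulVec, dotProduct, Pi.zero_apply]
        rw [← this]
        refine Finset.sum_congr rfl fun l _ => ?_
        simp [M, mul_comm, Matrix.updateRow_ne]
  rw [Matrix.det_updateRow_add, Matrix.det_updateRow_smul, Matrix.det_updateRow_smul, hM,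
    hM] at hdet
  have hu : IsUnit (C (c i) * (-1 : F[X]) ^ (j : ℕ)) :=
    (isUnit_C.2 hi.isUnit).mul (IsUnit.pow _ isUnit_one.neg)
  refine (hu.dvd_mul_left).1 ⟨C (c j) * (-1) ^ (i : ℕ), ?_⟩
  linear_combination hdet

/-- The counting argument behind all the bounds: in a linear relation among the `g i` with
nonzero coefficients, in which no node takes over all the members and all members but `i₀` are
linearly independent, compare the zeros of the Wronskian with its degree. -/
theorem sum_sub_add_le_of_relation [CharZero F] {n : ℕ} {g : Fin (n + 1) → F[X]}
    {c : Fin (n + 1) → F} (hrel : ∑ i, C (c i) * g i = 0) (hc : ∀ i, c i ≠ 0)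
    {node : Fin (n + 1) → F} (hnode : ∀ i, ∃ j, node j ≠ node i) {m : Fin (n + 1) → ℕ}
    (hm : ∀ i, (X - C (node i)) ^ m i ∣ g i) (i₀ : Fin (n + 1))
    (hli : LinearIndependent F (i₀.removeNth g)) :
    ∑ i, (m i - (n - 1)) + ∑ i : Fin n, (i : ℕ) ≤ ∑ i, (i₀.removeNth g i).natDegree := by
  classical
  have h0 := wronskianDet_ne_zero hli
  refine le_trans (Nat.add_le_add_right ?_ _) (natDegree_wronskianDet_add_le h0)
  set W := wronskianDet (i₀.removeNth g)
  have hdvd : ∏ b ∈ Finset.univ.image node,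
      (X - C b) ^ (∑ i ∈ Finset.univ.filter (fun i => node i = b), (m i - (n - 1))) ∣ W := by
    refine Finset.prod_dvd_of_coprime ?_ ?_
    · intro b _ b' _ hb
      exact (isCoprime_X_sub_C_of_isUnit_sub (sub_ne_zero.2 hb).isUnit).pow
    · intro b hb
      -- up to proportionality, the member left out is one with another node, so that all the
      -- members with the node `b` contribute
      obtain ⟨i, -, rfl⟩ := Finset.mem_image.1 hb
      obtain ⟨j, hj⟩ := hnode i
      refine dvd_trans ?_ (wronskianDet_removeNth_dvd hrel (hc j) i₀)
      have := prod_dvd_wronskianDet (h := j.removeNth g) (q := X - C (node i))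
        (m := fun k => if node (j.succAbove k) = node i then m (j.succAbove k) else 0) (by
          intro k
          by_cases hk : node (j.succAbove k) = node i
          · simp only [hk, if_true]; rw [← hk]; exact hm _
          · simp [hk])
      refine (pow_dvd_pow _ (le_of_eq ?_)).trans this
      rw [Finset.sum_filter, Fin.sum_univ_succAbove _ j, if_neg hj, zero_add]
      refine Finset.sum_congr rfl fun k _ => ?_
      split_ifs <;> simp
  have := natDegree_le_of_dvd hdvd h0
  rw [natDegree_prod _ _ (fun b _ => pow_ne_zero _ (X_sub_C_ne_zero b))] at this
  simp only [natDegree_pow, natDegree_X_sub_C, mul_one] at this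
  rwa [Finset.sum_fiberwise_of_maps_to (s := Finset.univ) (t := Finset.univ.image node) (g := node)
    (fun i _ => Finset.mem_image_of_mem _ (Finset.mem_univ i))] at this

end Wronskian

/-! ### Linear relations among affine powers -/

section Relations

variable {F : Type u} [Field F]

/-- Among the relations through `i₀`, one of minimal support makes the members other than `i₀`
linearly independent, so that the Wronskian count applies to it. -/
theorem two_mul_add_le_of_relation [CharZero F] {ι : Type*} {g : ι → F[X]} {node : ι → F}
    {m : ι → ℕ} {L : ℕ} (hm : ∀ i, (X - C (node i)) ^ m i ∣ g i)
    (hdeg : ∀ i, (g i).natDegree ≤ m i + L)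
    (hb : ∀ b, LinearIndepOn F g {i | node i = b})
    {c : ι →₀ F} (hc : Finsupp.linearCombination F g c = 0) {i₀ : ι} (hi₀ : i₀ ∈ c.support) :
    2 * m i₀ + c.support.card + 2 ≤ 2 * (c.support.card - 1) * L + c.support.card ^ 2 := by
  classical
  let A : Set (ι →₀ F) := {c | Finsupp.linearCombination F g c = 0 ∧ c i₀ ≠ 0}
  have hcA : c ∈ A := ⟨hc, Finsupp.mem_support_iff.1 hi₀⟩
  obtain ⟨c', ⟨hc', hc'0⟩, hmin⟩ : ∃ c' ∈ A, ∀ d ∈ A, c'.support.card ≤ d.support.card :=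
    ⟨Function.argminOn (fun d : ι →₀ F => d.support.card) A ⟨c, hcA⟩,
      Function.argminOn_mem _ _ _, fun d hd =>
        Function.argminOn_le (fun d : ι →₀ F => d.support.card) A hd⟩
  have hcard := hmin c hcA
  have hi₀' : i₀ ∈ c'.support := Finsupp.mem_support_iff.2 hc'0
  obtain ⟨n, hn⟩ : ∃ n, c'.support.card = n + 1 :=
    Nat.exists_eq_succ_of_ne_zero (Finset.card_ne_zero_of_mem hi₀')
  let σ : Fin (n + 1) ≃ c'.support := (c'.support.equivFinOfCardEq hn).symm
  have hσ0 : ∀ k, c' (σ k) ≠ 0 := fun k => Finsupp.mem_support_iff.1 (σ k).2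
  set k₀ : Fin (n + 1) := σ.symm ⟨i₀, hi₀'⟩ with hk₀
  have hσk₀ : (σ k₀ : ι) = i₀ := by simp [hk₀]
  have hrel : ∑ k, C (c' (σ k)) * g (σ k) = 0 := by
    rw [Finsupp.linearCombination_apply, Finsupp.sum, ← Finset.sum_coe_sort] at hc'
    rw [← hc', ← Equiv.sum_comp σ]
    simp [smul_eq_C_mul]
  have hnode : ∀ i, ∃ j, node (σ j) ≠ node (σ i) := by
    intro i
    by_contra! h
    have := (linearIndepOn_iff.1 (hb (node (σ i)))) c' (by
      rw [Finsupp.mem_supported]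
      intro x hx
      have := h (σ.symm ⟨x, hx⟩)
      simpa using this) hc'
    exact hc'0 (by rw [this]; rfl)
  have hinj : Function.Injective fun k => (σ (k₀.succAbove k) : ι) := fun a b hab =>
    Fin.succAbove_right_injective (σ.injective (Subtype.ext hab))
  have hli : LinearIndependent F (k₀.removeNth fun k => g (σ k)) := by
    rw [Fintype.linearIndependent_iff]
    intro w hw
    by_contra! hne
    obtain ⟨k, hk⟩ := hne
    let w' : ι →₀ F :=
      Finsupp.mapDomain (fun k => (σ (k₀.succAbove k) : ι)) (Finsupp.equivFunOnFinite.symm w)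
    have hw'k : ∀ k, w' (σ (k₀.succAbove k)) = w k := fun k => by
      simpa using Finsupp.mapDomain_apply hinj (Finsupp.equivFunOnFinite.symm w) k
    have hw'0 : w' i₀ = 0 := by
      apply Finsupp.mapDomain_of_notMem_range
      rintro ⟨l, hl⟩
      rw [← hσk₀] at hl
      exact Fin.succAbove_ne k₀ l (σ.injective (Subtype.ext hl))
    have hw's : w'.support ⊆ c'.support := by
      refine Finsupp.mapDomain_support.trans ?_
      intro x hx
      obtain ⟨l, -, rfl⟩ := Finset.mem_image.1 hx
      exact (σ _).2
    have hw'l : Finsupp.linearCombination F g w' = 0 := by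
      rw [Finsupp.linearCombination_mapDomain, Finsupp.linearCombination_apply,
        Finsupp.sum_fintype _ _ (by simp)]
      exact hw
    let d : ι →₀ F := c' - (c' (σ (k₀.succAbove k)) / w k) • w'
    have hd : d ∈ A := ⟨by simp [d, hc', hw'l], by simpa [d, hw'0] using hc'0⟩
    have hdk : d (σ (k₀.succAbove k)) = 0 := by simp [d, hw'k, hk]
    have hlt : d.support.card < c'.support.card := by
      apply Finset.card_lt_card
      rw [Finset.ssubset_iff_of_subset]
      · exact ⟨_, (σ (k₀.succAbove k)).2, by simpa using hdk⟩
      · intro x hx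
        by_contra hx'
        have h1 : c' x = 0 := by simpa using hx'
        have h2 : w' x = 0 := by
          by_contra h; exact hx' (hw's (Finsupp.mem_support_iff.2 h))
        exact Finsupp.mem_support_iff.1 hx (by simp [d, h1, h2])
    exact absurd (hmin d hd) (by omega)
  have key := sum_sub_add_le_of_relation hrel hσ0 (node := fun k => node (σ k)) hnode
    (m := fun k => m (σ k)) (fun k => hm _) k₀ hli
  have hn1 : 1 ≤ n := by
    obtain ⟨j, hj⟩ := hnode k₀
    rcases n with _ | n
    · exact absurd (congrArg (fun x => node (σ x)) (by omega : j = k₀)) hj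
    · omega
  have h1 : ∑ k, m (σ k) ≤ ∑ k, (m (σ k) - (n - 1)) + (n + 1) * (n - 1) := by
    calc _ ≤ ∑ k : Fin (n + 1), ((m (σ k) - (n - 1)) + (n - 1)) :=
          Finset.sum_le_sum fun k _ => by omega
      _ = _ := by rw [Finset.sum_add_distrib]; simp
  have h2 : ∑ k, (k₀.removeNth (fun k => g (σ k)) k).natDegree
      ≤ ∑ k, m (σ (k₀.succAbove k)) + n * L := by
    calc _ ≤ ∑ k : Fin n, (m (σ (k₀.succAbove k)) + L) := Finset.sum_le_sum fun k _ => hdeg _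
      _ = _ := by rw [Finset.sum_add_distrib]; simp
  have h3 : (∑ i : Fin n, (i : ℕ)) * 2 = n * (n - 1) := by
    rw [← Finset.sum_range (fun i => i)]; exact Finset.sum_range_id_mul_two n
  rw [Fin.sum_univ_succAbove _ k₀, hσk₀] at h1
  have hfin : 2 * m i₀ + n * (n - 1) ≤ 2 * (n * L) + 2 * ((n + 1) * (n - 1)) := by
    omega
  obtain ⟨k, rfl⟩ : ∃ k, n = k + 1 := ⟨n - 1, by omega⟩
  obtain ⟨e, he⟩ : ∃ e, c.support.card = k + 2 + e := ⟨c.support.card - (k + 2), by omega⟩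
  rw [he]
  have : k + 2 + e - 1 = k + 1 + e := by omega
  rw [this]
  simp only [Nat.add_sub_cancel] at hfin
  nlinarith [Nat.zero_le (e * L), Nat.zero_le (k * e), Nat.zero_le (e * e)]

/-- The affine power `(x - b) ^ d` of a pair `(b, d)`. -/
noncomputable def affinePower (q : F × ℕ) : F[X] := (X - C q.1) ^ q.2

theorem linearIndepOn_affinePower (b : F) :
    LinearIndepOn F (affinePower (F := F)) {q | q.1 = b} := by
  let S : Polynomial.Sequence F :=
    { elems' := fun d => (X - C b) ^ d
      degree_eq' := fun d => by simp [degree_pow] }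
  have h : LinearIndependent F fun d : ℕ => (X - C b) ^ d := S.linearIndependent
  have := h.comp (fun q : {q : F × ℕ | q.1 = b} => q.1.2) (by
    rintro ⟨⟨x, d⟩, hx⟩ ⟨⟨y, d'⟩, hy⟩ hd
    simp only [Set.mem_ofPred_eq] at hx hy hd
    subst hx hy hd
    rfl)
  have heq : (fun q : {q : F × ℕ | q.1 = b} => affinePower q.1) =
      (fun d : ℕ => (X - C b) ^ d) ∘ fun q : {q : F × ℕ | q.1 = b} => q.1.2 := by
    funext q
    have : q.1.1 = b := q.2
    simp [affinePower, this]
  rw [LinearIndepOn, heq]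
  exact this

/-- A relation among `n` distinct affine powers only involves exponents below `n² / 2`. -/
theorem two_mul_exponent_add_le_of_relation [CharZero F] {β : F × ℕ →₀ F}
    (hβ : Finsupp.linearCombination F affinePower β = 0) {q : F × ℕ} (hq : q ∈ β.support) :
    2 * q.2 + β.support.card + 2 ≤ β.support.card ^ 2 := by
  have := two_mul_add_le_of_relation (g := affinePower) (node := Prod.fst) (m := Prod.snd) (L := 0)
    (fun i => dvd_rfl) (fun i => by simp [affinePower]) linearIndepOn_affinePower hβ hq
  simpa using this

theorem linearIndependent_affinePower_of_card [CharZero F] {ι : Type*} [Fintype ι] {q : ι → F × ℕ}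
    (hq : Function.Injective q) (hd : ∀ i, Fintype.card ι ^ 2 ≤ 2 * (q i).2 + 1) :
    LinearIndependent F fun i => affinePower (q i) := by
  classical
  rw [Fintype.linearIndependent_iff]
  intro w hw i
  by_contra hi
  let β : F × ℕ →₀ F := Finsupp.mapDomain q (Finsupp.equivFunOnFinite.symm w)
  have h1 : Finsupp.linearCombination F affinePower β = 0 := by
    rw [Finsupp.linearCombination_mapDomain, Finsupp.linearCombination_apply,
        Finsupp.sum_fintype _ _ (by simp)]
    exact hw
  have h2 : q i ∈ β.support := by
    rw [Finsupp.mem_support_iff, Finsupp.mapDomain_apply hq]; exact hi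
  have h3 : β.support.card ≤ Fintype.card ι := by
    refine (Finset.card_le_card Finsupp.mapDomain_support).trans ?_
    exact Finset.card_image_le.trans (Finset.card_le_univ _)
  have h4 := two_mul_exponent_add_le_of_relation h1 h2
  have h5 := hd i
  nlinarith

end Relations

/-! ### Shifted differential equations and sums of affine powers -/

section Recovery

variable {F : Type u} [Field F]

theorem satisfies_sum {k : ℕ} {P : ℕ → F[X]} {ι : Type*} (t : Finset ι) {g : ι → F[X]}
    (hg : ∀ i ∈ t, Satisfies k P (g i)) (c : ι → F) : Satisfies k P (∑ i ∈ t, C (c i) * g i) := by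
  unfold Satisfies at *
  simp only [iterate_derivative_sum, iterate_derivative_C_mul, Finset.mul_sum]
  rw [Finset.sum_comm]
  refine Finset.sum_eq_zero fun i hi => ?_
  calc _ = C (c i) * ∑ x ∈ Finset.range (k + 1), P x * derivative^[x] (g i) := by
          rw [Finset.mul_sum]; refine Finset.sum_congr rfl fun x _ => by ring
    _ = 0 := by rw [hg i hi, mul_zero]

/-- The cofactor of `(x - b) ^ (d - k)` in the image of `(x - b) ^ d` under a differential
operator of order `k`. -/
noncomputable def cofactor (k : ℕ) (P : ℕ → F[X]) (q : F × ℕ) : F[X] :=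
  ∑ i ∈ Finset.range (k + 1), P i * (C (q.2.descFactorial i : F) * (X - C q.1) ^ (k - i))

theorem sum_mul_iterate_derivative_affinePower {k : ℕ} (P : ℕ → F[X]) {q : F × ℕ} (hk : k ≤ q.2) :
    ∑ i ∈ Finset.range (k + 1), P i * derivative^[i] (affinePower q)
      = cofactor k P q * (X - C q.1) ^ (q.2 - k) := by
  rw [cofactor, Finset.sum_mul]
  refine Finset.sum_congr rfl fun i hi => ?_
  have hi' : i ≤ k := by simpa [Nat.lt_succ_iff] using hi
  rw [affinePower, iterate_derivative_X_sub_pow, nsmul_eq_mul,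
    show q.2 - i = (k - i) + (q.2 - k) by omega, pow_add]
  simp only [map_natCast]
  ring

theorem satisfies_affinePower_iff {k : ℕ} (P : ℕ → F[X]) {q : F × ℕ} (hk : k ≤ q.2) :
    Satisfies k P (affinePower q) ↔ cofactor k P q = 0 := by
  rw [Satisfies, sum_mul_iterate_derivative_affinePower P hk, mul_eq_zero,
    or_iff_left (pow_ne_zero _ (X_sub_C_ne_zero _))]

theorem natDegree_cofactor_le {k : ℕ} {P : ℕ → F[X]} (hP : ∀ i ≤ k, (P i).natDegree ≤ i)
    (q : F × ℕ) : (cofactor k P q).natDegree ≤ k := by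
  refine natDegree_sum_le_of_forall_le _ _ fun i hi => ?_
  have hi' : i ≤ k := by simpa [Nat.lt_succ_iff] using hi
  refine natDegree_mul_le.trans ?_
  have h1 := hP i hi'
  have h2 := natDegree_C_mul_le (q.2.descFactorial i : F) ((X - C q.1) ^ (k - i))
  rw [natDegree_pow, natDegree_X_sub_C, mul_one] at h2
  omega

/-- A node of a solution of large exponent is a root of the leading coefficient. -/
theorem eval_eq_zero_of_satisfies_affinePower [CharZero F] {k : ℕ} {P : ℕ → F[X]} {q : F × ℕ}
    (hk : k ≤ q.2) (h : Satisfies k P (affinePower q)) : (P k).eval q.1 = 0 := by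
  have h1 := (satisfies_affinePower_iff P hk).1 h
  have h2 : (cofactor k P q).eval q.1 = (P k).eval q.1 * (q.2.descFactorial k : F) := by
    rw [cofactor, eval_finsetSum, Finset.sum_eq_single k]
    · simp
    · intro i hi hik
      have : i < k := by have := Finset.mem_range.1 hi; omega
      simp [zero_pow (by omega : k - i ≠ 0)]
    · simp
  rw [h1, eval_zero] at h2
  refine (mul_eq_zero.1 h2.symm).resolve_right ?_
  exact_mod_cast (Nat.descFactorial_pos.2 hk).ne'

/-- A sum of `s ≥ 1` affine powers of large exponents satisfies an equation of order `2 s - 1`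
and shift `0`: there are more coefficients to choose than conditions. -/
theorem exists_isSDE_of_affinePowers {s : ℕ} (hs : 0 < s) (q : Fin s → F × ℕ)
    (hq : ∀ j, 2 * s - 1 ≤ (q j).2) :
    ∃ Q : ℕ → F[X], IsSDE (2 * s - 1) 0 Q ∧ ∀ j, Satisfies (2 * s - 1) Q (affinePower (q j)) := by
  classical
  set k := 2 * s - 1 with hk
  let B : (Σ i : Fin (k + 1), Fin (i + 1)) → Fin s → F[X] := fun p j =>
    X ^ (p.2 : ℕ) * (C ((q j).2.descFactorial p.1 : F) * (X - C (q j).1) ^ (k - p.1))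
  let φ := Fintype.linearCombination F
    (fun p => fun (x : Fin s × Fin (k + 1)) => (B p x.1).coeff x.2)
  have hker : LinearMap.ker φ ≠ ⊥ := by
    apply LinearMap.ker_ne_bot_of_finrank_lt
    have : (∑ i : Fin (k + 1), ((i : ℕ) + 1)) * 2 = (k + 2) * (k + 1) := by
      have h1 := Finset.sum_range_succ' (fun i => i) (k + 1)
      rw [← Finset.sum_range (fun i => i + 1)]
      rw [add_zero] at h1
      rw [← h1]
      exact Finset.sum_range_id_mul_two (k + 2)
    simp only [Module.finrank_fintype_fun_eq_card, Fintype.card_prod, Fintype.card_fin,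
      Fintype.card_sigma]
    have h2 : k + 1 = 2 * s := by omega
    nlinarith
  obtain ⟨w, hw, hw0⟩ := (Submodule.ne_bot_iff _).1 hker
  let Q : ℕ → F[X] := fun i =>
    if h : i < k + 1 then ∑ l : Fin (i + 1), C (w ⟨⟨i, h⟩, l⟩) * X ^ (l : ℕ) else 0
  have hQc : ∀ (i : Fin (k + 1)) (l : Fin (i + 1)), (Q i).coeff l = w ⟨i, l⟩ := by
    intro i l
    simp only [Q, i.2, dif_pos, finsetSum_coeff, coeff_C_mul, coeff_X_pow]
    rw [Finset.sum_eq_single l]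
    · simp
    · intro b _ hb
      rw [if_neg (fun h => hb (Fin.ext h.symm)), mul_zero]
    · simp
  have hdeg : ∀ i, (Q i).natDegree ≤ i := by
    intro i
    by_cases h : i < k + 1
    · simp only [Q, h, dif_pos]
      refine natDegree_sum_le_of_forall_le _ _ fun l _ => ?_
      exact (natDegree_C_mul_X_pow_le _ _).trans (by omega)
    · simp only [Q, h, dif_neg, not_false_eq_true, natDegree_zero, Nat.zero_le]
  refine ⟨Q, ⟨?_, fun i _ => by simpa using hdeg i⟩, fun j => ?_⟩
  · obtain ⟨⟨i, l⟩, hil⟩ := Function.ne_iff.1 hw0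
    refine ⟨i, by omega, fun h => hil ?_⟩
    rw [← hQc, h]; simp
  · rw [satisfies_affinePower_iff Q (hq j)]
    have hsum : cofactor k Q (q j) = ∑ p, C (w p) * B p j := by
      rw [cofactor, Finset.sum_range, Fintype.sum_sigma]
      refine Finset.sum_congr rfl fun i _ => ?_
      simp only [Q, i.2, dif_pos, Finset.sum_mul, B]
      exact Finset.sum_congr rfl fun l _ => by ring
    ext m
    by_cases hm : m < k + 1
    · have := congrFun (LinearMap.mem_ker.1 hw) (j, ⟨m, hm⟩)
      rw [hsum, finsetSum_coeff, coeff_zero]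
      simpa [φ, Fintype.linearCombination_apply] using this
    · rw [coeff_zero]
      exact coeff_eq_zero_of_natDegree_lt
        (lt_of_le_of_lt (natDegree_cofactor_le (fun i _ => hdeg i) _) (by omega))

theorem exists_isSDE_natDegree_succ (f : F[X]) :
    ∃ Q : ℕ → F[X], IsSDE (f.natDegree + 1) 0 Q ∧ Satisfies (f.natDegree + 1) Q f := by
  refine ⟨fun i => if i = f.natDegree + 1 then 1 else 0, ⟨⟨_, le_rfl, by simp⟩, fun i _ => ?_⟩, ?_⟩
  · dsimp only; split_ifs <;> simp
  · rw [Satisfies, Finset.sum_range_succ, Finset.sum_eq_zero, if_pos rfl,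
      iterate_derivative_eq_zero (Nat.lt_succ_self _)]
    · simp
    · intro i hi
      rw [if_neg (Finset.mem_range.1 hi).ne, zero_mul]

theorem IsMinimalSDE.leadingCoeff_ne_zero {f : F[X]} {r : ℕ} {P : ℕ → F[X]}
    (h : IsMinimalSDE f r P) : P r ≠ 0 := by
  intro h0
  obtain ⟨⟨-, hmin⟩, ⟨⟨i, hi, hi0⟩, hdeg⟩, hsat⟩ := h
  rcases r with _ | r
  · obtain rfl : i = 0 := by omega
    exact hi0 h0
  · have : r ∈ {k : ℕ | ∃ Q : ℕ → F[X], IsSDE k 0 Q ∧ Satisfies k Q f} := by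
      refine ⟨P, ⟨⟨i, ?_, hi0⟩, fun i hi => hdeg i (by omega)⟩, ?_⟩
      · rcases hi.lt_or_eq with h | rfl
        · omega
        · exact absurd h0 hi0
      · rw [Satisfies, Finset.sum_range_succ, h0, zero_mul, add_zero] at hsat
        exact hsat
    have := hmin this
    omega

namespace IsBigExponentDecomposition

variable {f : F[X]} {s : ℕ} {α a : Fin s → F} {e : Fin s → ℕ}

theorem five_mul_sq_lt (h : IsBigExponentDecomposition f s α a e) (i : Fin s) :
    5 * s ^ 2 < 2 * e i := by
  have := h.exponent_big i
  rw [div_lt_iff₀ (by norm_num)] at this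
  have h2 : 5 * s ^ 2 < e i * 2 := by exact_mod_cast this
  omega

theorem two_mul_le_exponent (h : IsBigExponentDecomposition f s α a e) (i : Fin s) :
    2 * s ≤ e i := by
  have h1 := h.five_mul_sq_lt i
  have h2 : s * 1 ≤ s * s := Nat.mul_le_mul_left _ i.pos
  nlinarith

theorem pairs_injective (h : IsBigExponentDecomposition f s α a e) :
    Function.Injective fun i => (a i, e i) := fun _ _ hij =>
  h.nodes_distinct (congrArg Prod.fst hij)

theorem eq_sum_affinePower (h : IsBigExponentDecomposition f s α a e) :
    f = ∑ i, C (α i) * affinePower (a i, e i) := h.eq_sum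

theorem linearIndependent (h : IsBigExponentDecomposition f s α a e) [CharZero F] :
    LinearIndependent F fun i => affinePower (a i, e i) :=
  linearIndependent_affinePower_of_card h.pairs_injective fun i => by
    have := h.five_mul_sq_lt i
    simp only [Fintype.card_fin]
    omega

/-- The difference of two decompositions of `f` is a relation among at most `2 s - 1` affine
powers if the second one is shorter; it involves a term of the first one, whose exponent is too
large for that. -/
theorem affPow_eq [CharZero F] (h : IsBigExponentDecomposition f s α a e) : affPow f = s := by
  classical
  refine le_antisymm (Nat.sInf_le ⟨α, a, e, h.eq_sum⟩) (le_csInf ⟨s, α, a, e, h.eq_sum⟩ ?_)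
  rintro t ⟨γ, b, d, hf⟩
  by_contra! hts
  let β₁ : F × ℕ →₀ F :=
    Finsupp.mapDomain (fun i => (a i, e i)) (Finsupp.equivFunOnFinite.symm α)
  let β₂ : F × ℕ →₀ F :=
    Finsupp.mapDomain (fun i => (b i, d i)) (Finsupp.equivFunOnFinite.symm γ)
  have h1 : Finsupp.linearCombination F affinePower β₁ = f := by
    rw [Finsupp.linearCombination_mapDomain, Finsupp.linearCombination_apply,
      Finsupp.sum_fintype _ _ (by simp), h.eq_sum]
    simp [smul_eq_C_mul, affinePower]
  have h2 : Finsupp.linearCombination F affinePower β₂ = f := by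
    rw [Finsupp.linearCombination_mapDomain, Finsupp.linearCombination_apply,
      Finsupp.sum_fintype _ _ (by simp), hf]
    simp [smul_eq_C_mul, affinePower]
  have hβ₁ : ∀ i, β₁ (a i, e i) = α i := fun i =>
    Finsupp.mapDomain_apply h.pairs_injective _ i
  have c2 : β₂.support.card ≤ t := by
    refine (Finset.card_le_card Finsupp.mapDomain_support).trans ?_
    exact Finset.card_image_le.trans ((Finset.card_le_univ _).trans (Fintype.card_fin _).le)
  have c1 : β₁.support.card ≤ s := by
    refine (Finset.card_le_card Finsupp.mapDomain_support).trans ?_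
    exact Finset.card_image_le.trans ((Finset.card_le_univ _).trans (Fintype.card_fin _).le)
  obtain ⟨i, hi⟩ : ∃ i, (a i, e i) ∉ β₂.support := by
    by_contra! hall
    have : (Finset.univ.image fun i => (a i, e i)) ⊆ β₂.support := by
      intro x hx
      obtain ⟨i, -, rfl⟩ := Finset.mem_image.1 hx
      exact hall i
    have := Finset.card_le_card this
    rw [Finset.card_image_of_injective _ h.pairs_injective, Finset.card_univ, Fintype.card_fin]
      at this
    omega
  have hmem : (a i, e i) ∈ (β₁ - β₂).support := by
    rw [Finsupp.mem_support_iff, Finsupp.sub_apply, hβ₁, Finsupp.notMem_support_iff.1 hi, sub_zero]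
    exact h.coeff_ne_zero i
  have hcard : (β₁ - β₂).support.card ≤ s + t := by
    refine (Finset.card_le_card Finsupp.support_sub).trans ((Finset.card_union_le _ _).trans ?_)
    omega
  have key := two_mul_exponent_add_le_of_relation (by rw [map_sub, h1, h2, sub_self]) hmem
  have hbig := h.five_mul_sq_lt i
  simp only at key
  nlinarith

/-- The terms of `f` satisfy every equation of small order that `f` satisfies: otherwise their
images under the differential operator are linearly dependent. -/
theorem satisfies_affinePower [CharZero F] (h : IsBigExponentDecomposition f s α a e) {k : ℕ}
    {P : ℕ → F[X]} (hk : k ≤ 2 * s - 1) (hP : IsSDE k 0 P) (hf : Satisfies k P f) (i : Fin s) :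
    Satisfies k P (affinePower (a i, e i)) := by
  classical
  have hke : ∀ j, k ≤ e j := fun j => by
    have := h.two_mul_le_exponent j
    omega
  have hsat : ∀ j, Satisfies k P (affinePower (a j, e j)) ↔ cofactor k P (a j, e j) = 0 :=
    fun j => satisfies_affinePower_iff P (hke j)
  by_contra hi
  rw [hsat] at hi
  -- the relation among the nonzero images
  let ι := {j // cofactor k P (a j, e j) ≠ 0}
  let g : ι → F[X] := fun j => cofactor k P (a j, e j) * (X - C (a j)) ^ (e j - k)
  have hg0 : ∀ j, g j ≠ 0 := fun j => mul_ne_zero j.2 (pow_ne_zero _ (X_sub_C_ne_zero _))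
  let c : ι →₀ F := Finsupp.equivFunOnFinite.symm fun j => α j
  have hrel : Finsupp.linearCombination F g c = 0 := by
    rw [Finsupp.linearCombination_apply, Finsupp.sum_fintype _ _ (by simp)]
    have h1 : ∑ j, C (α j) * (cofactor k P (a j, e j) * (X - C (a j)) ^ (e j - k)) = 0 := by
      rw [Satisfies, h.eq_sum_affinePower] at hf
      rw [← hf]
      simp only [iterate_derivative_sum, iterate_derivative_C_mul, Finset.mul_sum]
      rw [Finset.sum_comm]
      refine Finset.sum_congr rfl fun j _ => ?_
      rw [← sum_mul_iterate_derivative_affinePower P (q := (a j, e j)) (hke j), Finset.mul_sum]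
      exact Finset.sum_congr rfl fun x _ => by ring
    refine Eq.trans ?_ h1
    rw [← Finset.sum_filter_add_sum_filter_not Finset.univ
      (fun j => cofactor k P (a j, e j) ≠ 0)]
    rw [Finset.sum_eq_zero (s := Finset.univ.filter fun j => ¬ cofactor k P (a j, e j) ≠ 0),
      add_zero]
    · have hs := Finset.sum_subtype (F := inferInstanceAs (Fintype ι))
        (p := fun j => cofactor k P (a j, e j) ≠ 0)
        (Finset.univ.filter fun j => cofactor k P (a j, e j) ≠ 0) (by simp)
        (fun j => C (α j) * (cofactor k P (a j, e j) * (X - C (a j)) ^ (e j - k)))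
      rw [hs]
      simp only [c, g, smul_eq_C_mul]
      rfl
    · intro j hj
      rw [not_not.1 (Finset.mem_filter.1 hj).2]
      simp
  have key := two_mul_add_le_of_relation (g := g) (node := fun j => a j) (m := fun j => e j - k)
    (L := k) (fun j => dvd_mul_left _ _) (fun j => by
      refine natDegree_mul_le.trans ?_
      rw [natDegree_pow, natDegree_X_sub_C, mul_one]
      have := natDegree_cofactor_le (fun i hi => by simpa using hP.2 i hi) (a j, e j)
      omega) (fun b => by
      have : ({j | a j = b} : Set ι).Subsingleton := fun x hx y hy =>
        Subtype.ext (h.nodes_distinct (hx.trans hy.symm))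
      rcases this.eq_empty_or_singleton with h0 | ⟨x, hx⟩
      · rw [h0]; exact linearIndepOn_empty _ _
      · rw [hx]; exact (linearIndepOn_singleton_iff F).2 (hg0 x)) hrel (i₀ := ⟨i, hi⟩)
      (Finsupp.mem_support_iff.2 (h.coeff_ne_zero i))
  have hcard : c.support.card ≤ s := by
    refine (Finset.card_le_univ _).trans ?_
    exact (Fintype.card_subtype_le _).trans (by simp)
  have hpos : 0 < c.support.card := Finset.card_pos.2
    ⟨⟨i, hi⟩, Finsupp.mem_support_iff.2 (h.coeff_ne_zero i)⟩
  have hbig := h.five_mul_sq_lt i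
  have := hke i
  obtain ⟨m, hm⟩ : ∃ m, c.support.card = m + 1 := ⟨c.support.card - 1, by omega⟩
  obtain ⟨t, rfl⟩ : ∃ t, s = m + 1 + t := ⟨s - (m + 1), by omega⟩
  rw [hm] at key
  simp only [Nat.add_sub_cancel] at key
  have hk' : k ≤ 2 * m + 2 * t + 1 := by omega
  have hkm : k * m ≤ (2 * m + 2 * t + 1) * m := Nat.mul_le_mul_right _ hk'
  have hke' : e i = (e i - k) + k := by omega
  nlinarith [Nat.zero_le (m * t), Nat.zero_le (t * t)]

/-- The exponents exceed the degree of `f` by little, as `f` may replace one of the terms in a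
basis of the space that they span. -/
theorem two_mul_exponent_le [CharZero F] (h : IsBigExponentDecomposition f s α a e) (i : Fin s) :
    2 * e i ≤ 2 * f.natDegree + s ^ 2 := by
  classical
  -- `f` gets a node of its own, where no multiplicity is claimed
  obtain ⟨x, hx⟩ := Infinite.exists_notMem_finset (Finset.univ.image a)
  have hxa : ∀ j, a j ≠ x := fun j hj => hx (by rw [← hj]; simp)
  let g : Fin (s + 1) → F[X] := Fin.cons f fun j => affinePower (a j, e j)
  let c : Fin (s + 1) → F := Fin.cons (-1) α
  let node : Fin (s + 1) → F := Fin.cons x a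
  let m : Fin (s + 1) → ℕ := Fin.cons 0 e
  have hrel : ∑ i, C (c i) * g i = 0 := by
    rw [Fin.sum_univ_succ]
    simp only [c, g, Fin.cons_zero, Fin.cons_succ, map_neg, map_one]
    rw [← h.eq_sum_affinePower]; ring
  have hli : LinearIndependent F (i.succ.removeNth g) := by
    rw [Fintype.linearIndependent_iff]
    intro w hw
    let w' : Fin (s + 1) → F := i.succ.insertNth 0 w
    have h1 : ∑ j, w' j • g j = 0 := by
      rw [Fin.sum_univ_succAbove _ i.succ]
      simpa [w', Fin.removeNth] using hw
    have h2 : ∑ j, (w' 0 * α j + w' j.succ) • affinePower (a j, e j) = 0 := by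
      rw [Fin.sum_univ_succ] at h1
      simp only [g, Fin.cons_zero, Fin.cons_succ] at h1
      rw [← h1]
      conv_rhs => rw [h.eq_sum_affinePower]
      rw [Finset.smul_sum, ← Finset.sum_add_distrib]
      refine Finset.sum_congr rfl fun j _ => ?_
      rw [add_smul, mul_smul, smul_eq_C_mul (α j)]
    have h3 := Fintype.linearIndependent_iff.1 h.linearIndependent _ h2
    have h4 : w' 0 = 0 := by
      have := h3 i
      have hi : w' i.succ = 0 := by simp [w']
      rw [hi, add_zero] at this
      exact (mul_eq_zero.1 this).resolve_right (h.coeff_ne_zero i)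
    have h5 : ∀ j, w' j = 0 := by
      intro j
      refine Fin.cases h4 (fun j => ?_) j
      have := h3 j
      rwa [h4, zero_mul, zero_add] at this
    intro j
    have := h5 (i.succ.succAbove j)
    simpa [w'] using this
  have hc : ∀ j, c j ≠ 0 := by
    intro j
    refine Fin.cases ?_ (fun j => ?_) j
    · simp [c]
    · simpa [c] using h.coeff_ne_zero j
  have hnode : ∀ j, ∃ l, node l ≠ node j := by
    intro j
    refine Fin.cases ⟨i.succ, by simpa [node] using hxa i⟩ (fun j => ⟨0, ?_⟩) j
    simpa [node] using (hxa j).symm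
  have key := sum_sub_add_le_of_relation hrel hc hnode (m := m) (by
    intro j
    refine Fin.cases ?_ (fun j => ?_) j
    · simp [m]
    · simp [m, node, g, affinePower]) i.succ hli
  have e1 : ∑ j, (g j).natDegree = f.natDegree + ∑ j, e j := by
    rw [Fin.sum_univ_succ]; simp [g, affinePower]
  have e2 : ∑ j, (g j).natDegree = e i + ∑ j, (i.succ.removeNth g j).natDegree := by
    rw [Fin.sum_univ_succAbove _ i.succ]; simp [g, affinePower, Fin.removeNth]
  have e3 : (∑ i : Fin s, (i : ℕ)) * 2 = s * (s - 1) := by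
    rw [← Finset.sum_range (fun i => i)]; exact Finset.sum_range_id_mul_two s
  have e4 : ∑ j, e j ≤ ∑ j, (m j - (s - 1)) + s * (s - 1) := by
    rw [Fin.sum_univ_succ]
    calc ∑ j, e j ≤ ∑ j : Fin s, ((e j - (s - 1)) + (s - 1)) :=
          Finset.sum_le_sum fun k _ => by omega
      _ ≤ _ := by rw [Finset.sum_add_distrib]; simp [m]
  have e5 : s * (s - 1) ≤ s ^ 2 := by rw [pow_two]; exact Nat.mul_le_mul_left _ (Nat.sub_le _ _)
  omega

variable {r : ℕ} {P : ℕ → F[X]}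

theorem order_le [CharZero F] (h : IsBigExponentDecomposition f s α a e)
    (hr : IsMinimalSDE f r P) : r ≤ 2 * s - 1 := by
  apply hr.1.2
  rcases Nat.eq_zero_or_pos s with rfl | hs
  · have : f = 0 := by rw [h.eq_sum]; simp
    exact ⟨fun _ => 1, ⟨⟨0, by simp, one_ne_zero⟩, by simp⟩, by simp [Satisfies, this]⟩
  · obtain ⟨Q, hQ, hQs⟩ := exists_isSDE_of_affinePowers hs (fun i => (a i, e i)) (fun j => by
      have := h.two_mul_le_exponent j
      simp only
      omega)
    refine ⟨Q, hQ, ?_⟩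
    rw [h.eq_sum_affinePower]
    exact satisfies_sum _ (fun i _ => hQs i) α

end IsBigExponentDecomposition

theorem mem_powerSolutions_iff {f : F[X]} {r : ℕ} {P : ℕ → F[X]} {q : F × ℕ} :
    q ∈ powerSolutions f r P ↔ (r + 1) ^ 2 ≤ 2 * q.2 ∧ 2 * q.2 ≤ 2 * f.natDegree + r ^ 2 ∧
      Satisfies r P (affinePower q) := by
  have h1 : ((r : ℚ) + 1) ^ 2 / 2 ≤ (q.2 : ℚ) ↔ (r + 1) ^ 2 ≤ 2 * q.2 := by
    rw [div_le_iff₀ (by norm_num), ← @Nat.cast_le ℚ]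
    push_cast
    rw [mul_comm]
  have h2 : (q.2 : ℚ) ≤ (f.natDegree : ℚ) + (r : ℚ) ^ 2 / 2 ↔
      2 * q.2 ≤ 2 * f.natDegree + r ^ 2 := by
    rw [← @Nat.cast_le ℚ]
    push_cast
    constructor <;> intro h <;> linarith
  rw [powerSolutions, Set.mem_ofPred_eq, h1, h2]
  rfl

theorem le_exponent_of_mem_powerSolutions {f : F[X]} {r : ℕ} {P : ℕ → F[X]} {q : F × ℕ}
    (hq : q ∈ powerSolutions f r P) : r ≤ q.2 := by
  have := (mem_powerSolutions_iff.1 hq).1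
  nlinarith

/-- More than `r` elements of the set would give too many linearly independent solutions. -/
theorem powerSolutions_finite_and_ncard_le [CharZero F] {f : F[X]} {r : ℕ} {P : ℕ → F[X]}
    (hP : ∃ i ≤ r, P i ≠ 0) :
    (powerSolutions f r P).Finite ∧ (powerSolutions f r P).ncard ≤ r := by
  rw [← Set.encard_le_coe_iff_finite_ncard_le]
  by_contra! hlt
  obtain ⟨t, ht, htc⟩ := Set.exists_subset_encard_eq (s := powerSolutions f r P) (k := (r + 1 : ℕ))
    (by rw [Nat.cast_add_one]; exact Order.add_one_le_of_lt hlt)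
  have htf : t.Finite := Set.finite_of_encard_eq_coe htc
  have hcard : htf.toFinset.card = r + 1 := by
    rw [htf.encard_eq_coe_toFinset_card] at htc; exact_mod_cast htc
  let σ := (htf.toFinset.equivFinOfCardEq hcard).symm
  have hσ : ∀ i, (σ i : F × ℕ) ∈ powerSolutions f r P := fun i =>
    ht (htf.mem_toFinset.1 (σ i).2)
  refine not_linearIndependent_of_satisfies hP (g := fun i => affinePower (σ i : F × ℕ))
    (fun i => (mem_powerSolutions_iff.1 (hσ i)).2.2) ?_
  refine linearIndependent_affinePower_of_card
    (fun i j hij => σ.injective (Subtype.ext hij)) fun i => ?_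
  have := (mem_powerSolutions_iff.1 (hσ i)).1
  rw [Fintype.card_fin]
  omega

theorem linearIndepOn_powerSolutions [CharZero F] {f : F[X]} {r : ℕ} {P : ℕ → F[X]}
    (hP : ∃ i ≤ r, P i ≠ 0) : LinearIndepOn F affinePower (powerSolutions f r P) := by
  rw [linearIndepOn_iff]
  intro β hβ h0
  by_contra hne
  obtain ⟨q, hq⟩ := Finsupp.support_nonempty_iff.2 hne
  rw [Finsupp.mem_supported] at hβ
  obtain ⟨hfin, hcard⟩ := powerSolutions_finite_and_ncard_le (f := f) hP
  have h1 : β.support.card ≤ r := by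
    rw [← Set.ncard_coe_finset]
    exact (Set.ncard_le_ncard hβ hfin).trans hcard
  have h2 := two_mul_exponent_add_le_of_relation h0 hq
  have h3 := (mem_powerSolutions_iff.1 (hβ hq)).1
  nlinarith

namespace IsBigExponentDecomposition

variable {f : F[X]} {s : ℕ} {α a : Fin s → F} {e : Fin s → ℕ} {r : ℕ} {P : ℕ → F[X]}

theorem mem_powerSolutions [CharZero F] (h : IsBigExponentDecomposition f s α a e)
    (hr : IsMinimalSDE f r P) (i : Fin s) : (a i, e i) ∈ powerSolutions f r P := by
  have hle := h.order_le hr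
  have hsat := h.satisfies_affinePower hle hr.2.1 hr.2.2
  have hbig := h.five_mul_sq_lt i
  have hup := h.two_mul_exponent_le i
  have hspos : 0 < s := i.pos
  have hsr : s ≤ r := by
    by_contra! hlt
    refine not_linearIndependent_of_satisfies hr.2.1.1 (g := fun j : Fin (r + 1) =>
      affinePower (a (Fin.castLE hlt j), e (Fin.castLE hlt j))) (fun j => hsat _) ?_
    exact h.linearIndependent.comp _ (Fin.castLE_injective hlt)
  rw [mem_powerSolutions_iff]
  refine ⟨?_, ?_, hsat i⟩
  · have : r + 1 ≤ 2 * s := by omega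
    simp only
    nlinarith
  · simp only
    nlinarith

theorem linearCombination_sum_single (h : IsBigExponentDecomposition f s α a e) :
    Finsupp.linearCombination F affinePower (∑ i, Finsupp.single (a i, e i) (α i)) = f := by
  rw [map_sum, h.eq_sum_affinePower]
  simp [smul_eq_C_mul]

/-- `f` has only one expression in terms of the members of `powerSolutions f r P`. -/
theorem subset_and_eq_sum_iff [CharZero F] (h : IsBigExponentDecomposition f s α a e)
    (hr : IsMinimalSDE f r P) (β : F × ℕ →₀ F) :
    ((β.support : Set (F × ℕ)) ⊆ powerSolutions f r P ∧
      f = Finsupp.linearCombination F affinePower β) ↔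
      β = ∑ i, Finsupp.single (a i, e i) (α i) := by
  classical
  have hsupp : (∑ i, Finsupp.single (a i, e i) (α i)) ∈
      Finsupp.supported F F (powerSolutions f r P) :=
    Submodule.sum_mem _ fun i _ => Finsupp.single_mem_supported _ _ (h.mem_powerSolutions hr i)
  constructor
  · rintro ⟨h1, h2⟩
    have := (linearIndepOn_iff.1 (linearIndepOn_powerSolutions (f := f) hr.2.1.1))
      (β - ∑ i, Finsupp.single (a i, e i) (α i))
      (Submodule.sub_mem _ ((Finsupp.mem_supported _ _).2 h1) hsupp)
      (by rw [map_sub, ← h2, h.linearCombination_sum_single, sub_self])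
    exact sub_eq_zero.1 this
  · rintro rfl
    exact ⟨(Finsupp.mem_supported _ _).1 hsupp, h.linearCombination_sum_single.symm⟩

end IsBigExponentDecomposition

end Recovery

/-! ### Polynomially bounded programs -/

section Bounds

/-- The magnitude of a value: the largest counter and the largest length of a list in it.  Unlike
the total size, it does not grow when values are paired or rearranged. -/
def mag {F : Type u} : (τ : Ty) → τ.Val F → ℕ
  | .nat, x => x.down
  | .fld, _ => 0
  | .prod a b, x => max (mag a x.1) (mag b x.2)
  | .list a, l => (List.map (mag a) l).foldr max (List.length l)

theorem mag_list_le {F : Type u} {a : Ty} {l : List (a.Val F)} {n : ℕ} :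
    mag (.list a) l ≤ n ↔ l.length ≤ n ∧ ∀ y ∈ l, mag a y ≤ n := by
  have key : ∀ (l' : List (a.Val F)) (m : ℕ), (List.map (mag a) l').foldr max m ≤ n ↔
      m ≤ n ∧ ∀ y ∈ l', mag a y ≤ n := by
    intro l' m
    induction l' with
    | nil => simp
    | cons y l' ih => simp [ih]; tauto
  exact key l l.length

theorem length_le_mag {F : Type u} {a : Ty} (l : List (a.Val F)) : l.length ≤ mag (.list a) l :=
  (mag_list_le.1 le_rfl).1

theorem mag_le_of_mem {F : Type u} {a : Ty} {l : List (a.Val F)} {y : a.Val F} (hy : y ∈ l) :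
    mag a y ≤ mag (.list a) l :=
  (mag_list_le.1 le_rfl).2 y hy

theorem mag_fldList {F : Type u} (l : List F) : mag (.list .fld) l = l.length :=
  le_antisymm (mag_list_le.2 ⟨le_rfl, fun _ _ => Nat.zero_le _⟩) (length_le_mag (a := .fld) l)

/-- The steps and the output of a program are bounded by the `k`-th power of the input, in terms
of magnitudes (increased by `2`, so that powers of it absorb constants and sums). -/
def BoundedBy (k : ℕ) {σ τ : Ty} (p : Prog σ τ) : Prop :=
  ∀ (F : Type u) [Field F] (R : List F → List F), IsRootFinder R → ∀ x : σ.Val F,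
    p.steps R x ≤ (mag σ x + 2) ^ k ∧ mag τ (p.eval R x) + 2 ≤ (mag σ x + 2) ^ k

/-- A program runs in polynomial time, uniformly in the field and the root finder.  This is a type
class, so that the bound for a composite program is found by instance search. -/
class PolyTime {σ τ : Ty} (p : Prog σ τ) : Prop where
  exists_boundedBy : ∃ k, BoundedBy.{u} k p

/-- The body of a loop increases the magnitude of the state by an amount that does not depend on
the state, so that the state stays polynomially bounded through the loop. -/
def AddsBounded {σ a τ : Ty} (w : Prog (.prod σ (.prod a τ)) τ) : Prop :=
  ∃ c : ℕ, ∀ (F : Type u) [Field F] (R : List F → List F), IsRootFinder R →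
    ∀ (x : σ.Val F) (y : a.Val F) (t : τ.Val F),
      mag τ (w.eval R (x, (y, t))) ≤ mag τ t + (max (mag σ x) (mag a y) + 2) ^ c

theorem BoundedBy.mono {k l : ℕ} (hkl : k ≤ l) {σ τ : Ty} {p : Prog σ τ}
    (h : BoundedBy.{u} k p) : BoundedBy.{u} l p := by
  intro F _ R hR x
  have hle : (mag σ x + 2) ^ k ≤ (mag σ x + 2) ^ l := Nat.pow_le_pow_right (by omega) hkl
  exact ⟨(h F R hR x).1.trans hle, (h F R hR x).2.trans hle⟩

theorem add_add_one_le_pow {B a b k : ℕ} (hB : 2 ≤ B) (ha : a ≤ B ^ k) (hb : b ≤ B ^ k) :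
    a + b + 1 ≤ B ^ (k + 2) := by
  have h1 : 1 ≤ B ^ k := Nat.one_le_pow _ _ (by omega)
  have h2 : 2 * 2 ≤ B * B := Nat.mul_le_mul hB hB
  calc a + b + 1 ≤ B ^ k * (2 * 2) := by omega
    _ ≤ B ^ k * (B * B) := Nat.mul_le_mul_left _ h2
    _ = B ^ (k + 2) := by ring

/-- If the body enlarges the state by at most `D`, then the state stays linearly bounded, and so all
the passes through the loop have a common bound. -/
theorem loopSteps_le {A T : Type*} {body : A → T → T} {cost : A → T → ℕ} {m : T → ℕ}
    {D E k : ℕ} (l : List A) (hbody : ∀ y ∈ l, ∀ t, m (body y t) ≤ m t + D)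
    (hcost : ∀ y ∈ l, ∀ t, cost y t ≤ (max E (m t) + 2) ^ k) (t : T) {M : ℕ} (ht : m t ≤ M) :
    loopSteps body cost l t ≤ l.length * ((max E (M + l.length * D) + 2) ^ k + 1) ∧
      m (l.foldl (fun t y => body y t) t) ≤ M + l.length * D := by
  induction l generalizing t M with
  | nil => simpa [loopSteps] using ht
  | cons y l ih =>
    have hb := hbody y (by simp) t
    have hc := hcost y (by simp) t
    obtain ⟨h1, h2⟩ := ih (fun y hy => hbody y (by simp [hy])) (fun y hy => hcost y (by simp [hy]))
      (body y t) (M := M + D) (by omega)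
    have e : M + D + l.length * D = M + (y :: l).length * D := by
      rw [List.length_cons]; ring
    rw [e] at h1 h2
    refine ⟨?_, h2⟩
    have hc' : cost y t ≤ (max E (M + (y :: l).length * D) + 2) ^ k := by
      refine hc.trans (Nat.pow_le_pow_left ?_ _)
      have : m t ≤ M + (y :: l).length * D := ht.trans (Nat.le_add_right _ _)
      omega
    rw [loopSteps, List.length_cons, Nat.succ_mul]
    rw [List.length_cons] at hc' h1
    omega

/-- The arithmetic common to the two kinds of loops. -/
theorem loop_bound {A T : Type*} {body : A → T → T} {cost : A → T → ℕ} {m : T → ℕ}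
    {B k c : ℕ} (hB : 2 ≤ B) (l : List A) (t : T) (hl : l.length ≤ B ^ k) (ht : m t ≤ B ^ k)
    (hbody : ∀ y ∈ l, ∀ t, m (body y t) ≤ m t + (B ^ k) ^ c)
    (hcost : ∀ y ∈ l, ∀ t, cost y t ≤ (max (B ^ k) (m t) + 2) ^ k) {sp sq : ℕ}
    (hp : sp ≤ B ^ k) (hq : sq ≤ B ^ k) :
    sp + sq + 1 + loopSteps body cost l t ≤ B ^ ((k + k * c + 3) * k + 2 * k + 5) ∧
      m (l.foldl (fun t y => body y t) t) + 2 ≤ B ^ ((k + k * c + 3) * k + 2 * k + 5) := by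
  obtain ⟨h1, h2⟩ := loopSteps_le l hbody hcost t ht
  have hone : ∀ j, 1 ≤ B ^ j := fun j => Nat.one_le_pow _ _ (by omega)
  have hk := hone k
  have hsk : B ^ k + l.length * (B ^ k) ^ c ≤ B ^ (k + k * c + 1) := by
    calc B ^ k + l.length * (B ^ k) ^ c ≤ B ^ k * (B ^ k) ^ c + B ^ k * (B ^ k) ^ c :=
          Nat.add_le_add (Nat.le_mul_of_pos_right _ (Nat.pow_pos hk))
            (Nat.mul_le_mul_right _ hl)
      _ = (B ^ k * (B ^ k) ^ c) * 2 := by ring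
      _ ≤ (B ^ k * (B ^ k) ^ c) * B := Nat.mul_le_mul_left _ hB
      _ = B ^ (k + k * c + 1) := by rw [← pow_mul]; ring
  have hstate : B ^ k + l.length * (B ^ k) ^ c + 2 ≤ B ^ (k + k * c + 3) := by
    have := add_add_one_le_pow hB hsk (hone _)
    exact this
  have hmax : max (B ^ k) (B ^ k + l.length * (B ^ k) ^ c) + 2 ≤ B ^ (k + k * c + 3) := by
    rwa [max_eq_right (Nat.le_add_right _ _)]
  have hcst : (max (B ^ k) (B ^ k + l.length * (B ^ k) ^ c) + 2) ^ k
      ≤ B ^ ((k + k * c + 3) * k) := by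
    rw [pow_mul]; exact Nat.pow_le_pow_left hmax _
  set e := (k + k * c + 3) * k with he
  have hmono : ∀ {i j}, i ≤ j → B ^ i ≤ B ^ j := fun h => Nat.pow_le_pow_right (by omega) h
  constructor
  · have h3 : loopSteps body cost l t ≤ B ^ (k + (e + 1)) := by
      refine h1.trans ?_
      rw [pow_add]
      refine Nat.mul_le_mul hl ?_
      have := hone e
      calc _ ≤ B ^ e + B ^ e := by omega
        _ = B ^ e * 2 := by ring
        _ ≤ B ^ e * B := Nat.mul_le_mul_left _ hB
        _ = B ^ (e + 1) := by ring
    have h4 : sp + sq + 1 ≤ B ^ (k + (e + 1) + 2) :=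
      (add_add_one_le_pow hB hp hq).trans (hmono (by omega))
    have h5 := add_add_one_le_pow hB h4 (h3.trans (hmono (by omega : _ ≤ k + (e + 1) + 2)))
    have h6 : B ^ (k + (e + 1) + 2 + 2) ≤ B ^ (e + 2 * k + 5) := hmono (by omega)
    omega
  · have h3 : k + k * c + 3 ≤ e + 2 * k + 5 := by
      rcases Nat.eq_zero_or_pos k with rfl | hk0
      · simp
      · have : k + k * c + 3 ≤ e := by
          rw [he]; exact Nat.le_mul_of_pos_right _ hk0
        omega
    have := hmono h3
    omega

end Bounds

section Instances

variable {σ τ ρ a b : Ty}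

/-- Two programs have a common bound. -/
theorem PolyTime.pair_bound (p : Prog σ τ) (q : Prog ρ a) [hp : PolyTime.{u} p]
    [hq : PolyTime.{u} q] : ∃ k, BoundedBy.{u} k p ∧ BoundedBy.{u} k q := by
  obtain ⟨k, hk⟩ := hp.exists_boundedBy
  obtain ⟨l, hl⟩ := hq.exists_boundedBy
  exact ⟨max k l, hk.mono (le_max_left _ _), hl.mono (le_max_right _ _)⟩

theorem PolyTime.triple_bound {σ' τ' : Ty} (p : Prog σ τ) (q : Prog ρ a) (w : Prog σ' τ')
    [PolyTime.{u} p] [PolyTime.{u} q] [hw : PolyTime.{u} w] :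
    ∃ k, BoundedBy.{u} k p ∧ BoundedBy.{u} k q ∧ BoundedBy.{u} k w := by
  obtain ⟨k, hk, hk'⟩ := PolyTime.pair_bound p q
  obtain ⟨l, hl⟩ := hw.exists_boundedBy
  exact ⟨max k l, hk.mono (le_max_left _ _), hk'.mono (le_max_left _ _),
    hl.mono (le_max_right _ _)⟩

/-- An operation that combines the results of two programs, and whose output is at most one larger
than them, is polynomial. -/
theorem polyTime_of_binary {p : Prog σ a} {q : Prog σ b} {w : Prog σ τ} [PolyTime.{u} p]
    [PolyTime.{u} q]
    (hs : ∀ (F : Type u) [Field F] (R : List F → List F) (x : σ.Val F),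
      w.steps R x ≤ p.steps R x + q.steps R x + 1)
    (hm : ∀ (F : Type u) [Field F] (R : List F → List F) (x : σ.Val F),
      mag τ (w.eval R x) ≤ max (mag a (p.eval R x)) (mag b (q.eval R x)) + 1) :
    PolyTime.{u} w := by
  obtain ⟨k, hp, hq⟩ := PolyTime.pair_bound p q
  refine ⟨k + 2, fun F _ R hR x => ?_⟩
  obtain ⟨p1, p2⟩ := hp F R hR x
  obtain ⟨q1, q2⟩ := hq F R hR x
  have h1 := add_add_one_le_pow (by omega) p1 q1
  have h2 := add_add_one_le_pow (by omega) p2 q2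
  have := hs F R x
  have := hm F R x
  omega

theorem polyTime_of_const {w : Prog σ τ} (hs : ∀ (F : Type u) [Field F] (R : List F → List F)
      (x : σ.Val F), w.steps R x ≤ 1)
    (hm : ∀ (F : Type u) [Field F] (R : List F → List F) (x : σ.Val F),
      mag τ (w.eval R x) ≤ mag σ x) : PolyTime.{u} w := by
  refine ⟨1, fun F _ R hR x => ?_⟩
  have := hs F R x
  have := hm F R x
  rw [pow_one]
  omega

instance : PolyTime.{u} (Prog.arg : Prog σ σ) :=
  polyTime_of_const (fun _ _ _ _ => le_rfl) fun _ _ _ _ => le_rfl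

instance : PolyTime.{u} (Prog.zero : Prog σ .nat) :=
  polyTime_of_const (fun _ _ _ _ => le_rfl) fun _ _ _ _ => Nat.zero_le _

instance : PolyTime.{u} (Prog.nil : Prog σ (.list a)) :=
  polyTime_of_const (fun _ _ _ _ => le_rfl) fun _ _ _ _ => Nat.zero_le _

instance : PolyTime.{u} (Prog.fzero : Prog σ .fld) :=
  polyTime_of_const (fun _ _ _ _ => le_rfl) fun _ _ _ _ => Nat.zero_le _

instance : PolyTime.{u} (Prog.fone : Prog σ .fld) :=
  polyTime_of_const (fun _ _ _ _ => le_rfl) fun _ _ _ _ => Nat.zero_le _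

instance (p : Prog σ τ) (q : Prog τ ρ) [PolyTime.{u} p] [PolyTime.{u} q] :
    PolyTime.{u} (p.comp q) := by
  obtain ⟨k, hp, hq⟩ := PolyTime.pair_bound p q
  refine ⟨k + k * k + 2, fun F _ R hR x => ?_⟩
  obtain ⟨p1, p2⟩ := hp F R hR x
  obtain ⟨q1, q2⟩ := hq F R hR (p.eval R x)
  have hpow : (mag τ (p.eval R x) + 2) ^ k ≤ (mag σ x + 2) ^ (k * k) := by
    rw [pow_mul]; exact Nat.pow_le_pow_left p2 _
  have hmono : ∀ {i j}, i ≤ j → (mag σ x + 2) ^ i ≤ (mag σ x + 2) ^ j :=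
    fun h => Nat.pow_le_pow_right (by omega) h
  have h1 : (mag σ x + 2) ^ k ≤ (mag σ x + 2) ^ (k + k * k) := hmono (by omega)
  have h2 : (mag σ x + 2) ^ (k * k) ≤ (mag σ x + 2) ^ (k + k * k) := hmono (by omega)
  have h3 : (mag σ x + 2) ^ (k + k * k) ≤ (mag σ x + 2) ^ (k + k * k + 2) := hmono (by omega)
  exact ⟨add_add_one_le_pow (by omega) (p1.trans h1) ((q1.trans hpow).trans h2),
    ((q2.trans hpow).trans h2).trans h3⟩

instance (p : Prog σ a) (q : Prog σ b) [PolyTime.{u} p] [PolyTime.{u} q] :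
    PolyTime.{u} (p.pair q) :=
  polyTime_of_binary (p := p) (q := q) (fun _ _ _ _ => le_rfl)
    fun _ _ _ _ => Nat.le_succ _

instance (p : Prog σ (.prod a b)) [PolyTime.{u} p] : PolyTime.{u} p.fst :=
  polyTime_of_binary (p := p) (q := p)
    (fun _ _ R x => by rw [Prog.steps]; omega)
    fun _ _ R x => by
      have : mag a (p.fst.eval R x) ≤ mag (.prod a b) (p.eval R x) := le_max_left _ _
      omega

instance (p : Prog σ (.prod a b)) [PolyTime.{u} p] : PolyTime.{u} p.snd :=
  polyTime_of_binary (p := p) (q := p)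
    (fun _ _ R x => by rw [Prog.steps]; omega)
    fun _ _ R x => by
      have : mag b (p.snd.eval R x) ≤ mag (.prod a b) (p.eval R x) := le_max_right _ _
      omega

instance (p : Prog σ .nat) [PolyTime.{u} p] : PolyTime.{u} p.succ :=
  polyTime_of_binary (p := p) (q := p)
    (fun _ _ R x => by rw [Prog.steps]; omega)
    fun _ _ R x => by
      have : mag .nat (p.succ.eval R x) = mag .nat (p.eval R x) + 1 := rfl
      omega

theorem mag_cons_le {F : Type u} (y : a.Val F) (l : List (a.Val F)) :
    mag (.list a) (List.cons y l) ≤ max (mag a y) (mag (.list a) l + 1) := by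
  rw [mag_list_le]
  have h1 := length_le_mag l
  refine ⟨by rw [List.length_cons]; omega, fun z hz => ?_⟩
  rcases List.mem_cons.1 hz with rfl | hz
  · exact le_max_left _ _
  · have := mag_le_of_mem hz; omega

instance (p : Prog σ a) (q : Prog σ (.list a)) [PolyTime.{u} p] [PolyTime.{u} q] :
    PolyTime.{u} (p.cons q) :=
  polyTime_of_binary (p := p) (q := q) (fun _ _ _ _ => le_rfl)
    fun _ _ R x => (mag_cons_le (p.eval R x) (q.eval R x)).trans (by omega)

instance (p q : Prog σ .fld) [PolyTime.{u} p] [PolyTime.{u} q] : PolyTime.{u} (p.fadd q) :=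
  polyTime_of_binary (p := p) (q := q) (fun _ _ _ _ => le_rfl) fun _ _ _ _ => Nat.zero_le _

instance (p q : Prog σ .fld) [PolyTime.{u} p] [PolyTime.{u} q] : PolyTime.{u} (p.fsub q) :=
  polyTime_of_binary (p := p) (q := q) (fun _ _ _ _ => le_rfl) fun _ _ _ _ => Nat.zero_le _

instance (p q : Prog σ .fld) [PolyTime.{u} p] [PolyTime.{u} q] : PolyTime.{u} (p.fmul q) :=
  polyTime_of_binary (p := p) (q := q) (fun _ _ _ _ => le_rfl) fun _ _ _ _ => Nat.zero_le _

instance (p q : Prog σ .fld) [PolyTime.{u} p] [PolyTime.{u} q] : PolyTime.{u} (p.fdiv q) :=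
  polyTime_of_binary (p := p) (q := q) (fun _ _ _ _ => le_rfl) fun _ _ _ _ => Nat.zero_le _

instance (p q : Prog σ .fld) [PolyTime.{u} p] [PolyTime.{u} q] : PolyTime.{u} (p.feq q) :=
  polyTime_of_binary (p := p) (q := q) (fun _ _ _ _ => le_rfl) fun _ _ R x => by
    classical
    have : mag .nat ((p.feq q).eval R x)
      = if @Eq _ (p.eval R x) (q.eval R x) then 1 else 0 := rfl
    rw [this]
    split_ifs <;> omega

/-- The bound of a branch, whose input is the input together with a part of the value that is
branched on. -/
theorem branch_bound {B n sp sw mw k : ℕ} (hB : 2 ≤ B) (hsp : sp ≤ B ^ k) (hn : n ≤ B ^ k)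
    (hsw : sw ≤ n ^ k) (hmw : mw + 2 ≤ n ^ k) :
    sp + 1 + sw ≤ B ^ (k + k * k + 2) ∧ mw + 2 ≤ B ^ (k + k * k + 2) := by
  have hpow : n ^ k ≤ B ^ (k * k) := by rw [pow_mul]; exact Nat.pow_le_pow_left hn _
  have hmono : ∀ {i j}, i ≤ j → B ^ i ≤ B ^ j := fun h => Nat.pow_le_pow_right (by omega) h
  have h1 : B ^ k ≤ B ^ (k + k * k) := hmono (by omega)
  have h2 : B ^ (k * k) ≤ B ^ (k + k * k) := hmono (by omega)
  have h3 : B ^ (k + k * k) ≤ B ^ (k + k * k + 2) := hmono (by omega)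
  have := add_add_one_le_pow hB (hsp.trans h1) ((hsw.trans hpow).trans h2)
  omega

/-- A base is at most its bounding power, as the power is at least `2`. -/
theorem le_pow_of_two_le_pow {B k : ℕ} (h : 2 ≤ B ^ k) : B ≤ B ^ k := by
  rcases k with _ | k
  · simp at h
  · exact Nat.le_self_pow (by omega) B

instance (p : Prog σ .nat) (q : Prog σ τ) (w : Prog (.prod σ .nat) τ) [PolyTime.{u} p]
    [PolyTime.{u} q] [PolyTime.{u} w] : PolyTime.{u} (p.natCase q w) := by
  obtain ⟨k, hp, hq, hw⟩ := PolyTime.triple_bound p q w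
  refine ⟨k + k * k + 2, fun F _ R hR x => ?_⟩
  obtain ⟨p1, p2⟩ := hp F R hR x
  have hle : mag σ x + 2 ≤ (mag σ x + 2) ^ k := le_pow_of_two_le_pow (by omega)
  rw [Prog.steps, Prog.eval]
  match hv : p.eval R x with
  | ⟨0⟩ =>
    obtain ⟨q1, q2⟩ := hq F R hR x
    exact branch_bound (by omega) p1 hle q1 q2
  | ⟨n + 1⟩ =>
    obtain ⟨w1, w2⟩ := hw F R hR (x, ULift.up n)
    refine branch_bound (by omega) p1 ?_ w1 w2
    rw [hv] at p2
    have e1 : mag (F := F) .nat (ULift.up (n + 1)) = n + 1 := rfl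
    have e2 : mag (.prod σ .nat) ((x, ULift.up n) : Ty.Val F (.prod σ .nat)) = max (mag σ x) n :=
      rfl
    rw [e1] at p2
    rw [e2]
    omega

instance (p : Prog σ (.list a)) (q : Prog σ τ) (w : Prog (.prod σ (.prod a (.list a))) τ)
    [PolyTime.{u} p] [PolyTime.{u} q] [PolyTime.{u} w] : PolyTime.{u} (p.listCase q w) := by
  obtain ⟨k, hp, hq, hw⟩ := PolyTime.triple_bound p q w
  refine ⟨k + k * k + 2, fun F _ R hR x => ?_⟩
  obtain ⟨p1, p2⟩ := hp F R hR x
  have hle : mag σ x + 2 ≤ (mag σ x + 2) ^ k := le_pow_of_two_le_pow (by omega)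
  rw [Prog.steps, Prog.eval]
  match hv : p.eval R x with
  | [] =>
    obtain ⟨q1, q2⟩ := hq F R hR x
    exact branch_bound (by omega) p1 hle q1 q2
  | y :: l =>
    obtain ⟨w1, w2⟩ := hw F R hR (x, (y, l))
    refine branch_bound (by omega) p1 ?_ w1 w2
    rw [hv] at p2
    obtain ⟨h1, h2⟩ := mag_list_le.1 (le_refl (mag (.list a) (y :: l)))
    have e1 : mag a y ≤ mag (.list a) (y :: l) := h2 y (by simp)
    have e2 : mag (.list a) l ≤ mag (.list a) (y :: l) := mag_list_le.2
      ⟨by rw [List.length_cons] at h1; omega, fun z hz => h2 z (by simp [hz])⟩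
    have e3 : mag (.prod σ (.prod a (.list a)))
        ((x, (y, l)) : Ty.Val F (.prod σ (.prod a (.list a))))
      = max (mag σ x) (max (mag a y) (mag (.list a) l)) := rfl
    rw [e3]
    omega

theorem polyTime_listLoop (p : Prog σ (.list a)) (q : Prog σ τ) (w : Prog (.prod σ (.prod a τ)) τ)
    [PolyTime.{u} p] [PolyTime.{u} q] [PolyTime.{u} w] (hw' : AddsBounded.{u} w) :
    PolyTime.{u} (p.listLoop q w) := by
  obtain ⟨k, hp, hq, hw⟩ := PolyTime.triple_bound p q w
  obtain ⟨c, hc⟩ := hw'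
  refine ⟨(k + k * c + 3) * k + 2 * k + 5, fun F _ R hR x => ?_⟩
  obtain ⟨p1, p2⟩ := hp F R hR x
  obtain ⟨q1, q2⟩ := hq F R hR x
  have hle : mag σ x + 2 ≤ (mag σ x + 2) ^ k := le_pow_of_two_le_pow (by omega)
  have hmem : ∀ y ∈ (show List (a.Val F) from p.eval R x), mag a y + 2 ≤ (mag σ x + 2) ^ k :=
    fun y hy => by
      have := (mag_list_le.1 (le_refl (mag (.list a) (p.eval R x)))).2 y hy
      omega
  rw [Prog.steps, Prog.eval]
  refine loop_bound (m := mag τ) (by omega) _ _ ?_ (by omega) (fun y hy t => ?_) (fun y hy t => ?_)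
    p1 q1
  · exact (length_le_mag _).trans (le_trans (by omega) p2)
  · refine (hc F R hR x y t).trans (Nat.add_le_add_left (Nat.pow_le_pow_left ?_ _) _)
    have := hmem y hy
    omega
  · refine (hw F R hR (x, (y, t))).1.trans (Nat.pow_le_pow_left ?_ _)
    have e : mag (.prod σ (.prod a τ)) ((x, (y, t)) : Ty.Val F (.prod σ (.prod a τ)))
      = max (mag σ x) (max (mag a y) (mag τ t)) := rfl
    have := hmem y hy
    rw [e]
    omega

theorem polyTime_natLoop (p : Prog σ .nat) (q : Prog σ τ) (w : Prog (.prod σ (.prod .nat τ)) τ)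
    [PolyTime.{u} p] [PolyTime.{u} q] [PolyTime.{u} w] (hw' : AddsBounded.{u} w) :
    PolyTime.{u} (p.natLoop q w) := by
  obtain ⟨k, hp, hq, hw⟩ := PolyTime.triple_bound p q w
  obtain ⟨c, hc⟩ := hw'
  refine ⟨(k + k * c + 3) * k + 2 * k + 5, fun F _ R hR x => ?_⟩
  obtain ⟨p1, p2⟩ := hp F R hR x
  obtain ⟨q1, q2⟩ := hq F R hR x
  have hle : mag σ x + 2 ≤ (mag σ x + 2) ^ k := le_pow_of_two_le_pow (by omega)
  have hn : (p.eval R x).down + 2 ≤ (mag σ x + 2) ^ k := p2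
  rw [Prog.steps, Prog.eval]
  refine loop_bound (m := mag τ) (by omega) _ _ ?_ (by omega) (fun y hy t => ?_) (fun y hy t => ?_)
    p1 q1
  · rw [List.length_range]; omega
  · refine (hc F R hR x (ULift.up y) t).trans (Nat.add_le_add_left (Nat.pow_le_pow_left ?_ _) _)
    have := List.mem_range.1 hy
    have e : mag (F := F) .nat (ULift.up y) = y := rfl
    omega
  · refine (hw F R hR (x, (ULift.up y, t))).1.trans (Nat.pow_le_pow_left ?_ _)
    have e : mag (.prod σ (.prod .nat τ)) ((x, (ULift.up y, t)) : Ty.Val F (.prod σ (.prod .nat τ)))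
      = max (mag σ x) (max y (mag τ t)) := rfl
    have := List.mem_range.1 hy
    rw [e]
    omega

end Instances

/-! ### Programs on lists and counters -/

theorem addsBounded_of_le {σ a τ : Ty} {w : Prog (.prod σ (.prod a τ)) τ}
    (h : ∀ (F : Type u) [Field F] (R : List F → List F) (x : σ.Val F) (y : a.Val F) (t : τ.Val F),
      mag τ (w.eval R (x, (y, t))) ≤ mag τ t + max (mag σ x) (mag a y) + 2) :
    AddsBounded.{u} w :=
  ⟨1, fun F _ R _ x y t => by rw [pow_one]; exact h F R x y t⟩

namespace Prog

variable {σ τ a b : Ty}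

/-- The current element in the body of a loop, whose input consists of the environment, the current
element and the state. -/
abbrev item : Prog (.prod σ (.prod a τ)) a := arg.snd.fst

/-- The state in the body of a loop. -/
abbrev state : Prog (.prod σ (.prod a τ)) τ := arg.snd.snd

/-- `if c = 0 then p else q`. -/
def ifZero (c : Prog σ .nat) (p q : Prog σ τ) : Prog σ τ := natCase c p (arg.fst.comp q)

def reverse (p : Prog σ (.list a)) : Prog σ (.list a) := listLoop p nil (cons item state)

def append (p q : Prog σ (.list a)) : Prog σ (.list a) := listLoop p.reverse q (cons item state)

def flatMap (p : Prog σ (.list a)) (w : Prog (.prod σ a) (.list b)) : Prog σ (.list b) :=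
  listLoop p.reverse nil (append ((pair arg.fst item).comp w) state)

def map (p : Prog σ (.list a)) (w : Prog (.prod σ a) b) : Prog σ (.list b) :=
  flatMap p (cons w nil)

def length (p : Prog σ (.list a)) : Prog σ .nat := listLoop p zero (succ state)

def range (p : Prog σ .nat) : Prog σ (.list .nat) := reverse (natLoop p nil (cons item state))

def pred (p : Prog σ .nat) : Prog σ .nat := natCase p zero arg.snd

def add (p q : Prog σ .nat) : Prog σ .nat := natLoop q p (succ state)

def sub (p q : Prog σ .nat) : Prog σ .nat := natLoop q p (pred state)

def mul (p q : Prog σ .nat) : Prog σ .nat := length (flatMap (range p) (range (arg.fst.comp q)))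

def max (p q : Prog σ .nat) : Prog σ .nat := add p (sub q p)

def tail (p : Prog σ (.list a)) : Prog σ (.list a) := listCase p nil arg.snd.snd

def drop (n : Prog σ .nat) (p : Prog σ (.list a)) : Prog σ (.list a) := natLoop n p (tail state)

/-- The `n`-th entry of a list, with a default value. -/
def nth (d : Prog σ a) (p : Prog σ (.list a)) (n : Prog σ .nat) : Prog σ a :=
  listCase (drop n p) d arg.snd.fst

def ofNat (n : Prog σ .nat) : Prog σ .fld := natLoop n fzero (fadd state fone)

def sum (p : Prog σ (.list .fld)) : Prog σ .fld := listLoop p fzero (fadd state item)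

section Eval

variable {F : Type u} [Field F] (R : List F → List F) (x : σ.Val F)

theorem eval_ifZero (c : Prog σ .nat) (p q : Prog σ τ) :
    (ifZero c p q).eval R x = if (c.eval R x).down = 0 then p.eval R x else q.eval R x := by
  rw [ifZero, Prog.eval]
  match c.eval R x with
  | ⟨0⟩ => rfl
  | ⟨n + 1⟩ => rfl

theorem foldl_cons_eq {A : Type*} (l m : List A) :
    l.foldl (fun t y => y :: t) m = l.reverse ++ m := by
  induction l generalizing m with
  | nil => rfl
  | cons y l ih => simp [ih]

theorem eval_reverse (p : Prog σ (.list a)) :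
    (reverse p).eval R x = List.reverse (p.eval R x) := by
  have := foldl_cons_eq (show List (a.Val F) from p.eval R x) []
  rw [List.append_nil] at this
  exact this

theorem eval_append (p q : Prog σ (.list a)) :
    (append p q).eval R x = List.append (p.eval R x) (q.eval R x) := by
  have := foldl_cons_eq (show List (a.Val F) from p.reverse.eval R x) (q.eval R x)
  rw [eval_reverse, List.reverse_reverse] at this
  rw [append, Prog.eval, eval_reverse]
  exact this

theorem eval_flatMap (p : Prog σ (.list a)) (w : Prog (.prod σ a) (.list b)) :
    (flatMap p w).eval R x
      = List.flatMap (fun y => (w.eval R (x, y) : List (b.Val F))) (p.eval R x) := by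
  rw [flatMap, Prog.eval, eval_reverse]
  simp only [eval_append]
  rw [List.foldl_reverse]
  induction (p.eval R x : List (a.Val F)) with
  | nil => rfl
  | cons y l ih =>
    rw [List.foldr_cons, List.flatMap_cons, ih]
    rfl

theorem eval_map (p : Prog σ (.list a)) (w : Prog (.prod σ a) b) :
    (map p w).eval R x = List.map (fun y => w.eval R (x, y)) (p.eval R x) := by
  rw [map, eval_flatMap, List.map_eq_flatMap]
  rfl

theorem eval_length (p : Prog σ (.list a)) :
    ((length p).eval R x).down = List.length (p.eval R x) := by
  have key : ∀ (l : List (a.Val F)) (n : ℕ),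
      (l.foldl (fun (t : ULift.{u} ℕ) _ => ULift.up (t.down + 1)) (ULift.up n)).down
        = n + l.length := by
    intro l
    induction l with
    | nil => intro n; rfl
    | cons y l ih =>
      intro n
      rw [List.foldl_cons, ih, List.length_cons, Nat.add_right_comm, Nat.add_assoc]
  exact (key (p.eval R x) 0).trans (Nat.zero_add _)

theorem eval_range (p : Prog σ .nat) :
    (range p).eval R x = (List.range (p.eval R x).down).map ULift.up := by
  rw [range, eval_reverse, Prog.eval]
  have := foldl_cons_eq ((List.range (p.eval R x).down).map ULift.up.{u}) []
  rw [List.foldl_map, List.append_nil] at this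
  rw [← List.reverse_reverse ((List.range (p.eval R x).down).map ULift.up.{u}), ← this]
  rfl

theorem eval_pred (p : Prog σ .nat) : ((pred p).eval R x).down = (p.eval R x).down - 1 := by
  rw [pred, Prog.eval]
  match p.eval R x with
  | ⟨0⟩ => rfl
  | ⟨n + 1⟩ => rfl

theorem eval_add (p q : Prog σ .nat) :
    ((add p q).eval R x).down = (p.eval R x).down + (q.eval R x).down := by
  rw [add, Prog.eval]
  induction (q.eval R x).down with
  | zero => rfl
  | succ n ih =>
    rw [List.range_succ, List.foldl_append, ← Nat.add_assoc, ← ih]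
    rfl

theorem eval_sub (p q : Prog σ .nat) :
    ((sub p q).eval R x).down = (p.eval R x).down - (q.eval R x).down := by
  rw [sub, Prog.eval]
  induction (q.eval R x).down with
  | zero => rfl
  | succ n ih =>
    rw [List.range_succ, List.foldl_append, ← Nat.sub_sub, ← ih, List.foldl_cons, List.foldl_nil,
      eval_pred]
    rfl

theorem eval_mul (p q : Prog σ .nat) :
    ((mul p q).eval R x).down = (p.eval R x).down * (q.eval R x).down := by
  rw [mul, eval_length, eval_flatMap, eval_range]
  simp only [eval_range, List.length_flatMap]
  change ((List.map _ (List.map _ _)).sum) = _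
  rw [List.map_map]
  have : ((fun y : ULift.{u} ℕ => (List.map ULift.up.{u}
      (List.range ((arg.fst.comp q).eval R ((x, y) : Ty.Val F (.prod σ .nat))).down)).length)
        ∘ ULift.up) = fun _ : ℕ => (q.eval R x).down := by
    funext y
    simp only [Function.comp, List.length_map, List.length_range]
    rfl
  exact (congrArg (fun f => (List.map f (List.range (p.eval R x).down)).sum) this).trans (by simp)

theorem eval_max (p q : Prog σ .nat) :
    ((max p q).eval R x).down = Max.max (p.eval R x).down (q.eval R x).down := by
  rw [max, eval_add, eval_sub]
  omega

theorem eval_tail (p : Prog σ (.list a)) : (tail p).eval R x = List.tail (p.eval R x) := by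
  rw [tail, Prog.eval]
  match p.eval R x with
  | [] => rfl
  | y :: l => rfl

theorem eval_drop (n : Prog σ .nat) (p : Prog σ (.list a)) :
    (drop n p).eval R x = List.drop (n.eval R x).down (p.eval R x) := by
  rw [drop, Prog.eval]
  induction (n.eval R x).down with
  | zero => rfl
  | succ n ih =>
    rw [List.range_succ, List.foldl_append, ← List.tail_drop, ← ih, List.foldl_cons, List.foldl_nil,
      eval_tail]
    rfl

theorem eval_nth (d : Prog σ a) (p : Prog σ (.list a)) (n : Prog σ .nat) :
    (nth d p n).eval R x = List.getD (p.eval R x) (n.eval R x).down (d.eval R x) := by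
  rw [nth, Prog.eval, eval_drop]
  rw [List.getD_eq_getElem?_getD]
  have h : (List.drop (n.eval R x).down (p.eval R x : List (a.Val F))).head?
    = (p.eval R x : List (a.Val F))[(n.eval R x).down]? := List.head?_drop
  match hl : (List.drop (n.eval R x).down (p.eval R x : List (a.Val F))) with
  | [] => rw [hl] at h; exact (congrArg (fun o => Option.getD o (d.eval R x)) h)
  | y :: l => rw [hl] at h; exact (congrArg (fun o => Option.getD o (d.eval R x)) h)

theorem eval_ofNat (n : Prog σ .nat) : (ofNat n).eval R x = ((n.eval R x).down : F) := by
  rw [ofNat, Prog.eval]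
  induction (n.eval R x).down with
  | zero => exact Nat.cast_zero.symm
  | succ n ih =>
    rw [List.range_succ, List.foldl_append, Nat.cast_succ, ← ih]
    rfl

theorem eval_sum (p : Prog σ (.list .fld)) :
    (sum p).eval R x = List.sum (α := F) (p.eval R x) := by
  rw [List.sum_eq_foldl]
  rfl

end Eval

instance (c : Prog σ .nat) (p q : Prog σ τ) [PolyTime.{u} c] [PolyTime.{u} p] [PolyTime.{u} q] :
    PolyTime.{u} (ifZero c p q) := inferInstanceAs (PolyTime.{u} (natCase ..))

theorem addsBounded_cons : AddsBounded.{u} (σ := σ) (a := a) (cons item state) :=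
  addsBounded_of_le fun F _ R x y t => by
    have : mag (.list a) _ ≤ _ := mag_cons_le y t
    exact this.trans (by omega)

instance (p : Prog σ (.list a)) [PolyTime.{u} p] : PolyTime.{u} (reverse p) :=
  polyTime_listLoop _ _ _ addsBounded_cons

instance (p q : Prog σ (.list a)) [PolyTime.{u} p] [PolyTime.{u} q] : PolyTime.{u} (append p q) :=
  polyTime_listLoop _ _ _ addsBounded_cons

theorem mag_append_le {F : Type u} (l m : List (a.Val F)) :
    mag (.list a) (List.append l m) ≤ mag (.list a) l + mag (.list a) m := by
  have h1 := length_le_mag l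
  have h2 := length_le_mag m
  refine mag_list_le.2 ⟨?_, fun y hy => ?_⟩
  · rw [List.append_eq, List.length_append]; omega
  · rcases List.mem_append.1 hy with h | h
    · exact (mag_le_of_mem h).trans (Nat.le_add_right _ _)
    · exact (mag_le_of_mem h).trans (Nat.le_add_left _ _)

instance (p : Prog σ (.list a)) (w : Prog (.prod σ a) (.list b)) [PolyTime.{u} p]
    [hw : PolyTime.{u} w] : PolyTime.{u} (flatMap p w) := by
  refine polyTime_listLoop _ _ _ ?_
  obtain ⟨k, hk⟩ := hw.exists_boundedBy
  refine ⟨k, fun F _ R hR x y t => ?_⟩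
  rw [eval_append]
  refine (mag_append_le _ _).trans ?_
  have h1 : mag (.list b) (((pair arg.fst item).comp w).eval R (x, (y, t))) + 2
    ≤ (Max.max (mag σ x) (mag a y) + 2) ^ k := (hk F R hR (x, y)).2
  have h2 : mag (.list b) (state.eval R ((x, (y, t)) : Ty.Val F (.prod σ (.prod a (.list b)))))
    = mag (.list b) t := rfl
  omega

instance (p : Prog σ (.list a)) (w : Prog (.prod σ a) b) [PolyTime.{u} p] [PolyTime.{u} w] :
    PolyTime.{u} (map p w) := inferInstanceAs (PolyTime.{u} (flatMap ..))

theorem addsBounded_succ : AddsBounded.{u} (σ := σ) (a := a) (succ state) :=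
  addsBounded_of_le fun F _ R x y t => by
    have : mag .nat ((succ state).eval R ((x, (y, t)) : Ty.Val F (.prod σ (.prod a .nat))))
      = mag .nat t + 1 := rfl
    omega

instance (p : Prog σ (.list a)) [PolyTime.{u} p] : PolyTime.{u} (length p) :=
  polyTime_listLoop _ _ _ addsBounded_succ

instance (p : Prog σ .nat) [PolyTime.{u} p] : PolyTime.{u} (range p) := by
  have : PolyTime.{u} (natLoop p nil (cons item state)) := polyTime_natLoop _ _ _ addsBounded_cons
  exact inferInstanceAs (PolyTime.{u} (reverse ..))

instance (p : Prog σ .nat) [PolyTime.{u} p] : PolyTime.{u} (pred p) :=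
  inferInstanceAs (PolyTime.{u} (natCase ..))

instance (p q : Prog σ .nat) [PolyTime.{u} p] [PolyTime.{u} q] : PolyTime.{u} (add p q) :=
  polyTime_natLoop _ _ _ addsBounded_succ

instance (p q : Prog σ .nat) [PolyTime.{u} p] [PolyTime.{u} q] : PolyTime.{u} (sub p q) :=
  polyTime_natLoop _ _ _ <| addsBounded_of_le fun F _ R x y t => by
    have : mag .nat ((pred state).eval R ((x, (y, t)) : Ty.Val F (.prod σ (.prod .nat .nat))))
      = mag .nat t - 1 := eval_pred R _ _
    omega

instance (p q : Prog σ .nat) [PolyTime.{u} p] [PolyTime.{u} q] : PolyTime.{u} (mul p q) :=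
  inferInstanceAs (PolyTime.{u} (length ..))

instance (p q : Prog σ .nat) [PolyTime.{u} p] [PolyTime.{u} q] : PolyTime.{u} (max p q) :=
  inferInstanceAs (PolyTime.{u} (add ..))

instance (p : Prog σ (.list a)) [PolyTime.{u} p] : PolyTime.{u} (tail p) :=
  inferInstanceAs (PolyTime.{u} (listCase ..))

theorem mag_le_of_subset {F : Type u} {l m : List (a.Val F)} (hlen : List.length l ≤ List.length m)
    (h : ∀ y ∈ l, y ∈ m) : mag (.list a) l ≤ mag (.list a) m :=
  mag_list_le.2 ⟨hlen.trans (length_le_mag m), fun y hy => mag_le_of_mem (h y hy)⟩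

instance (n : Prog σ .nat) (p : Prog σ (.list a)) [PolyTime.{u} n] [PolyTime.{u} p] :
    PolyTime.{u} (drop n p) :=
  polyTime_natLoop _ _ _ <| addsBounded_of_le fun F _ R x y t => by
    rw [eval_tail]
    have : mag (.list a) (List.tail t) ≤ mag (.list a) t :=
      mag_le_of_subset (by rw [List.length_tail]; omega) fun _ => List.mem_of_mem_tail
    exact this.trans (by omega)

instance (d : Prog σ a) (p : Prog σ (.list a)) (n : Prog σ .nat) [PolyTime.{u} d] [PolyTime.{u} p]
    [PolyTime.{u} n] : PolyTime.{u} (nth d p n) := inferInstanceAs (PolyTime.{u} (listCase ..))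

instance (n : Prog σ .nat) [PolyTime.{u} n] : PolyTime.{u} (ofNat n) :=
  polyTime_natLoop _ _ _ <| addsBounded_of_le fun _ _ _ _ _ _ => Nat.zero_le _

instance (p : Prog σ (.list .fld)) [PolyTime.{u} p] : PolyTime.{u} (sum p) :=
  polyTime_listLoop _ _ _ <| addsBounded_of_le fun _ _ _ _ _ _ => Nat.zero_le _

end Prog

/-! ### Programs on polynomials -/

theorem coeff_listPoly {F : Type u} [Field F] (l : List F) (k : ℕ) :
    (listPoly l).coeff k = l.getD k 0 := by
  induction l generalizing k with
  | nil => simp [listPoly]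
  | cons c l ih =>
    change (C c + X * listPoly l).coeff k = _
    rcases k with _ | k
    · simp
    · simp [coeff_X_mul, ih]

theorem listPoly_eq_zero_iff {F : Type u} [Field F] {l : List F} :
    listPoly l = 0 ↔ ∀ y ∈ l, y = 0 := by
  constructor
  · intro h y hy
    obtain ⟨k, hk, rfl⟩ := List.mem_iff_getElem.1 hy
    have := coeff_listPoly l k
    rwa [h, coeff_zero, List.getD_eq_getElem _ _ hk, eq_comm] at this
  · intro h
    ext k
    rw [coeff_listPoly, coeff_zero, List.getD_eq_getElem?_getD]
    rcases hk : l[k]? with _ | y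
    · rfl
    · exact h y (List.mem_of_getElem? hk)

theorem listPoly_denseRep {F : Type u} [Field F] (f : F[X]) : listPoly (denseRep f) = f := by
  ext k
  rw [coeff_listPoly, denseRep, List.getD_eq_getElem?_getD]
  by_cases hk : k < f.natDegree + 1
  · simp [hk]
  · rw [List.getElem?_eq_none (by simpa using hk),
      coeff_eq_zero_of_natDegree_lt (by omega : f.natDegree < k)]
    rfl

theorem getD_map_range {A : Type*} (g : ℕ → A) (n k : ℕ) (d : A) :
    ((List.range n).map g).getD k d = if k < n then g k else d := by
  rw [List.getD_eq_getElem?_getD]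
  split_ifs with hk
  · simp [hk]
  · rw [List.getElem?_eq_none (by simpa using hk)]
    rfl

theorem getD_of_length_le {A : Type*} {l : List A} {k : ℕ} (d : A) (h : l.length ≤ k) :
    l.getD k d = d := by
  rw [List.getD_eq_getElem?_getD, List.getElem?_eq_none h]
  rfl

theorem addsBounded_of_le_eval {σ a τ ρ : Ty} {w : Prog (.prod σ (.prod a τ)) τ}
    (v : Prog (.prod σ a) ρ) [hv : PolyTime.{u} v]
    (h : ∀ (F : Type u) [Field F] (R : List F → List F) (x : σ.Val F) (y : a.Val F) (t : τ.Val F),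
      mag τ (w.eval R (x, (y, t))) ≤ mag τ t + mag ρ (v.eval R (x, y))) :
    AddsBounded.{u} w := by
  obtain ⟨k, hk⟩ := hv.exists_boundedBy
  refine ⟨k, fun F _ R hR x y t => (h F R x y t).trans (Nat.add_le_add_left ?_ _)⟩
  have : mag ρ (v.eval R (x, y)) + 2 ≤ (max (mag σ x) (mag a y) + 2) ^ k := (hk F R hR (x, y)).2
  omega

namespace Prog

variable {σ τ a b : Ty}

/-- The list of the values of `w` at the counters below `n`. -/
def tabulate (n : Prog σ .nat) (w : Prog (.prod σ .nat) a) : Prog σ (.list a) := map (range n) w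

/-- The polynomial `q + c * p`. -/
def axpy (c : Prog σ .fld) (p q : Prog σ (.list .fld)) : Prog σ (.list .fld) :=
  tabulate (max (length p) (length q))
    (fadd (nth fzero (arg.fst.comp q) arg.snd)
      (fmul (arg.fst.comp c) (nth fzero (arg.fst.comp p) arg.snd)))

/-- `axpy`, entry by entry on lists of polynomials. -/
def axpyList (c : Prog σ .fld) (p q : Prog σ (.list (.list .fld))) : Prog σ (.list (.list .fld)) :=
  tabulate (max (length p) (length q))
    (axpy (arg.fst.comp c) (nth nil (arg.fst.comp p) arg.snd) (nth nil (arg.fst.comp q) arg.snd))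

def deriv (p : Prog σ (.list .fld)) : Prog σ (.list .fld) :=
  tabulate (pred (length p))
    (fmul (nth fzero (arg.fst.comp p) (succ arg.snd)) (ofNat (succ arg.snd)))

def iterDeriv (n : Prog σ .nat) (p : Prog σ (.list .fld)) : Prog σ (.list .fld) :=
  natLoop n p (deriv state)

def polyMul (p q : Prog σ (.list .fld)) : Prog σ (.list .fld) :=
  tabulate (add (length p) (length q)) (sum (tabulate (succ arg.snd)
    (fmul (nth fzero (arg.fst.fst.comp p) arg.snd)
      (nth fzero (arg.fst.fst.comp q) (sub arg.fst.snd arg.snd)))))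

/-- The polynomial `X ^ n * p`. -/
def shift (n : Prog σ .nat) (p : Prog σ (.list .fld)) : Prog σ (.list .fld) :=
  append (tabulate n fzero) p

/-- The polynomial `(X - b) ^ n`. -/
def linPow (b : Prog σ .fld) (n : Prog σ .nat) : Prog σ (.list .fld) :=
  natLoop n (cons fone nil) (axpy (fsub fzero (arg.fst.comp b)) state (cons fzero state))

/-- The image of `g` under the differential operator with the coefficients `P`. -/
def applyOp (P : Prog σ (.list (.list .fld))) (g : Prog σ (.list .fld)) : Prog σ (.list .fld) :=
  natLoop (length P) nil
    (axpy fone (polyMul (nth nil (arg.fst.comp P) item) (iterDeriv item (arg.fst.comp g))) state)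

/-- The number of nonzero entries, which is zero for the coefficients of the zero polynomial. -/
def countNonzero (p : Prog σ (.list .fld)) : Prog σ .nat :=
  length (flatMap p (ifZero (feq arg.snd fzero) (cons zero nil) nil))

section Eval

variable {F : Type u} [Field F] (R : List F → List F) (x : σ.Val F)

theorem eval_tabulate (n : Prog σ .nat) (w : Prog (.prod σ .nat) a) :
    (tabulate n w).eval R x
      = (List.range (n.eval R x).down).map fun i => w.eval R (x, ULift.up i) := by
  rw [tabulate, eval_map, eval_range, List.map_map]
  rfl

theorem length_eval_tabulate (n : Prog σ .nat) (w : Prog (.prod σ .nat) a) :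
    List.length ((tabulate n w).eval R x) = (n.eval R x).down := by
  rw [eval_tabulate, List.length_map, List.length_range]

theorem coeff_eval_tabulate (n : Prog σ .nat) (w : Prog (.prod σ .nat) .fld) (k : ℕ) :
    (listPoly ((tabulate n w).eval R x)).coeff k
      = if k < (n.eval R x).down then w.eval R (x, ULift.up k) else (0 : F) := by
  rw [coeff_listPoly, eval_tabulate, getD_map_range]

theorem length_eval_axpy (c : Prog σ .fld) (p q : Prog σ (.list .fld)) :
    List.length ((axpy c p q).eval R x)
      = Max.max (List.length (p.eval R x)) (List.length (q.eval R x)) := by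
  rw [axpy, length_eval_tabulate, eval_max, eval_length, eval_length]

theorem listPoly_eval_axpy (c : Prog σ .fld) (p q : Prog σ (.list .fld)) :
    listPoly ((axpy c p q).eval R x)
      = listPoly (q.eval R x) + C (c.eval R x) * listPoly (p.eval R x) := by
  ext k
  have h : (axpy c p q) = tabulate _ _ := rfl
  rw [h, coeff_eval_tabulate, eval_max, eval_length, eval_length, coeff_add, coeff_C_mul,
    coeff_listPoly, coeff_listPoly]
  split_ifs with hk
  · rw [Prog.eval, Prog.eval, eval_nth, eval_nth]
    rfl
  · rw [getD_of_length_le _ (by omega), getD_of_length_le _ (by omega), mul_zero, add_zero]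

theorem length_eval_axpyList (c : Prog σ .fld) (p q : Prog σ (.list (.list .fld))) :
    List.length ((axpyList c p q).eval R x)
      = Max.max (List.length (p.eval R x)) (List.length (q.eval R x)) := by
  rw [axpyList, length_eval_tabulate, eval_max, eval_length, eval_length]

theorem eval_axpyList_getD (c : Prog σ .fld) (p q : Prog σ (.list (.list .fld))) (k : ℕ) :
    listPoly (List.getD ((axpyList c p q).eval R x) k [])
      = listPoly (List.getD (q.eval R x) k [])
        + C (c.eval R x) * listPoly (List.getD (p.eval R x) k []) := by
  rw [axpyList, eval_tabulate, getD_map_range, eval_max, eval_length, eval_length]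
  split_ifs with hk
  · rw [listPoly_eval_axpy, eval_nth, eval_nth]
    rfl
  · rw [getD_of_length_le _ (by omega), getD_of_length_le _ (by omega)]
    simp [listPoly]

theorem length_eval_deriv (p : Prog σ (.list .fld)) :
    List.length ((deriv p).eval R x) = List.length (p.eval R x) - 1 := by
  rw [deriv, length_eval_tabulate, eval_pred, eval_length]

theorem listPoly_eval_deriv (p : Prog σ (.list .fld)) :
    listPoly ((deriv p).eval R x) = derivative (listPoly (p.eval R x)) := by
  ext k
  rw [deriv, coeff_eval_tabulate, eval_pred, eval_length, coeff_derivative, coeff_listPoly]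
  split_ifs with hk
  · rw [Prog.eval, eval_nth, eval_ofNat]
    rw [← Nat.cast_succ]
    rfl
  · rw [getD_of_length_le _ (by omega), zero_mul]

theorem eval_iterDeriv (n : Prog σ .nat) (p : Prog σ (.list .fld)) :
    listPoly ((iterDeriv n p).eval R x)
        = derivative^[(n.eval R x).down] (listPoly (p.eval R x)) ∧
      List.length ((iterDeriv n p).eval R x) ≤ List.length (p.eval R x) := by
  rw [iterDeriv, Prog.eval]
  induction (n.eval R x).down with
  | zero => exact ⟨rfl, le_rfl⟩
  | succ n ih =>
    rw [List.range_succ, List.foldl_append, List.foldl_cons, List.foldl_nil, listPoly_eval_deriv,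
      length_eval_deriv, Function.iterate_succ_apply']
    refine ⟨?_, (Nat.sub_le _ _).trans ih.2⟩
    rw [← ih.1]
    rfl

theorem listPoly_eval_polyMul (p q : Prog σ (.list .fld)) :
    listPoly ((polyMul p q).eval R x) = listPoly (p.eval R x) * listPoly (q.eval R x) := by
  ext k
  rw [polyMul, coeff_eval_tabulate, eval_add, eval_length, eval_length, coeff_mul,
    Finset.Nat.sum_antidiagonal_eq_sum_range_succ
      (fun i j => (listPoly (p.eval R x)).coeff i * (listPoly (q.eval R x)).coeff j)]
  split_ifs with hk
  · rw [eval_sum, eval_tabulate]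
    have : ((succ arg.snd).eval R ((x, ULift.up k) : Ty.Val F (.prod σ .nat))).down = k + 1 := rfl
    rw [this]
    change _ = ((List.range (k + 1)).map _).sum
    refine congrArg List.sum (List.map_congr_left fun i _ => ?_)
    rw [Prog.eval, eval_nth, eval_nth, eval_sub, coeff_listPoly, coeff_listPoly]
    rfl
  · symm
    refine Finset.sum_eq_zero fun i hi => ?_
    have := Finset.mem_range.1 hi
    rw [coeff_listPoly, coeff_listPoly]
    by_cases h : List.length (p.eval R x) ≤ i
    · rw [getD_of_length_le _ h, zero_mul]
    · rw [getD_of_length_le (l := q.eval R x) _ (by omega), mul_zero]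

theorem listPoly_append_replicate (n : ℕ) (l : List F) :
    listPoly (((List.range n).map fun _ => (0 : F)) ++ l) = X ^ n * listPoly l := by
  rw [List.map_const', List.length_range]
  induction n with
  | zero => simp
  | succ n ih =>
    rw [List.replicate_succ, List.cons_append]
    change C 0 + X * listPoly _ = _
    rw [ih]
    simp [pow_succ']
    ring

theorem listPoly_eval_shift (n : Prog σ .nat) (p : Prog σ (.list .fld)) :
    listPoly ((shift n p).eval R x) = X ^ (n.eval R x).down * listPoly (p.eval R x) := by
  rw [shift, eval_append, eval_tabulate]
  exact listPoly_append_replicate _ _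

theorem eval_linPow (b : Prog σ .fld) (n : Prog σ .nat) :
    listPoly ((linPow b n).eval R x) = affinePower (b.eval R x, (n.eval R x).down) := by
  rw [linPow, Prog.eval]
  induction (n.eval R x).down with
  | zero => simp [affinePower, Prog.eval, listPoly]
  | succ n ih =>
    rw [List.range_succ, List.foldl_append, List.foldl_cons, List.foldl_nil, listPoly_eval_axpy]
    have h1 : ∀ t : List F, listPoly (List.cons (0 : F) t) = X * listPoly t := fun t => by
      change C 0 + X * listPoly t = _
      simp
    generalize List.foldl _ _ _ = t at ih ⊢
    simp only [Prog.eval, h1, ih, affinePower, pow_succ, zero_sub, C_neg]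
    ring

theorem listPoly_eval_applyOp (P : Prog σ (.list (.list .fld))) (g : Prog σ (.list .fld)) :
    listPoly ((applyOp P g).eval R x) = ∑ i ∈ Finset.range (List.length (P.eval R x)),
      listPoly (List.getD (P.eval R x) i []) * derivative^[i] (listPoly (g.eval R x)) := by
  rw [applyOp, Prog.eval, eval_length]
  induction List.length (P.eval R x) with
  | zero => rfl
  | succ n ih =>
    rw [List.range_succ, List.foldl_append, List.foldl_cons, List.foldl_nil, listPoly_eval_axpy,
      listPoly_eval_polyMul, (eval_iterDeriv ..).1, eval_nth, Finset.sum_range_succ, ← ih]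
    generalize List.foldl _ _ _ = t
    simp only [Prog.eval, C_1, one_mul]

theorem eval_countNonzero (p : Prog σ (.list .fld)) :
    ((countNonzero p).eval R x).down = 0 ↔ listPoly (p.eval R x) = 0 := by
  rw [countNonzero, eval_length, eval_flatMap, listPoly_eq_zero_iff, List.length_eq_zero_iff,
    List.flatMap_eq_nil_iff]
  refine forall₂_congr fun y _ => ?_
  rw [eval_ifZero]
  have : ((feq arg.snd fzero).eval R ((x, y) : Ty.Val F (.prod σ .fld))).down = 0 ↔
      y ≠ (0 : F) := by
    classical
    change (if y = (0 : F) then 1 else 0) = 0 ↔ _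
    split_ifs with h <;> simp [h]
  split_ifs with h
  · simpa [Prog.eval] using this.1 h
  · simpa [Prog.eval] using not_not.1 (mt this.2 h)

end Eval

instance (n : Prog σ .nat) (w : Prog (.prod σ .nat) a) [PolyTime.{u} n] [PolyTime.{u} w] :
    PolyTime.{u} (tabulate n w) := inferInstanceAs (PolyTime.{u} (map ..))

instance (c : Prog σ .fld) (p q : Prog σ (.list .fld)) [PolyTime.{u} c] [PolyTime.{u} p]
    [PolyTime.{u} q] : PolyTime.{u} (axpy c p q) := inferInstanceAs (PolyTime.{u} (tabulate ..))

instance (c : Prog σ .fld) (p q : Prog σ (.list (.list .fld))) [PolyTime.{u} c] [PolyTime.{u} p]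
    [PolyTime.{u} q] : PolyTime.{u} (axpyList c p q) := inferInstanceAs (PolyTime.{u} (tabulate ..))

instance (p : Prog σ (.list .fld)) [PolyTime.{u} p] : PolyTime.{u} (deriv p) :=
  inferInstanceAs (PolyTime.{u} (tabulate ..))

instance (n : Prog σ .nat) (p : Prog σ (.list .fld)) [PolyTime.{u} n] [PolyTime.{u} p] :
    PolyTime.{u} (iterDeriv n p) :=
  polyTime_natLoop _ _ _ <| addsBounded_of_le fun F _ R x y t => by
    rw [mag_fldList, mag_fldList, length_eval_deriv]
    have : List.length (state.eval R ((x, (y, t)) : Ty.Val F (.prod σ (.prod .nat (.list .fld)))))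
      = List.length t := rfl
    omega

instance (p q : Prog σ (.list .fld)) [PolyTime.{u} p] [PolyTime.{u} q] :
    PolyTime.{u} (polyMul p q) := inferInstanceAs (PolyTime.{u} (tabulate ..))

instance (n : Prog σ .nat) (p : Prog σ (.list .fld)) [PolyTime.{u} n] [PolyTime.{u} p] :
    PolyTime.{u} (shift n p) := inferInstanceAs (PolyTime.{u} (append ..))

instance (b : Prog σ .fld) (n : Prog σ .nat) [PolyTime.{u} b] [PolyTime.{u} n] :
    PolyTime.{u} (linPow b n) :=
  polyTime_natLoop _ _ _ <| addsBounded_of_le fun F _ R x y t => by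
    rw [mag_fldList, mag_fldList, length_eval_axpy]
    have h1 : List.length (state.eval R
        ((x, (y, t)) : Ty.Val F (.prod σ (.prod .nat (.list .fld)))))
      = List.length t := rfl
    have h2 : List.length ((cons fzero state).eval R
      ((x, (y, t)) : Ty.Val F (.prod σ (.prod .nat (.list .fld))))) = List.length t + 1 := rfl
    omega

instance (P : Prog σ (.list (.list .fld))) (g : Prog σ (.list .fld)) [PolyTime.{u} P]
    [PolyTime.{u} g] : PolyTime.{u} (applyOp P g) :=
  polyTime_natLoop _ _ _ <| addsBounded_of_le_eval
      (polyMul (nth nil (arg.fst.comp P) arg.snd) (iterDeriv arg.snd (arg.fst.comp g)))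
      fun F _ R x y t => by
    rw [mag_fldList, mag_fldList, mag_fldList, length_eval_axpy]
    have h1 : List.length (state.eval R
        ((x, (y, t)) : Ty.Val F (.prod σ (.prod .nat (.list .fld)))))
      = List.length t := rfl
    rw [h1, max_comm]
    refine (max_le_add_of_nonneg (Nat.zero_le _) (Nat.zero_le _)).trans (le_of_eq ?_)
    rfl

instance (p : Prog σ (.list .fld)) [PolyTime.{u} p] : PolyTime.{u} (countNonzero p) :=
  inferInstanceAs (PolyTime.{u} (length ..))

end Prog

/-! ### Polynomial relations of bounded degree by elimination -/

/-- Subtracting multiples of a pivot `p` cuts the span of a set down to the kernel of a linear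
form. -/
theorem span_image_sub_smul {F V : Type*} [Field F] [AddCommGroup V] [Module F V] (φ : V →ₗ[F] F)
    {S : Set V} {p : V} (h : (p ∈ S ∧ φ p ≠ 0) ∨ (p = 0 ∧ ∀ x ∈ S, φ x = 0)) :
    Submodule.span F ((fun x => x - (φ x / φ p) • p) '' S)
      = Submodule.span F S ⊓ LinearMap.ker φ := by
  let T : V →ₗ[F] V := LinearMap.id - φ.smulRight ((φ p)⁻¹ • p)
  have hT : (fun x => x - (φ x / φ p) • p) = T := by
    funext x
    simp [T, div_eq_mul_inv, mul_smul]
  rw [hT, ← Submodule.map_span]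
  have hker : ∀ x ∈ Submodule.span F S, φ x = 0 → T x = x := by
    intro x _ hx
    simp [T, hx]
  apply le_antisymm
  · rw [Submodule.map_span, Submodule.span_le]
    rintro _ ⟨x, hx, rfl⟩
    rcases h with ⟨hp, hφ⟩ | ⟨rfl, hφ⟩
    · refine ⟨Submodule.sub_mem _ (Submodule.subset_span hx) ?_, ?_⟩
      · exact Submodule.smul_mem _ _ (Submodule.smul_mem _ _ (Submodule.subset_span hp))
      · simp [T, hφ]
    · rw [hker x (Submodule.subset_span hx) (hφ x hx)]
      exact ⟨Submodule.subset_span hx, hφ x hx⟩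
  · rintro x ⟨hx, hφ⟩
    exact ⟨x, hx, hker x hx hφ⟩

/-- The type of the rows of the elimination: a polynomial, together with the coefficients of an
expression of it in terms of the given polynomials. -/
abbrev rowTy : Ty := .prod (.list .fld) (.list (.list .fld))

/-- The type of the input of the elimination: polynomials `v i` and bounds `d i` for the degrees of
their coefficients. -/
abbrev systemTy : Ty := .list (.prod (.list .fld) .nat)

namespace Prog

variable {σ : Ty}

/-- `w` at the last element of the list `p` where `c` is zero, or `d` if there is none. -/
def pickLast {a b : Ty} (p : Prog σ (.list a)) (c : Prog (.prod σ a) .nat) (w : Prog (.prod σ a) b)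
    (d : Prog σ b) : Prog σ b :=
  listLoop p d (ifZero ((pair arg.fst item).comp c) ((pair arg.fst item).comp w) state)

instance {a b : Ty} (p : Prog σ (.list a)) (c : Prog (.prod σ a) .nat) (w : Prog (.prod σ a) b)
    (d : Prog σ b) [PolyTime.{u} p] [PolyTime.{u} c] [PolyTime.{u} w] [PolyTime.{u} d] :
    PolyTime.{u} (pickLast p c w d) :=
  polyTime_listLoop _ _ _ <| addsBounded_of_le_eval w fun F _ R x y t => by
    rw [eval_ifZero]
    split_ifs
    · exact Nat.le_add_left _ _
    · exact Nat.le_add_right _ _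

theorem foldl_ite {A B : Type*} (P : A → Prop) [DecidablePred P] (g : A → B) (t : B) (l : List A) :
    (l.foldl (fun t y => if P y then g y else t) t = t ∧ ∀ y ∈ l, ¬ P y) ∨
      ∃ l₁ y l₂, l = l₁ ++ y :: l₂ ∧ P y ∧ (∀ z ∈ l₂, ¬ P z) ∧
        l.foldl (fun t y => if P y then g y else t) t = g y := by
  induction l using List.reverseRecOn with
  | nil => simp
  | append_singleton l y ih =>
    rw [List.foldl_append, List.foldl_cons, List.foldl_nil]
    by_cases hy : P y
    · right
      exact ⟨l, y, [], rfl, hy, by simp, if_pos hy⟩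
    · rw [if_neg hy]
      rcases ih with ⟨h1, h2⟩ | ⟨l₁, z, l₂, rfl, h1, h2, h3⟩
      · left
        refine ⟨h1, fun z hz => ?_⟩
        rcases List.mem_append.1 hz with hz | hz
        · exact h2 z hz
        · rwa [List.mem_singleton.1 hz]
      · right
        refine ⟨l₁, z, l₂ ++ [y], by simp, h1, fun w hw => ?_, h3⟩
        rcases List.mem_append.1 hw with hw | hw
        · exact h2 w hw
        · rwa [List.mem_singleton.1 hw]

theorem eval_pickLast {a b : Ty} {F : Type u} [Field F] (R : List F → List F) (x : σ.Val F)
    (p : Prog σ (.list a)) (c : Prog (.prod σ a) .nat) (w : Prog (.prod σ a) b) (d : Prog σ b)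
    {l : List (a.Val F)} (hl : p.eval R x = l) :
    ((pickLast p c w d).eval R x = d.eval R x ∧ ∀ y ∈ l, (c.eval R (x, y)).down ≠ 0) ∨
      ∃ l₁ y l₂, l = l₁ ++ y :: l₂ ∧ (c.eval R (x, y)).down = 0 ∧
        (∀ z ∈ l₂, (c.eval R (x, z)).down ≠ 0) ∧
        (pickLast p c w d).eval R x = w.eval R (x, y) := by
  rw [pickLast, Prog.eval, hl]
  simp only [eval_ifZero]
  exact foldl_ite (fun y : a.Val F => (c.eval R (x, y)).down = 0) (fun y => w.eval R (x, y))
    (d.eval R x) l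

theorem mem_of_eq_append_cons {A : Type*} {l l₁ l₂ : List A} {y : A} (h : l = l₁ ++ y :: l₂) :
    y ∈ l := by
  rw [h]; simp

/-- The list of length `n` with the entry `m` at the position `i` and zero polynomials elsewhere. -/
def unitList (n i : Prog σ .nat) (m : Prog σ (.list .fld)) : Prog σ (.list (.list .fld)) :=
  tabulate n (ifZero (add (sub (arg.fst.comp i) arg.snd) (sub arg.snd (arg.fst.comp i)))
    (arg.fst.comp m) nil)

/-- On input `((v, d), i, j)`, the row for `X ^ j * v i`. -/
def initialRow : Prog (.prod (.prod systemTy .nat) .nat) rowTy :=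
  pair (shift arg.snd (nth (pair nil zero) arg.fst.fst arg.fst.snd).fst)
    (unitList (length arg.fst.fst) arg.fst.snd (shift arg.snd (cons fone nil)))

/-- The rows for `X ^ j * v i`, where `j ≤ d i`. -/
def initialRows : Prog systemTy (.list rowTy) :=
  flatMap (range (length arg)) <|
    map (range (succ (nth (pair nil zero) arg.fst arg.snd).snd)) initialRow

/-- A row with a nonzero coefficient of `X ^ k`, or zero if there is none. -/
def pivot : Prog (.prod (.list rowTy) .nat) rowTy :=
  pickLast arg.fst (feq (nth fzero arg.snd.fst arg.fst.snd) fzero) arg.snd (pair nil nil)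

/-- On input `(row, p, k)`, the factor of `p` that cancels the coefficient of `X ^ k` in the row. -/
def cancelCoeff : Prog (.prod rowTy (.prod rowTy .nat)) .fld :=
  fsub fzero (fdiv (nth fzero arg.fst.fst arg.snd.snd) (nth fzero arg.snd.fst.fst arg.snd.snd))

/-- On input `(row, p, k)`, the row minus the multiple of `p` that cancels its coefficient of
`X ^ k`. -/
def reduceRow : Prog (.prod rowTy (.prod rowTy .nat)) rowTy :=
  pair (axpy cancelCoeff arg.snd.fst.fst arg.fst.fst)
    (axpyList cancelCoeff arg.snd.fst.snd arg.fst.snd)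

def eliminationStep : Prog (.prod (.list rowTy) .nat) (.list rowTy) :=
  map arg.fst ((pair arg.snd (pair (arg.fst.comp pivot) arg.fst.snd)).comp reduceRow)

/-- On input `(rows, M)`, rows that span the combinations of the given ones whose coefficients of
`X ^ k` vanish for all `k < M`. -/
def eliminate : Prog (.prod (.list rowTy) .nat) (.list rowTy) :=
  natLoop arg.snd arg.fst ((pair state item).comp eliminationStep)

/-- The coefficients of some row for which they do not all vanish, or the empty list. -/
def pickRelation : Prog (.list rowTy) (.list (.list .fld)) :=
  pickLast arg (ifZero (countNonzero (flatMap arg.snd.snd arg.snd)) (succ zero) zero) arg.snd.snd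
    nil

/-- For a list of polynomials `v i` and numbers `d i`, polynomials `Q i` of degree at most `d i`,
not all zero, with `∑ i, Q i * v i = 0`; or the empty list if there are none.  The total length of
the rows serves as a bound for the degrees. -/
def findRelation : Prog systemTy (.list (.list .fld)) :=
  (initialRows.comp (pair arg (length (flatMap arg arg.snd.fst)))).comp
    (eliminate.comp pickRelation)

instance (n i : Prog σ .nat) (m : Prog σ (.list .fld)) [PolyTime.{u} n] [PolyTime.{u} i]
    [PolyTime.{u} m] : PolyTime.{u} (unitList n i m) := inferInstanceAs (PolyTime.{u} (tabulate ..))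

instance : PolyTime.{u} initialRow := inferInstanceAs (PolyTime.{u} (pair ..))

instance : PolyTime.{u} initialRows := inferInstanceAs (PolyTime.{u} (flatMap ..))

section Eval

variable {F : Type u} [Field F] (R : List F → List F)

theorem eval_unitList (x : σ.Val F) (n i : Prog σ .nat) (m : Prog σ (.list .fld)) :
    (unitList n i m).eval R x = (List.range (n.eval R x).down).map fun k =>
      if k = (i.eval R x).down then (m.eval R x : List F) else [] := by
  rw [unitList, eval_tabulate]
  refine List.map_congr_left fun k _ => ?_
  rw [eval_ifZero, eval_add, eval_sub, eval_sub]
  have h : ((i.eval R x).down - k + (k - (i.eval R x).down) = 0) ↔ k = (i.eval R x).down := by omega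
  exact if_congr h rfl rfl

end Eval

end Prog

/-- The values of the rows of the elimination. -/
abbrev Row (F : Type u) : Type u := List F × List (List F)

section Rows

variable {F : Type u} [Field F] (R : List F → List F)

/-- The polynomial of a row and the coefficients of its expression. -/
noncomputable def Row.toProd (y : Row F) : F[X] × (ℕ → F[X]) :=
  (listPoly y.1, fun i => listPoly (y.2.getD i []))

/-- The combinations of the rows. -/
noncomputable def rowSpan (rows : List (Row F)) : Submodule F (F[X] × (ℕ → F[X])) :=
  Submodule.span F (Row.toProd '' {y | y ∈ rows})

theorem toProd_mem_rowSpan {rows : List (Row F)} {y : Row F} (hy : y ∈ rows) :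
    y.toProd ∈ rowSpan rows := Submodule.subset_span ⟨y, hy, rfl⟩

theorem rowSpan_map {rows : List (Row F)} {g : Row F → Row F}
    {T : F[X] × (ℕ → F[X]) → F[X] × (ℕ → F[X])} (h : ∀ y, (g y).toProd = T y.toProd) :
    rowSpan (rows.map g) = Submodule.span F (T '' (Row.toProd '' {y | y ∈ rows})) := by
  rw [rowSpan]
  congr 1
  ext z
  constructor
  · rintro ⟨_, hy, rfl⟩
    obtain ⟨y, hy', rfl⟩ := List.mem_map.1 hy
    exact ⟨y.toProd, ⟨y, hy', rfl⟩, (h y).symm⟩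
  · rintro ⟨_, ⟨y, hy, rfl⟩, rfl⟩
    exact ⟨g y, List.mem_map.2 ⟨y, hy, rfl⟩, h y⟩

/-- The value of `Prog.pivot`. -/
noncomputable def pivotRow (rows : List (Row F)) (k : ℕ) : Row F :=
  Prog.pivot.eval R (rows, ULift.up k)

/-- The value of `Prog.reduceRow`. -/
noncomputable def reducedRow (y p : Row F) (k : ℕ) : Row F :=
  Prog.reduceRow.eval R (y, (p, ULift.up k))

/-- The value of `Prog.eliminate`. -/
noncomputable def eliminated (rows : List (Row F)) (M : ℕ) : List (Row F) :=
  Prog.eliminate.eval R (rows, ULift.up M)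

open Prog in
theorem pivotRow_spec (rows : List (Row F)) (k : ℕ) :
    (pivotRow R rows k ∈ rows ∧ (pivotRow R rows k).1.getD k 0 ≠ 0) ∨
      (pivotRow R rows k = ([], []) ∧ ∀ y ∈ rows, y.1.getD k 0 = 0) := by
  have hc : ∀ y : Row F, ((feq (nth fzero arg.snd.fst arg.fst.snd) fzero).eval R
      (((rows, ULift.up k), y) : Ty.Val F (.prod (.prod (.list rowTy) .nat) rowTy))).down = 0 ↔
        y.1.getD k 0 ≠ 0 := by
    classical
    intro y
    rw [Prog.eval, eval_nth]
    change (if y.1.getD k 0 = 0 then 1 else 0) = 0 ↔ _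
    split_ifs with h
    · exact iff_of_false (by simp) (not_not.2 h)
    · exact iff_of_true rfl h
  rcases eval_pickLast (a := rowTy) (b := rowTy) R
    (x := ((rows, ULift.up k) : Ty.Val F (.prod (.list rowTy) .nat)))
    (p := arg.fst) (c := feq (nth fzero arg.snd.fst arg.fst.snd) fzero) (w := arg.snd)
    (d := pair nil nil) (l := rows) rfl with ⟨h1, h2⟩ | ⟨l₁, y, l₂, hl, h1, -, h2⟩
  · right
    exact ⟨h1, fun y hy => not_not.1 (mt (hc y).2 (h2 y hy))⟩
  · left
    have h3 : pivotRow R rows k = y := h2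
    rw [h3]
    exact ⟨mem_of_eq_append_cons hl, (hc y).1 h1⟩

open Prog in
theorem toProd_reducedRow (y p : Row F) (k : ℕ) :
    (reducedRow R y p k).toProd
      = y.toProd - (y.toProd.1.coeff k / p.toProd.1.coeff k) • p.toProd := by
  have hc : ∀ x : Ty.Val F (.prod rowTy (.prod rowTy .nat)), cancelCoeff.eval R x
      = 0 - (listPoly x.1.1).coeff x.2.2.down / (listPoly x.2.1.1).coeff x.2.2.down := by
    intro x
    simp only [cancelCoeff, Prog.eval]
    rw [eval_nth, eval_nth, coeff_listPoly, coeff_listPoly]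
    simp only [Prog.eval]
  have h : ∀ x : Ty.Val F (.prod rowTy (.prod rowTy .nat)),
      Row.toProd (reduceRow.eval R x) = Row.toProd x.1
        - ((listPoly x.1.1).coeff x.2.2.down / (listPoly x.2.1.1).coeff x.2.2.down)
          • Row.toProd x.2.1 := by
    intro x
    rw [reduceRow, Prog.eval, Row.toProd]
    ext1
    · simp only [Row.toProd, Prod.fst_sub, Prod.smul_fst, smul_eq_C_mul]
      rw [listPoly_eval_axpy, hc]
      simp only [Prog.eval, zero_sub, C_neg]
      ring
    · funext i
      simp only [Row.toProd, Prod.snd_sub, Prod.smul_snd, Pi.sub_apply, Pi.smul_apply,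
        smul_eq_C_mul]
      rw [eval_axpyList_getD, hc]
      simp only [Prog.eval, zero_sub, C_neg]
      ring
  exact h (y, (p, ULift.up k))

open Prog in
theorem length_reducedRow (y p : Row F) (k : ℕ) :
    (reducedRow R y p k).1.length = max p.1.length y.1.length ∧
      (reducedRow R y p k).2.length = max p.2.length y.2.length := by
  have h : ∀ x : Ty.Val F (.prod rowTy (.prod rowTy .nat)),
      List.length (reduceRow.eval R x).1 = max (List.length x.2.1.1) (List.length x.1.1) ∧
        List.length (reduceRow.eval R x).2 = max (List.length x.2.1.2) (List.length x.1.2) := by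
    intro x
    rw [reduceRow, Prog.eval]
    constructor
    · dsimp only
      rw [length_eval_axpy]
      simp only [Prog.eval]
    · dsimp only
      rw [length_eval_axpyList]
      simp only [Prog.eval]
  exact h (y, (p, ULift.up k))

open Prog in
theorem eval_eliminationStep (rows : List (Row F)) (k : ℕ) :
    eliminationStep.eval R (rows, ULift.up k)
      = rows.map fun y => reducedRow R y (pivotRow R rows k) k := by
  rw [eliminationStep, Prog.eval_map]
  rfl

theorem eliminated_succ (rows : List (Row F)) (M : ℕ) :
    eliminated R rows (M + 1) = (eliminated R rows M).map fun y =>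
      reducedRow R y (pivotRow R (eliminated R rows M) M) M := by
  rw [← eval_eliminationStep]
  simp only [eliminated, Prog.eliminate, Prog.eval, List.range_succ, List.foldl_append,
    List.foldl_cons, List.foldl_nil]

/-- The elimination computes all the combinations of the rows whose polynomial has no coefficients
below `X ^ M`. -/
theorem mem_rowSpan_eliminated (rows : List (Row F)) (M : ℕ) (z : F[X] × (ℕ → F[X])) :
    z ∈ rowSpan (eliminated R rows M) ↔ z ∈ rowSpan rows ∧ ∀ k < M, z.1.coeff k = 0 := by
  induction M with
  | zero => exact ⟨fun h => ⟨h, fun k hk => absurd hk k.not_lt_zero⟩, And.left⟩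
  | succ M ih =>
    rw [eliminated_succ,
      rowSpan_map (fun y => toProd_reducedRow R y (pivotRow R (eliminated R rows M) M) M)
      (T := fun z => z - (z.1.coeff M / (pivotRow R (eliminated R rows M) M).toProd.1.coeff M) •
        (pivotRow R (eliminated R rows M) M).toProd)]
    have := span_image_sub_smul ((lcoeff F M).comp (LinearMap.fst F F[X] (ℕ → F[X])))
      (S := Row.toProd '' {y | y ∈ eliminated R rows M})
      (p := (pivotRow R (eliminated R rows M) M).toProd) (by
        rcases pivotRow_spec R (eliminated R rows M) M with ⟨h1, h2⟩ | ⟨h1, h2⟩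
        · left
          refine ⟨⟨_, h1, rfl⟩, ?_⟩
          simpa [Row.toProd, coeff_listPoly] using h2
        · right
          rw [h1]
          refine ⟨rfl, ?_⟩
          rintro _ ⟨y, hy, rfl⟩
          simpa [Row.toProd, coeff_listPoly] using h2 y hy)
    simp only [LinearMap.comp_apply, LinearMap.fst_apply, lcoeff_apply] at this
    rw [this, Submodule.mem_inf, ← rowSpan, ih, LinearMap.mem_ker, Nat.forall_lt_succ_right,
      and_assoc]
    rfl

theorem length_snd_eliminated {rows : List (Row F)} {n : ℕ} (h : ∀ y ∈ rows, y.2.length = n)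
    (M : ℕ) : ∀ y ∈ eliminated R rows M, y.2.length = n := by
  induction M with
  | zero => exact h
  | succ M ih =>
    rw [eliminated_succ]
    intro y hy
    obtain ⟨z, hz, rfl⟩ := List.mem_map.1 hy
    rw [(length_reducedRow ..).2, ih z hz]
    rcases pivotRow_spec R (eliminated R rows M) M with ⟨h1, -⟩ | ⟨h1, -⟩
    · rw [ih _ h1, max_self]
    · rw [h1]; exact max_eq_right (Nat.zero_le _)

open Prog in
theorem pickRelation_spec (rows : List (Row F)) :
    (pickRelation.eval R rows = ([] : List (List F)) ∧
      ∀ y ∈ rows, ∀ i, listPoly (y.2.getD i []) = 0) ∨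
    ∃ y ∈ rows, pickRelation.eval R rows = y.2 ∧
      ∃ i < y.2.length, listPoly (y.2.getD i []) ≠ 0 := by
  have hc : ∀ y : Row F, ((ifZero (countNonzero (flatMap arg.snd.snd arg.snd)) (succ zero)
      zero).eval R ((rows, y) : Ty.Val F (.prod (.list rowTy) rowTy))).down = 0 ↔
        ∃ i < y.2.length, listPoly (y.2.getD i []) ≠ 0 := by
    intro y
    have h0 : ((countNonzero (flatMap arg.snd.snd arg.snd)).eval R
        ((rows, y) : Ty.Val F (.prod (.list rowTy) rowTy))).down = 0 ↔
          ∀ i < y.2.length, listPoly (y.2.getD i []) = 0 := by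
      rw [eval_countNonzero, eval_flatMap, listPoly_eq_zero_iff]
      change (∀ z ∈ List.flatMap (fun m => m) y.2, z = 0) ↔ _
      simp only [List.mem_flatMap]
      constructor
      · intro h i hi
        rw [listPoly_eq_zero_iff]
        intro z hz
        rw [List.getD_eq_getElem _ _ hi] at hz
        exact h z ⟨_, List.getElem_mem hi, hz⟩
      · rintro h z ⟨m, hm, hz⟩
        obtain ⟨i, hi, rfl⟩ := List.mem_iff_getElem.1 hm
        have := h i hi
        rw [List.getD_eq_getElem _ _ hi] at this
        exact listPoly_eq_zero_iff.1 this z hz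
    rw [eval_ifZero]
    split_ifs with h
    · refine iff_of_false (by simp [Prog.eval]) ?_
      have := h0.1 h
      push Not
      exact this
    · refine iff_of_true rfl ?_
      have := mt h0.2 h
      push Not at this
      exact this
  rcases eval_pickLast (a := rowTy) (b := .list (.list .fld)) R
    (x := (rows : Ty.Val F (.list rowTy)))
    (p := arg) (c := ifZero (countNonzero (flatMap arg.snd.snd arg.snd)) (succ zero) zero)
    (w := arg.snd.snd) (d := nil) (l := rows) rfl with ⟨h1, h2⟩ | ⟨l₁, y, l₂, hl, h1, -, h2⟩
  · left
    refine ⟨h1, fun y hy i => ?_⟩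
    by_cases hi : i < y.2.length
    · have := mt (hc y).2 (h2 y hy)
      push Not at this
      exact this i hi
    · rw [getD_of_length_le _ (by omega)]; rfl
  · right
    exact ⟨y, mem_of_eq_append_cons hl, h2, (hc y).1 h1⟩

end Rows

/-! ### Cost and correctness of the elimination -/

namespace Prog

instance : PolyTime.{u} pivot := inferInstanceAs (PolyTime.{u} (pickLast ..))

instance : PolyTime.{u} cancelCoeff := inferInstanceAs (PolyTime.{u} (fsub ..))

instance : PolyTime.{u} reduceRow := inferInstanceAs (PolyTime.{u} (pair ..))

instance : PolyTime.{u} eliminationStep := inferInstanceAs (PolyTime.{u} (map ..))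

instance : PolyTime.{u} pickRelation := inferInstanceAs (PolyTime.{u} (pickLast ..))

theorem mag_eval_axpyList_le {σ : Ty} {F : Type u} [Field F] (R : List F → List F) (x : σ.Val F)
    (c : Prog σ .fld) (p q : Prog σ (.list (.list .fld))) :
    mag (.list (.list .fld)) ((axpyList c p q).eval R x)
      ≤ Max.max (mag (.list (.list .fld)) (p.eval R x))
        (mag (.list (.list .fld)) (q.eval R x)) := by
  have hgetD : ∀ (l : List (List F)) (i : ℕ),
      (l.getD i []).length ≤ mag (F := F) (.list (.list .fld)) l := by
    intro l i
    by_cases hi : i < l.length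
    · rw [List.getD_eq_getElem _ _ hi, ← mag_fldList]
      exact mag_le_of_mem (F := F) (a := .list .fld) (List.getElem_mem hi)
    · rw [getD_of_length_le _ (by omega)]
      exact Nat.zero_le _
  refine mag_list_le.2 ⟨?_, fun y hy => ?_⟩
  · rw [length_eval_axpyList]
    exact max_le_max (length_le_mag (a := .list .fld) _) (length_le_mag (a := .list .fld) _)
  · rw [axpyList, eval_tabulate] at hy
    obtain ⟨i, -, rfl⟩ := List.mem_map.1 hy
    rw [mag_fldList, length_eval_axpy, eval_nth, eval_nth]
    exact max_le_max (hgetD _ _) (hgetD _ _)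

end Prog

section Rows

variable {F : Type u} [Field F] (R : List F → List F)

open Prog in
theorem mag_reducedRow_le (y p : Row F) (k : ℕ) :
    mag (F := F) rowTy (reducedRow R y p k)
      ≤ max (mag (F := F) rowTy p) (mag (F := F) rowTy y) := by
  have h : ∀ x : Ty.Val F (.prod rowTy (.prod rowTy .nat)),
      mag rowTy (reduceRow.eval R x) ≤ max (mag rowTy x.2.1) (mag rowTy x.1) := by
    intro x
    have h1 : mag (F := F) (.list .fld) (reduceRow.eval R x).1
        ≤ max (mag (F := F) (.list .fld) x.2.1.1) (mag (F := F) (.list .fld) x.1.1) := by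
      rw [reduceRow, Prog.eval]
      dsimp only
      rw [mag_fldList, length_eval_axpy, mag_fldList, mag_fldList]
      simp only [Prog.eval, le_refl]
    have h2 : mag (F := F) (.list (.list .fld)) (reduceRow.eval R x).2
        ≤ max (mag (F := F) (.list (.list .fld)) x.2.1.2)
          (mag (F := F) (.list (.list .fld)) x.1.2) := by
      rw [reduceRow, Prog.eval]
      dsimp only
      refine (mag_eval_axpyList_le ..).trans ?_
      simp only [Prog.eval, le_refl]
    simp only [mag] at h1 h2 ⊢
    omega
  exact h (y, (p, ULift.up k))

open Prog in
theorem mag_eval_eliminationStep_le (rows : List (Row F)) (k : ℕ) :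
    mag (.list rowTy) (eliminationStep.eval R (rows, ULift.up k))
      ≤ mag (F := F) (.list rowTy) rows := by
  rw [eval_eliminationStep]
  refine mag_list_le.2 ⟨?_, fun y hy => ?_⟩
  · rw [List.length_map]; exact length_le_mag (F := F) (a := rowTy) rows
  · obtain ⟨z, hz, rfl⟩ := List.mem_map.1 hy
    refine (mag_reducedRow_le R z _ k).trans (max_le ?_ (mag_le_of_mem (F := F) (a := rowTy) hz))
    rcases pivotRow_spec R rows k with ⟨h, -⟩ | ⟨h, -⟩
    · exact mag_le_of_mem (F := F) (a := rowTy) h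
    · rw [h]; exact Nat.zero_le _

instance : PolyTime.{u} Prog.eliminate :=
  polyTime_natLoop _ _ _ <| addsBounded_of_le fun F _ R x y t => by
    have := mag_eval_eliminationStep_le R t y.down
    exact this.trans (by omega)

instance : PolyTime.{u} Prog.findRelation := inferInstanceAs (PolyTime.{u} (Prog.comp ..))

/-- The polynomials of a system. -/
noncomputable def sysPoly (L : List (List F × ULift.{u} ℕ)) (i : ℕ) : F[X] :=
  listPoly (L.getD i ([], ULift.up 0)).1

/-- The degree bounds of a system. -/
def sysDeg (L : List (List F × ULift.{u} ℕ)) (i : ℕ) : ℕ := (L.getD i ([], ULift.up 0)).2.down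

open Prog in
theorem eval_initialRow (L : List (List F × ULift.{u} ℕ)) {i : ℕ} (hi : i < L.length) (j : ℕ) :
    Row.toProd (initialRow.eval R ((L, ULift.up i), ULift.up j))
        = (X ^ j * sysPoly L i, Pi.single i (X ^ j)) ∧
      List.length (initialRow.eval R ((L, ULift.up i), ULift.up j)).2 = L.length := by
  have h : ∀ x : Ty.Val F (.prod (.prod systemTy .nat) .nat), x.1.2.down < List.length x.1.1 →
      Row.toProd (initialRow.eval R x)
        = (X ^ x.2.down * sysPoly x.1.1 x.1.2.down, Pi.single x.1.2.down (X ^ x.2.down)) ∧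
      List.length (initialRow.eval R x).2 = List.length x.1.1 := by
    intro x hx
    rw [initialRow, Prog.eval]
    refine ⟨?_, ?_⟩
    · rw [Row.toProd]
      ext1
      · dsimp only
        rw [listPoly_eval_shift, Prog.eval, eval_nth]
        simp only [Prog.eval]
        rfl
      · dsimp only
        funext k
        rw [eval_unitList, getD_map_range, eval_length]
        have h1 : listPoly [(1 : F)] = 1 := by simp [listPoly]
        by_cases h3 : k = x.1.2.down
        · rw [h3, if_pos (by exact hx), if_pos (by rfl), Pi.single_eq_same, listPoly_eval_shift]
          exact (congrArg _ h1).trans (mul_one _)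
        · rw [if_neg (c := k = _) (by exact h3), ite_self, Pi.single_eq_of_ne h3]; rfl
    · dsimp only
      rw [eval_unitList, List.length_map, List.length_range, eval_length]
      simp only [Prog.eval]
  exact h ((L, ULift.up i), ULift.up j) hi

open Prog in
theorem eval_initialRows (L : List (List F × ULift.{u} ℕ)) :
    initialRows.eval R L = (List.range L.length).flatMap fun i =>
      (List.range (sysDeg L i + 1)).map fun j =>
        (initialRow.eval R ((L, ULift.up i), ULift.up j) : Row F) := by
  rw [initialRows, eval_flatMap, eval_range, eval_length, List.flatMap_map]
  refine List.flatMap_congr fun i _ => ?_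
  rw [Prog.eval_map, eval_range, List.map_map]
  simp only [Prog.eval]
  rw [eval_nth]
  rfl

/-- The elements of the span of the initial rows are the polynomial combinations with the
prescribed degree bounds. -/
theorem mem_rowSpan_initialRows {L : List (List F × ULift.{u} ℕ)} {z : F[X] × (ℕ → F[X])}
    (hz : z ∈ rowSpan (Prog.initialRows.eval R L)) :
    z.1 = ∑ i ∈ Finset.range L.length, z.2 i * sysPoly L i ∧
      ∀ i, (z.2 i).natDegree ≤ sysDeg L i := by
  induction hz using Submodule.span_induction with
  | mem z hz =>
    obtain ⟨y, hy, rfl⟩ := hz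
    have hy' : y ∈ Prog.initialRows.eval R L := hy
    rw [eval_initialRows] at hy'
    obtain ⟨i, hi, hy'⟩ := List.mem_flatMap.1 hy'
    obtain ⟨j, hj, rfl⟩ := List.mem_map.1 hy'
    rw [List.mem_range] at hi hj
    rw [(eval_initialRow R L hi j).1]
    refine ⟨?_, fun k => ?_⟩
    · dsimp only
      rw [Finset.sum_eq_single i]
      · rw [Pi.single_eq_same]
      · intro k _ hk
        rw [Pi.single_eq_of_ne hk, zero_mul]
      · intro h
        exact absurd (Finset.mem_range.2 hi) h
    · dsimp only
      by_cases hk : k = i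
      · subst hk
        rw [Pi.single_eq_same, natDegree_X_pow]; omega
      · rw [Pi.single_eq_of_ne hk]; simp
  | zero => simp
  | add z w _ _ hz hw =>
    refine ⟨?_, fun i => ?_⟩
    · simp [hz.1, hw.1, add_mul, Finset.sum_add_distrib]
    · exact (natDegree_add_le _ _).trans (max_le (hz.2 i) (hw.2 i))
  | smul c z _ hz =>
    refine ⟨?_, fun i => ?_⟩
    · simp [hz.1, Finset.smul_sum]
    · exact (natDegree_smul_le _ _).trans (hz.2 i)

theorem mem_rowSpan_of_natDegree_le {L : List (List F × ULift.{u} ℕ)} {Q : ℕ → F[X]}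
    (hQ : ∀ i < L.length, (Q i).natDegree ≤ sysDeg L i) :
    (∑ i ∈ Finset.range L.length, Q i * sysPoly L i,
      ∑ i ∈ Finset.range L.length, Pi.single i (Q i)) ∈
        rowSpan (Prog.initialRows.eval R L) := by
  have hsum : (∑ i ∈ Finset.range L.length, Q i * sysPoly L i,
      ∑ i ∈ Finset.range L.length, (Pi.single i (Q i) : ℕ → F[X]))
        = ∑ i ∈ Finset.range L.length, (Q i * sysPoly L i, Pi.single i (Q i)) := by
    ext1
    · rw [Prod.fst_sum]
    · rw [Prod.snd_sum]
  rw [hsum]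
  refine Submodule.sum_mem _ fun i hi => ?_
  rw [Finset.mem_range] at hi
  have : (Q i * sysPoly L i, (Pi.single i (Q i) : ℕ → F[X]))
      = ∑ j ∈ Finset.range (sysDeg L i + 1),
        (Q i).coeff j • (X ^ j * sysPoly L i, (Pi.single i (X ^ j) : ℕ → F[X])) := by
    have h := (Q i).as_sum_range' (sysDeg L i + 1) (Nat.lt_succ_of_le (hQ i hi))
    simp only [← C_mul_X_pow_eq_monomial] at h
    ext1
    · rw [Prod.fst_sum]
      conv_lhs => rw [h]
      simp [Finset.sum_mul, smul_eq_C_mul, mul_assoc]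
    · rw [Prod.snd_sum]
      funext k
      rw [Finset.sum_apply]
      by_cases hk : k = i
      · subst hk
        simp only [Prod.smul_snd, Pi.smul_apply, Pi.single_eq_same, smul_eq_C_mul]
        exact h
      · simp [Pi.single_eq_of_ne hk]
  rw [this]
  refine Submodule.sum_mem _ fun j hj => Submodule.smul_mem _ _ ?_
  rw [← (eval_initialRow R L hi j).1]
  refine toProd_mem_rowSpan ?_
  rw [eval_initialRows]
  exact List.mem_flatMap.2 ⟨i, List.mem_range.2 hi, List.mem_map.2
    ⟨j, List.mem_range.2 (Finset.mem_range.1 hj), rfl⟩⟩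

/-- The total length of the rows. -/
def rowsBound (rows : List (Row F)) : ℕ := (rows.flatMap fun y => y.1).length

theorem coeff_eq_zero_of_mem_rowSpan {rows : List (Row F)} {z : F[X] × (ℕ → F[X])}
    (hz : z ∈ rowSpan rows) {k : ℕ} (hk : rowsBound rows ≤ k) : z.1.coeff k = 0 := by
  induction hz using Submodule.span_induction with
  | mem z hz =>
    obtain ⟨y, hy, rfl⟩ := hz
    have hle : y.1.length ≤ rowsBound rows := by
      rw [rowsBound, List.length_flatMap]
      exact List.le_sum_of_mem (List.mem_map.2 ⟨y, hy, rfl⟩)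
    rw [Row.toProd, coeff_listPoly, getD_of_length_le _ (hle.trans hk)]
  | zero => simp
  | add z w _ _ hz hw => simp [hz, hw]
  | smul c z _ hz => simp [hz]

open Prog in
theorem eval_findRelation (L : List (List F × ULift.{u} ℕ)) :
    findRelation.eval R L = pickRelation.eval R (eliminated R (initialRows.eval R L)
      (rowsBound (initialRows.eval R L))) := by
  have h : ∀ rows : Ty.Val F (.list rowTy),
      (pair arg (length (flatMap arg arg.snd.fst)) : Prog (.list rowTy) _).eval R rows
        = (rows, ULift.up (rowsBound rows)) := by
    intro rows
    rw [Prog.eval]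
    refine Prod.ext rfl (ULift.ext _ _ ?_)
    dsimp only
    rw [eval_length, eval_flatMap]
    rfl
  rw [findRelation, Prog.eval, Prog.eval, Prog.eval, h]
  rfl

/-- After eliminating as many coefficients as the rows have in total, the rows that are left span
the space of all relations. -/
theorem findRelation_spec (L : List (List F × ULift.{u} ℕ)) {c : List (List F)}
    (hc : Prog.findRelation.eval R L = c) :
    (c = [] ∧ ∀ Q : ℕ → F[X], (∀ i < L.length, (Q i).natDegree ≤ sysDeg L i) →
        ∑ i ∈ Finset.range L.length, Q i * sysPoly L i = 0 → ∀ i < L.length, Q i = 0) ∨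
      (c.length = L.length ∧ (∃ i < L.length, listPoly (c.getD i []) ≠ 0) ∧
        (∀ i, (listPoly (c.getD i [])).natDegree ≤ sysDeg L i) ∧
        ∑ i ∈ Finset.range L.length, listPoly (c.getD i []) * sysPoly L i = 0) := by
  rw [eval_findRelation] at hc
  subst hc
  set rows : List (Row F) := Prog.initialRows.eval R L with hrows
  have hlen : ∀ y ∈ rows, y.2.length = L.length := by
    intro y hy
    rw [hrows, eval_initialRows] at hy
    obtain ⟨i, hi, hy⟩ := List.mem_flatMap.1 hy
    obtain ⟨j, -, rfl⟩ := List.mem_map.1 hy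
    exact (eval_initialRow R L (List.mem_range.1 hi) j).2
  have hspan := mem_rowSpan_eliminated R rows (rowsBound rows)
  rcases pickRelation_spec R (eliminated R rows (rowsBound rows)) with ⟨h1, h2⟩ | ⟨y, hy, h1, h2⟩
  · left
    refine ⟨h1, fun Q hQ hQ0 i hi => ?_⟩
    have hmem := mem_rowSpan_of_natDegree_le R hQ
    rw [hQ0] at hmem
    have hmem' := (hspan _).2 ⟨hmem, fun _ _ => by simp⟩
    have hle : rowSpan (eliminated R rows (rowsBound rows)) ≤
        LinearMap.ker (LinearMap.snd F F[X] (ℕ → F[X])) := by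
      rw [rowSpan, Submodule.span_le]
      rintro _ ⟨y, hy, rfl⟩
      exact funext fun i => h2 y hy i
    have := congrFun (hle hmem' : _ = (0 : ℕ → F[X])) i
    simpa [Finset.sum_apply, Pi.single_apply, hi] using this
  · right
    rw [h1]
    obtain ⟨hy1, hy2⟩ := (hspan _).1 (toProd_mem_rowSpan hy)
    have hyl := length_snd_eliminated R hlen _ y hy
    obtain ⟨hy3, hy4⟩ := mem_rowSpan_initialRows R hy1
    refine ⟨hyl, hyl ▸ h2, hy4, ?_⟩
    have h0 : y.toProd.1 = 0 := by
      ext k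
      rw [coeff_zero]
      by_cases hk : k < rowsBound rows
      · exact hy2 k hk
      · exact coeff_eq_zero_of_mem_rowSpan hy1 (by omega)
    exact hy3.symm.trans h0

end Rows

/-! ### The stages of the algorithm -/

theorem natDegree_listPoly_le {F : Type u} [Field F] (l : List F) :
    (listPoly l).natDegree ≤ l.length :=
  natDegree_le_iff_coeff_eq_zero.2 fun k hk => by
    rw [coeff_listPoly, getD_of_length_le _ hk.le]

theorem IsRootFinder.length_le {F : Type u} [Field F] {R : List F → List F} (hR : IsRootFinder R)
    {l : List F} (hl : listPoly l ≠ 0) : (R l).length ≤ l.length := by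
  obtain ⟨h1, h2⟩ := hR l hl
  have h3 : ((R l : List F) : Multiset F) ≤ (listPoly l).roots :=
    (Multiset.le_iff_subset (Multiset.coe_nodup.2 h1)).2 fun b hb => (mem_roots hl).2 ((h2 b).1 hb)
  calc (R l).length = Multiset.card ((R l : List F) : Multiset F) := rfl
    _ ≤ Multiset.card (listPoly l).roots := Multiset.card_le_card h3
    _ ≤ (listPoly l).natDegree := card_roots' _
    _ ≤ l.length := natDegree_listPoly_le l

namespace Prog

variable {σ a : Ty}

/-- The roots of a nonzero polynomial.  The root finder is called only after checking that the
polynomial is nonzero, as its answer on the zero polynomial can be arbitrarily long. -/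
def findRoots (p : Prog σ (.list .fld)) : Prog σ (.list .fld) :=
  ifZero (countNonzero p) nil (roots p)

theorem eval_findRoots {F : Type u} [Field F] (R : List F → List F) (x : σ.Val F)
    (p : Prog σ (.list .fld)) (h : listPoly (p.eval R x) ≠ 0) :
    (findRoots p).eval R x = R (p.eval R x) := by
  rw [findRoots, eval_ifZero, if_neg (mt (eval_countNonzero R x p).1 h)]
  rfl

instance (p : Prog σ (.list .fld)) [PolyTime.{u} p] : PolyTime.{u} (findRoots p) := by
  obtain ⟨k, hc, hp⟩ := PolyTime.pair_bound (countNonzero p) p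
  refine ⟨k + 4, fun F _ R hR x => ?_⟩
  obtain ⟨c1, c2⟩ := hc F R hR x
  obtain ⟨p1, p2⟩ := hp F R hR x
  rw [mag_fldList] at p2
  have hpow : (mag σ x + 2) ^ k * 16 ≤ (mag σ x + 2) ^ (k + 4) := by
    rw [pow_add]
    exact Nat.mul_le_mul_left _ (Nat.pow_le_pow_left (by omega : 2 ≤ mag σ x + 2) 4)
  have hcases := eval_countNonzero R x p
  have hlen : listPoly (p.eval R x) ≠ 0 → List.length (R (p.eval R x)) ≤ List.length (p.eval R x) :=
    hR.length_le
  rw [mag_fldList, findRoots, ifZero, Prog.steps, Prog.eval]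
  match hv : (countNonzero p).eval R x with
  | ⟨0⟩ =>
    constructor
    · change _ + 1 + 1 ≤ _
      omega
    · change 0 + 2 ≤ _
      omega
  | ⟨n + 1⟩ =>
    rw [hv] at hcases
    have := hlen fun h => absurd (hcases.2 h) (Nat.succ_ne_zero n)
    constructor
    · change _ + 1 + ((1 + 1) + (p.steps R x + 1 + List.length (p.eval R x)
        + List.length (R (p.eval R x))) + 1) ≤ _
      omega
    · change List.length (R (p.eval R x)) + 2 ≤ _
      omega

/-- The sublist of the elements of `p` where `c` is zero. -/
def filter (p : Prog σ (.list a)) (c : Prog (.prod σ a) .nat) : Prog σ (.list a) :=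
  flatMap p (ifZero c (cons arg.snd nil) nil)

theorem eval_filter {F : Type u} [Field F] (R : List F → List F) (x : σ.Val F)
    (p : Prog σ (.list a)) (c : Prog (.prod σ a) .nat) :
    (filter p c).eval R x
      = List.filter (fun y => (c.eval R (x, y)).down = 0) (p.eval R x) := by
  rw [filter, eval_flatMap]
  have h : ∀ l : List (a.Val F), l.flatMap (fun y =>
      ((ifZero c (cons arg.snd nil) nil).eval R ((x, y) : Ty.Val F (.prod σ a)) : List (a.Val F)))
        = l.filter fun y => (c.eval R (x, y)).down = 0 := by
    intro l
    induction l with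
    | nil => rfl
    | cons y l ih =>
      rw [List.flatMap_cons, ih, eval_ifZero]
      by_cases hy : (c.eval R (x, y)).down = 0
      · rw [if_pos hy, List.filter_cons_of_pos (by simpa using hy)]
        rfl
      · rw [if_neg hy, List.filter_cons_of_neg (by simpa using hy)]
        rfl
  exact h _

instance (p : Prog σ (.list a)) (c : Prog (.prod σ a) .nat) [PolyTime.{u} p] [PolyTime.{u} c] :
    PolyTime.{u} (filter p c) := inferInstanceAs (PolyTime.{u} (flatMap ..))

/-- On input `(f, r)`, the system whose relations are the SDEs of order `r` and shift `0` that `f`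
satisfies. -/
def derivativeSystem : Prog (.prod (.list .fld) .nat) systemTy :=
  tabulate (succ arg.snd) (pair (iterDeriv arg.snd arg.fst.fst) arg.snd)

/-- On input `(f, r)`, an SDE of order `r` and shift `0` that `f` satisfies, or the empty list. -/
def findSDE : Prog (.prod (.list .fld) .nat) (.list (.list .fld)) :=
  derivativeSystem.comp findRelation

/-- An SDE of minimal order that `f` satisfies.  The orders are tried from the largest to the
smallest one, and the last success counts. -/
def findMinimalSDE : Prog (.list .fld) (.list (.list .fld)) :=
  pickLast (reverse (range (succ (succ (length arg))))) (listCase findSDE (succ zero) zero) findSDE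
    nil

/-- On input `(f, P)`, the candidates for the pairs of `powerSolutions`. -/
def candidates : Prog (.prod (.list .fld) (.list (.list .fld))) (.list (.prod .fld .nat)) :=
  flatMap (range (succ (add (length arg.fst) (mul (length arg.snd) (length arg.snd)))))
    (map (arg.fst.comp (findRoots (nth nil arg.snd (pred (length arg.snd)))))
      (pair arg.snd arg.fst.snd))

/-- On input `((f, P), (b, d))`, zero if `(b, d)` is in `powerSolutions`. -/
def candidateTest : Prog (.prod (.prod (.list .fld) (.list (.list .fld))) (.prod .fld .nat)) .nat :=
  add (add (sub (mul (length arg.fst.snd) (length arg.fst.snd)) (add arg.snd.snd arg.snd.snd))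
      (sub (add arg.snd.snd arg.snd.snd)
        (add (add (pred (length arg.fst.fst)) (pred (length arg.fst.fst)))
          (mul (pred (length arg.fst.snd)) (pred (length arg.fst.snd))))))
    (countNonzero (applyOp arg.fst.snd (linPow arg.snd.fst arg.snd.snd)))

/-- On input `(f, P)`, the list of the pairs in `powerSolutions`. -/
def findPowers : Prog (.prod (.list .fld) (.list (.list .fld))) (.list (.prod .fld .nat)) :=
  filter candidates candidateTest

/-- On input `(f, B)`, the system whose relations are the linear relations between `f` and the
affine powers of `B`. -/
def powerSystem : Prog (.prod (.list .fld) (.list (.prod .fld .nat))) systemTy :=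
  cons (pair arg.fst zero) (map arg.snd (pair (linPow arg.snd.fst arg.snd.snd) zero))

/-- On input `(B, c)`, where `c` is a linear relation between `f` and the affine powers of `B`, the
terms of the expression of `f` that results from solving for `f`. -/
def solveRelation : Prog (.prod (.list (.prod .fld .nat)) (.list (.list .fld)))
    (.list (.prod .fld (.prod .fld .nat))) :=
  tabulate (length arg.fst) (pair
    (fsub fzero (fdiv (nth fzero (nth nil arg.fst.snd (succ arg.snd)) zero)
      (nth fzero (nth nil arg.fst.snd zero) zero)))
    (nth (pair fzero zero) arg.fst.fst arg.snd))

/-- On input `(f, B)`, the terms of the expression of `f` in terms of the affine powers of `B`. -/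
def findTerms : Prog (.prod (.list .fld) (.list (.prod .fld .nat)))
    (.list (.prod .fld (.prod .fld .nat))) :=
  (pair arg.snd (powerSystem.comp findRelation)).comp solveRelation

/-- On input `(P, B, Z)`, where `Z` is the list of all terms, the output of the algorithm. -/
def output : Prog (.prod (.list (.list .fld)) (.prod (.list (.prod .fld .nat))
    (.list (.prod .fld (.prod .fld .nat))))) buildTy :=
  pair (pred (length arg.fst)) (pair arg.fst (pair arg.snd.fst
    (pair (map arg.snd.snd arg.snd.fst) (filter arg.snd.snd (feq arg.snd.fst fzero)))))

/-- The algorithm: find an SDE of minimal order, list its solutions among the affine powers, and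
solve a linear system for the coefficients. -/
def build : Prog (.list .fld) buildTy :=
  (pair arg findMinimalSDE).comp <|
    (pair arg.snd (pair findPowers ((pair arg.fst findPowers).comp findTerms))).comp output

instance : PolyTime.{u} derivativeSystem := inferInstanceAs (PolyTime.{u} (tabulate ..))

instance : PolyTime.{u} findSDE := inferInstanceAs (PolyTime.{u} (comp ..))

instance : PolyTime.{u} findMinimalSDE := inferInstanceAs (PolyTime.{u} (pickLast ..))

instance : PolyTime.{u} candidates := inferInstanceAs (PolyTime.{u} (flatMap ..))

instance : PolyTime.{u} candidateTest := inferInstanceAs (PolyTime.{u} (add ..))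

instance : PolyTime.{u} findPowers := inferInstanceAs (PolyTime.{u} (filter ..))

instance : PolyTime.{u} powerSystem := inferInstanceAs (PolyTime.{u} (cons ..))

instance : PolyTime.{u} solveRelation := inferInstanceAs (PolyTime.{u} (tabulate ..))

instance : PolyTime.{u} findTerms := inferInstanceAs (PolyTime.{u} (comp ..))

instance : PolyTime.{u} output := inferInstanceAs (PolyTime.{u} (pair ..))

instance : PolyTime.{u} build := inferInstanceAs (PolyTime.{u} (comp ..))

end Prog

/-! ### Correctness of the stages -/

section Correctness

variable {F : Type u} [Field F] (R : List F → List F)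

open Prog in
theorem eval_isEmpty {σ a : Ty} (x : σ.Val F) (p : Prog σ (.list a)) :
    ((listCase p (succ zero) zero).eval R x).down = 0 ↔ p.eval R x ≠ ([] : List (a.Val F)) := by
  rw [Prog.eval]
  match p.eval R x with
  | [] => exact iff_of_false (Nat.succ_ne_zero 0) (not_not.2 rfl)
  | y :: l => exact iff_of_true rfl (List.cons_ne_nil y l)

open Prog in
theorem eval_derivativeSystem (l : List F) (r : ℕ) :
    ∃ L : List (List F × ULift.{u} ℕ), derivativeSystem.eval R (l, ULift.up r) = L ∧
      L.length = r + 1 ∧ ∀ i ≤ r, sysPoly L i = derivative^[i] (listPoly l) ∧ sysDeg L i = i := by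
  refine ⟨_, rfl, ?_, fun i hi => ?_⟩
  · rw [derivativeSystem, length_eval_tabulate]
    rfl
  · have h : derivativeSystem.eval R (l, ULift.up r) = (List.range (r + 1)).map fun i =>
        (((iterDeriv arg.snd arg.fst.fst).eval R (((l, ULift.up r), ULift.up i) :
          Ty.Val F (.prod (.prod (.list .fld) .nat) .nat)), ULift.up i) : List F × ULift.{u} ℕ) :=
      eval_tabulate R _ _ _
    rw [sysPoly, sysDeg, h, getD_map_range, if_pos (by omega)]
    exact ⟨(eval_iterDeriv R _ arg.snd arg.fst.fst).1, rfl⟩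

open Prog in
theorem findSDE_spec (l : List F) (r : ℕ) {c : List (List F)}
    (hc : findSDE.eval R (l, ULift.up r) = c) :
    (c = [] ∧ ¬∃ Q : ℕ → F[X], IsSDE r 0 Q ∧ Satisfies r Q (listPoly l)) ∨
      (c.length = r + 1 ∧ IsSDE r 0 (fun i => listPoly (c.getD i [])) ∧
        Satisfies r (fun i => listPoly (c.getD i [])) (listPoly l)) := by
  obtain ⟨L, hL, hlen, hsys⟩ := eval_derivativeSystem R l r
  rw [findSDE, Prog.eval, hL] at hc
  have hsum : ∀ Q : ℕ → F[X], ∑ i ∈ Finset.range L.length, Q i * sysPoly L i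
      = ∑ i ∈ Finset.range (r + 1), Q i * derivative^[i] (listPoly l) := by
    intro Q
    rw [hlen]
    refine Finset.sum_congr rfl fun i hi => ?_
    rw [(hsys i (Nat.lt_succ_iff.1 (Finset.mem_range.1 hi))).1]
  rcases findRelation_spec R L hc with ⟨h1, h2⟩ | ⟨h1, ⟨i, hi, h2⟩, h3, h4⟩
  · refine Or.inl ⟨h1, ?_⟩
    rintro ⟨Q, ⟨⟨i, hi, hQ⟩, hdeg⟩, hsat⟩
    refine hQ (h2 Q (fun j hj => ?_) ((hsum Q).trans hsat) i (by omega))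
    rw [(hsys j (by omega)).2]
    exact hdeg j (by omega)
  · refine Or.inr ⟨h1.trans hlen, ⟨⟨i, by omega, h2⟩, fun j hj => ?_⟩, (hsum _).symm.trans h4⟩
    rw [Nat.add_zero]
    exact (h3 j).trans_eq (hsys j hj).2

open Prog in
theorem findMinimalSDE_spec (l : List F) : ∃ (r : ℕ) (P : List (List F)),
    findMinimalSDE.eval R l = P ∧ P.length = r + 1 ∧
      IsMinimalSDE (listPoly l) r (fun i => listPoly (P.getD i [])) := by
  have htest : ∀ k : ULift.{u} ℕ, ((listCase findSDE (succ zero) zero).eval R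
      ((l, k) : Ty.Val F (.prod (.list .fld) .nat))).down = 0 ↔
        ∃ Q : ℕ → F[X], IsSDE k.down 0 Q ∧ Satisfies k.down Q (listPoly l) := by
    intro k
    obtain ⟨c, hc⟩ : ∃ c : List (List F), findSDE.eval R (l, k) = c := ⟨_, rfl⟩
    rw [eval_isEmpty, hc]
    rcases findSDE_spec R l k.down hc with ⟨rfl, h⟩ | ⟨h1, h2⟩
    · exact iff_of_false (not_not.2 rfl) h
    · refine iff_of_true ?_ ⟨_, h2⟩
      rintro rfl
      exact absurd h1 (Nat.succ_ne_zero _).symm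
  have hrange : (reverse (range (succ (succ (length arg)))) : Prog (.list .fld) _).eval R l
      = List.reverse ((List.range (l.length + 2)).map ULift.up.{u}) := by
    rw [eval_reverse, eval_range]
    simp only [Prog.eval, eval_length]
  rcases eval_pickLast (σ := .list .fld) (a := .nat) (b := .list (.list .fld)) R (x := l)
    (p := reverse (range (succ (succ (length arg))))) (c := listCase findSDE (succ zero) zero)
    (w := findSDE) (d := nil) hrange with ⟨-, h⟩ | ⟨l₁, k, l₂, hl, h1, h2, h3⟩
  · obtain ⟨Q, hQ⟩ := exists_isSDE_natDegree_succ (listPoly l)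
    refine absurd ((htest (ULift.up _)).2 ⟨Q, hQ⟩) (h _ ?_)
    have := natDegree_listPoly_le l
    exact List.mem_reverse.2 (List.mem_map.2 ⟨_, List.mem_range.2 (by omega), rfl⟩)
  · obtain ⟨Q, hQ⟩ := (htest k).1 h1
    obtain ⟨c, hc⟩ : ∃ c : List (List F), findSDE.eval R (l, k) = c := ⟨_, rfl⟩
    rcases findSDE_spec R l k.down hc with ⟨-, h⟩ | ⟨h4, h5⟩
    · exact absurd ⟨Q, hQ⟩ h
    · refine ⟨k.down, c, h3.trans hc, h4, ⟨⟨Q, hQ⟩, fun j hj => ?_⟩, h5⟩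
      -- the orders after `k` in the decreasing list are the smaller ones
      by_contra! hlt
      have hpw : (l₁ ++ k :: l₂).Pairwise fun a b => b.down < a.down := by
        rw [← hl, List.pairwise_reverse, List.pairwise_map]
        exact List.pairwise_lt_range
      have hkm : k ∈ List.reverse ((List.range (l.length + 2)).map ULift.up.{u}) :=
        mem_of_eq_append_cons hl
      obtain ⟨k', hk', hkk⟩ := List.mem_map.1 (List.mem_reverse.1 hkm)
      have hjm : ULift.up.{u} j ∈ l₁ ++ k :: l₂ := by
        rw [← hl]
        refine List.mem_reverse.2 (List.mem_map.2 ⟨j, List.mem_range.2 ?_, rfl⟩)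
        rw [List.mem_range] at hk'
        rw [← hkk] at hlt
        exact hlt.trans hk'
      rcases List.mem_append.1 hjm with hj' | hj'
      · have := (List.pairwise_append.1 hpw).2.2 _ hj' k (by simp)
        exact absurd this (by simpa using hlt.le)
      · rcases List.mem_cons.1 hj' with rfl | hj'
        · exact absurd hlt (lt_irrefl _)
        · exact h2 _ hj' ((htest _).2 hj)

/-- The pairs of a list of values of the language. -/
def toPairs (B : List (F × ULift.{u} ℕ)) : List (F × ℕ) := B.map fun q => (q.1, q.2.down)

open Prog in
theorem eval_candidateTest (l : List F) (P : List (List F)) (q : F × ULift.{u} ℕ) :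
    (candidateTest.eval R ((l, P), q)).down = 0 ↔
      P.length ^ 2 ≤ 2 * q.2.down ∧ 2 * q.2.down ≤ 2 * (l.length - 1) + (P.length - 1) ^ 2 ∧
        ∑ i ∈ Finset.range P.length,
          listPoly (P.getD i []) * derivative^[i] (affinePower (q.1, q.2.down)) = 0 := by
  have h : ∀ x : Ty.Val F (.prod (.prod (.list .fld) (.list (.list .fld))) (.prod .fld .nat)),
      ((countNonzero (applyOp arg.fst.snd (linPow arg.snd.fst arg.snd.snd))).eval R x).down = 0 ↔
        ∑ i ∈ Finset.range (List.length x.1.2),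
          listPoly (List.getD x.1.2 i []) * derivative^[i] (affinePower (x.2.1, x.2.2.down))
            = 0 := by
    intro x
    rw [eval_countNonzero, listPoly_eval_applyOp]
    refine Eq.congr (Finset.sum_congr rfl fun i _ => ?_) rfl
    rw [eval_linPow]
    rfl
  rw [candidateTest, Prog.eval_add, Nat.add_eq_zero_iff, h, Prog.eval_add, Prog.eval_sub,
    Prog.eval_sub, Prog.eval_add, Prog.eval_add, Prog.eval_add, Prog.eval_mul, Prog.eval_mul,
    eval_pred, eval_pred, eval_length, eval_length]
  simp only [Prog.eval]
  rw [Nat.add_eq_zero_iff, Nat.sub_eq_zero_iff_le, Nat.sub_eq_zero_iff_le, and_assoc, pow_two,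
    pow_two, two_mul, two_mul]

open Prog in
theorem eval_candidates (l : List F) (P : List (List F))
    (hP : listPoly (P.getD (P.length - 1) []) ≠ 0) :
    candidates.eval R (l, P) = (List.range (l.length + P.length * P.length + 1)).flatMap fun d =>
      (R (P.getD (P.length - 1) [])).map fun b => (b, ULift.up.{u} d) := by
  have h : ∀ d : ULift.{u} ℕ,
      (arg.fst.comp (findRoots (nth nil arg.snd (pred (length arg.snd))))).eval R
        (((l, P), d) : Ty.Val F (.prod (.prod (.list .fld) (.list (.list .fld))) .nat))
        = R (P.getD (P.length - 1) []) := by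
    intro d
    have hn : (nth nil arg.snd (pred (length arg.snd))).eval R
        ((l, P) : Ty.Val F (.prod (.list .fld) (.list (.list .fld))))
          = P.getD (P.length - 1) [] := by
      rw [eval_nth, eval_pred, eval_length]
      rfl
    rw [Prog.eval]
    have := eval_findRoots R ((l, P) : Ty.Val F (.prod (.list .fld) (.list (.list .fld))))
      (nth nil arg.snd (pred (length arg.snd))) (by rw [hn]; exact hP)
    rw [hn] at this
    exact this
  rw [candidates, eval_flatMap, eval_range]
  have hr : ((succ (add (length arg.fst) (mul (length arg.snd) (length arg.snd)))).eval R
      ((l, P) : Ty.Val F (.prod (.list .fld) (.list (.list .fld))))).down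
        = l.length + P.length * P.length + 1 := by
    rw [Prog.eval]
    dsimp only
    rw [Prog.eval_add, Prog.eval_mul, eval_length, eval_length]
    rfl
  rw [hr, List.flatMap_map]
  refine List.flatMap_congr fun d _ => ?_
  rw [Prog.eval_map, h]
  rfl

open Prog in
/-- The nodes of the solutions are roots of the leading coefficient, so that they are all among the
candidates. -/
theorem findPowers_spec [CharZero F] (hR : IsRootFinder R) {f : F[X]} {l : List F}
    (hl : l.length = f.natDegree + 1) {r : ℕ} {P : List (List F)} (hlen : P.length = r + 1)
    (hP : IsMinimalSDE f r (fun i => listPoly (P.getD i []))) :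
    ∃ B : List (F × ULift.{u} ℕ), findPowers.eval R (l, P) = B ∧ (toPairs B).Nodup ∧
      ∀ q : F × ℕ, q ∈ toPairs B ↔ q ∈ powerSolutions f r (fun i => listPoly (P.getD i [])) := by
  have hlead : listPoly (P.getD (P.length - 1) []) ≠ 0 := by
    rw [hlen]
    exact hP.leadingCoeff_ne_zero
  obtain ⟨hnodup, hroots⟩ := hR _ hlead
  have hmem : ∀ q : F × ULift.{u} ℕ, (candidateTest.eval R ((l, P), q)).down = 0 ↔
      (q.1, q.2.down) ∈ powerSolutions f r (fun i => listPoly (P.getD i [])) := by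
    intro q
    rw [eval_candidateTest, mem_powerSolutions_iff, hlen, hl]
    rfl
  have hinj : Function.Injective fun q : F × ULift.{u} ℕ => (q.1, q.2.down) := by
    rintro ⟨b, ⟨d⟩⟩ ⟨b', ⟨d'⟩⟩ h
    simpa using h
  refine ⟨_, rfl, ?_, fun q => ?_⟩
  · rw [toPairs, List.nodup_map_iff hinj, findPowers, eval_filter]
    refine List.Nodup.filter _ ?_
    rw [eval_candidates R l P hlead, List.nodup_flatMap]
    refine ⟨fun d _ => hnodup.map fun b b' h => (Prod.ext_iff.1 h).1, ?_⟩
    refine List.nodup_range.imp fun {d d'} hdd => ?_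
    intro q hq hq'
    obtain ⟨b, -, rfl⟩ := List.mem_map.1 hq
    obtain ⟨b', -, h⟩ := List.mem_map.1 hq'
    exact hdd (congrArg (fun q => ULift.down q.2) h).symm
  · rw [toPairs, findPowers, eval_filter, eval_candidates R l P hlead]
    constructor
    · intro hq
      obtain ⟨q', hq', hqq⟩ := List.mem_map.1 hq
      rw [← hqq]
      exact (hmem q').1 (of_decide_eq_true (List.mem_filter.1 hq').2)
    · intro hq
      refine List.mem_map.2 ⟨(q.1, ULift.up q.2), List.mem_filter.2 ⟨?_, ?_⟩, rfl⟩
      · have h := mem_powerSolutions_iff.1 hq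
        refine List.mem_flatMap.2 ⟨q.2, List.mem_range.2 ?_, List.mem_map.2 ⟨q.1, ?_, rfl⟩⟩
        · have h2 := h.2.1
          rw [hl, hlen]
          nlinarith
        · rw [hroots, hlen]
          exact eval_eq_zero_of_satisfies_affinePower (le_exponent_of_mem_powerSolutions hq) h.2.2
      · exact decide_eq_true ((hmem _).2 hq)

end Correctness

/-! ### The coefficients of the terms -/

section FinsuppSums

variable {ι A F : Type*} [Field F] {t : Finset ι} {q : ι → A}

theorem sum_single_apply_of_injOn (hq : Set.InjOn q t) (c : ι → F) {j : ι} (hj : j ∈ t) :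
    (∑ i ∈ t, Finsupp.single (q i) (c i)) (q j) = c j := by
  rw [Finsupp.finsetSum_apply, Finset.sum_eq_single_of_mem j hj]
  · exact Finsupp.single_eq_same
  · intro i hi hij
    exact Finsupp.single_eq_of_ne fun h => hij (hq hj hi h).symm

theorem sum_single_apply_eq_zero (c : ι → F) {x : A} (hx : ∀ i ∈ t, q i ≠ x) :
    (∑ i ∈ t, Finsupp.single (q i) (c i)) x = 0 := by
  rw [Finsupp.finsetSum_apply]
  exact Finset.sum_eq_zero fun i hi => Finsupp.single_eq_of_ne (hx i hi).symm

theorem exists_iff_sum_single_apply (hq : Set.InjOn q t) (c : ι → F) {x : A} {y : F} (hy : y ≠ 0) :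
    (∃ i ∈ t, q i = x ∧ c i = y) ↔ (∑ i ∈ t, Finsupp.single (q i) (c i)) x = y := by
  constructor
  · rintro ⟨i, hi, rfl, rfl⟩
    exact sum_single_apply_of_injOn hq c hi
  · rintro h
    by_contra hne
    push Not at hne
    by_cases hx : ∃ i ∈ t, q i = x
    · obtain ⟨i, hi, rfl⟩ := hx
      exact hne i hi rfl ((sum_single_apply_of_injOn hq c hi).symm.trans h)
    · push Not at hx
      exact hy (h.symm.trans (sum_single_apply_eq_zero c hx))

theorem sum_single_apply_self (hq : Set.InjOn q t) {β : A →₀ F}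
    (hβ : ∀ x ∈ β.support, ∃ i ∈ t, q i = x) : ∑ i ∈ t, Finsupp.single (q i) (β (q i)) = β := by
  ext x
  by_cases hx : ∃ i ∈ t, q i = x
  · obtain ⟨i, hi, rfl⟩ := hx
    exact sum_single_apply_of_injOn hq (fun i => β (q i)) hi
  · have h0 : β x = 0 := by
      by_contra h
      exact hx (hβ x (Finsupp.mem_support_iff.2 h))
    push Not at hx
    rw [h0]
    exact sum_single_apply_eq_zero (fun i => β (q i)) hx

end FinsuppSums

section Correctness

variable {F : Type u} [Field F] (R : List F → List F)

/-- The `i`-th pair of a list of values of the language, or `(0, 0)` beyond its end. -/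
def pairAt (B : List (F × ULift.{u} ℕ)) (i : ℕ) : F × ℕ :=
  ((B.getD i (0, ULift.up 0)).1, (B.getD i (0, ULift.up 0)).2.down)

theorem toPairs_eq_map_pairAt (B : List (F × ULift.{u} ℕ)) :
    toPairs B = (List.range B.length).map (pairAt B) := by
  refine List.ext_getElem (by simp [toPairs]) fun i h1 h2 => ?_
  have hi : i < B.length := by simpa [toPairs] using h1
  simp [toPairs, pairAt, hi]

theorem eval_pair {σ a b : Ty} (x : σ.Val F) (p : Prog σ a) (q : Prog σ b) :
    (p.pair q).eval R x = (p.eval R x, q.eval R x) := by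
  rw [Prog.eval]

open Prog in
theorem eval_powerSystem (l : List F) (B : List (F × ULift.{u} ℕ)) :
    ∃ L : List (List F × ULift.{u} ℕ), powerSystem.eval R (l, B) = L ∧
      L.length = B.length + 1 ∧ (∀ i, sysDeg L i = 0) ∧ sysPoly L 0 = listPoly l ∧
      ∀ i < B.length, sysPoly L (i + 1) = affinePower (pairAt B i) := by
  let g : F × ULift.{u} ℕ → List F := fun q => (linPow arg.snd.fst arg.snd.snd).eval R
    (((l, B), q) :
      Ty.Val F (.prod (.prod (.list .fld) (.list (.prod .fld .nat))) (.prod .fld .nat)))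
  have hg : ∀ q, listPoly (g q) = affinePower (q.1, q.2.down) := fun q =>
    eval_linPow R _ arg.snd.fst arg.snd.snd
  have h : powerSystem.eval R (l, B) = (l, ULift.up 0) :: B.map fun q => (g q, ULift.up.{u} 0) := by
    rw [powerSystem, Prog.eval, Prog.eval_map]
    rfl
  refine ⟨_, h, by simp, fun i => ?_, rfl, fun i hi => ?_⟩
  · rw [sysDeg]
    rcases i with _ | i
    · rfl
    · rw [List.getD_cons_succ, List.getD_eq_getElem?_getD, List.getElem?_map]
      rcases B[i]? with _ | q <;> rfl
  · rw [sysPoly, List.getD_cons_succ, List.getD_eq_getElem _ _ (by simpa using hi),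
      List.getElem_map, hg, pairAt, List.getD_eq_getElem _ _ hi]

open Prog in
theorem eval_solveRelation (B : List (F × ULift.{u} ℕ)) (c : List (List F)) :
    solveRelation.eval R (B, c) = (List.range B.length).map fun i =>
      (0 - (c.getD (i + 1) []).getD 0 0 / (c.getD 0 []).getD 0 0,
        B.getD i (0, ULift.up.{u} 0)) := by
  rw [solveRelation, eval_tabulate, eval_length]
  refine List.map_congr_left fun i _ => ?_
  rw [Prog.eval, Prog.eval, Prog.eval, Prog.eval, eval_nth, eval_nth, eval_nth, eval_nth, eval_nth]
  rfl

open Prog in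
/-- A relation that involves `f` exists, and `f` cannot be missing in it, as the affine powers are
linearly independent. -/
theorem findTerms_spec {l : List F} {B : List (F × ULift.{u} ℕ)}
    (hB : ∀ k : ℕ → F, ∑ i ∈ Finset.range B.length, C (k i) * affinePower (pairAt B i) = 0 →
      ∀ i < B.length, k i = 0) {δ : ℕ → F}
    (hδ : listPoly l = ∑ i ∈ Finset.range B.length, C (δ i) * affinePower (pairAt B i)) :
    ∃ γ : ℕ → F, (findTerms.eval R (l, B) = (List.range B.length).map fun i =>
        (γ i, B.getD i (0, ULift.up.{u} 0))) ∧
      listPoly l = ∑ i ∈ Finset.range B.length, C (γ i) * affinePower (pairAt B i) := by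
  obtain ⟨L, hL, hlen, hdeg, h0, hsucc⟩ := eval_powerSystem R l B
  obtain ⟨c, hc⟩ : ∃ c : List (List F), findRelation.eval R L = c := ⟨_, rfl⟩
  have hcomp : ∀ x : Ty.Val F (.prod (.list .fld) (.list (.prod .fld .nat))), findTerms.eval R x
      = solveRelation.eval R (x.2, findRelation.eval R (powerSystem.eval R x)) := by
    intro x
    rw [findTerms]
    simp only [Prog.eval]
  have heval : findTerms.eval R (l, B) = solveRelation.eval R (B, c) := by
    rw [hcomp, hL, hc]
  have hsum : ∀ Q : ℕ → F[X], ∑ i ∈ Finset.range L.length, Q i * sysPoly L i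
      = ∑ i ∈ Finset.range B.length, Q (i + 1) * affinePower (pairAt B i) + Q 0 * listPoly l := by
    intro Q
    rw [hlen, Finset.sum_range_succ', h0]
    refine congrArg (· + Q 0 * listPoly l) (Finset.sum_congr rfl fun i hi => ?_)
    rw [hsucc i (Finset.mem_range.1 hi)]
  rcases findRelation_spec R L hc with ⟨-, h⟩ | ⟨hcl, ⟨j, hj, hj0⟩, hcdeg, hrel⟩
  · have := h (fun i => C (Nat.casesOn i (-1) δ)) (fun i _ => by simp) (by
      rw [hsum]
      change ∑ i ∈ Finset.range B.length, C (δ i) * _ + C (-1) * _ = 0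
      rw [← hδ]
      simp) 0 (by omega)
    simp at this
  · have hconst : ∀ i, listPoly (c.getD i []) = C ((c.getD i []).getD 0 0) := by
      intro i
      rw [← coeff_listPoly]
      exact eq_C_of_natDegree_le_zero ((hcdeg i).trans_eq (hdeg i))
    rw [hsum] at hrel
    simp only [hconst] at hrel hj0
    have hne : (c.getD 0 []).getD 0 0 ≠ 0 := by
      intro hz
      rw [hz, C_0, zero_mul, add_zero] at hrel
      have hall := hB (fun i => (c.getD (i + 1) []).getD 0 0) hrel
      rcases j with _ | j
      · rw [hz, C_0] at hj0
        exact hj0 rfl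
      · rw [hall j (by omega), C_0] at hj0
        exact hj0 rfl
    refine ⟨_, heval.trans (eval_solveRelation R B c), ?_⟩
    refine mul_left_cancel₀ (C_ne_zero.2 hne) ?_
    rw [← eq_neg_iff_add_eq_zero.2 ((add_comm _ _).trans hrel) |>.symm, Finset.mul_sum,
      ← Finset.sum_neg_distrib]
    refine Finset.sum_congr rfl fun i _ => ?_
    rw [← mul_assoc, ← C_mul, ← neg_mul, ← C_neg]
    refine congrArg (fun z => C z * affinePower (pairAt B i)) ?_
    rw [zero_sub, mul_neg, mul_div_cancel₀ _ hne]

open Prog in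
theorem eval_output (P : List (List F)) (B : List (F × ULift.{u} ℕ)) (γ : ℕ → F) :
    output.eval R (P, (B, (List.range B.length).map fun i => (γ i, B.getD i (0, ULift.up.{u} 0))))
      = encodeOutput (P.length - 1) P (toPairs B) ((List.range B.length).map γ)
          (nonzeroTerms ((List.range B.length).map γ) (toPairs B)) := by
  classical
  have hout : ∀ x : Ty.Val F (.prod (.list (.list .fld)) (.prod (.list (.prod .fld .nat))
      (.list (.prod .fld (.prod .fld .nat))))), output.eval R x
        = (ULift.up (List.length x.1 - 1), x.1, x.2.1, List.map (fun t => t.1) x.2.2,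
          List.filter (fun t => t.1 ≠ 0) x.2.2) := by
    intro x
    refine (eval_pair R x _ _).trans ?_
    rw [eval_pair, eval_pair, eval_pair, Prog.eval_map, eval_filter]
    refine Prod.ext (ULift.ext _ _ ?_) (Prod.ext rfl (Prod.ext rfl (Prod.ext rfl ?_)))
    · dsimp only
      rw [eval_pred, eval_length]
      rfl
    · refine List.filter_congr fun t _ => decide_eq_decide.2 ?_
      change (if t.1 = (0 : F) then 1 else 0) = 0 ↔ _
      split_ifs with h <;> simp [h]
  have hB : (toPairs B).map (fun q => (q.1, ULift.up.{u} q.2)) = B := by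
    rw [toPairs, List.map_map]
    exact List.map_id B
  rw [hout, encodeOutput, hB, nonzeroTerms, toPairs_eq_map_pairAt, List.zip_map']
  dsimp only
  rw [List.map_map, List.filter_map, List.filter_map, List.map_map]
  rfl

end Correctness

/-! ### Correctness of the algorithm -/

section Build

variable {F : Type u} [Field F] {R : List F → List F}

open Prog in
theorem eval_build {l : List F} {P : List (List F)} {B : List (F × ULift.{u} ℕ)}
    (hP : findMinimalSDE.eval R l = P) (hB : findPowers.eval R (l, P) = B) :
    build.eval R l = output.eval R (P, (B, findTerms.eval R (l, B))) := by
  have h1 : ∀ x : Ty.Val F (.list .fld), build.eval R x = output.eval R (findMinimalSDE.eval R x,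
      (findPowers.eval R (x, findMinimalSDE.eval R x),
        findTerms.eval R (x, findPowers.eval R (x, findMinimalSDE.eval R x)))) := by
    intro x
    rw [build]
    simp only [Prog.eval]
  rw [h1, hP, hB]

/-- The coefficients of the terms that are found form the unique expression of `f` in terms of the
solutions of the SDE, which is the given one. -/
theorem build_spec [CharZero F] (hR : IsRootFinder R) {f : F[X]} {s : ℕ} {α a : Fin s → F}
    {e : Fin s → ℕ} (h : IsBigExponentDecomposition f s α a e) :
    ∃ (r : ℕ) (P : List (List F)) (B : List (F × ℕ)) (β : List F) (T : List (F × F × ℕ)),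
      Prog.build.eval (F := F) R (denseRep (F := F) f) = encodeOutput r P B β T ∧
      P.length = r + 1 ∧
      IsMinimalSDE f r (fun i => listPoly (P.getD i [])) ∧
      B.Nodup ∧ B.length ≤ r ∧
      (∀ q : F × ℕ, q ∈ B ↔ q ∈ powerSolutions f r (fun i => listPoly (P.getD i []))) ∧
      β.length = B.length ∧
      f = (List.zipWith (fun c q => C c * (X - C q.1) ^ q.2) β B).sum ∧
      T = nonzeroTerms β B ∧ T.Perm (List.ofFn (fun i => (α i, a i, e i))) := by
  classical
  obtain ⟨r, P, hP, hlen, hmin⟩ := findMinimalSDE_spec R (denseRep f)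
  rw [listPoly_denseRep] at hmin
  obtain ⟨B, hB, hnodup, hmem⟩ := findPowers_spec R hR (f := f) (l := denseRep f)
    (by simp [denseRep]) hlen hmin
  set S := powerSolutions f r (fun i => listPoly (P.getD i [])) with hS
  have hpairs := toPairs_eq_map_pairAt B
  have hinj : Set.InjOn (pairAt B) (Finset.range B.length) := by
    rw [hpairs] at hnodup
    intro i hi j hj hij
    rw [Finset.coe_range, Set.mem_Iio] at hi hj
    exact List.inj_on_of_nodup_map hnodup (List.mem_range.2 hi) (List.mem_range.2 hj) hij
  have hrange : ∀ q, q ∈ S ↔ ∃ i ∈ Finset.range B.length, pairAt B i = q := by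
    intro q
    rw [← hmem, hpairs, List.mem_map]
    simp only [List.mem_range, Finset.mem_range]
  -- the coefficient function of a combination of the affine powers of `B`
  let coeffs : (ℕ → F) → F × ℕ →₀ F := fun γ =>
    ∑ i ∈ Finset.range B.length, Finsupp.single (pairAt B i) (γ i)
  have hcoeffs : ∀ γ, coeffs γ ∈ Finsupp.supported F F S := fun γ =>
    Submodule.sum_mem _ fun i hi => Finsupp.single_mem_supported _ _ ((hrange _).2 ⟨i, hi, rfl⟩)
  have hcomb : ∀ γ, Finsupp.linearCombination F affinePower (coeffs γ)
      = ∑ i ∈ Finset.range B.length, C (γ i) * affinePower (pairAt B i) := by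
    intro γ
    rw [map_sum]
    refine Finset.sum_congr rfl fun i _ => ?_
    rw [Finsupp.linearCombination_single, smul_eq_C_mul]
  set β₀ : F × ℕ →₀ F := ∑ i, Finsupp.single (a i, e i) (α i) with hβ₀
  obtain ⟨hsub, hf⟩ := (h.subset_and_eq_sum_iff hmin β₀).2 rfl
  have hβ₀' : coeffs (fun i => β₀ (pairAt B i)) = β₀ :=
    sum_single_apply_self hinj fun x hx => (hrange x).1 (hsub hx)
  obtain ⟨γ, hγ, hγf⟩ := findTerms_spec R (l := denseRep f) (B := B) (fun k hk i hi => by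
      have h0 := linearIndepOn_iff.1 (linearIndepOn_powerSolutions (f := f) hmin.2.1.1) (coeffs k)
        (hcoeffs k) ((hcomb k).trans hk)
      have h1 := sum_single_apply_of_injOn hinj k (Finset.mem_range.2 hi)
      rw [← h1]
      exact DFunLike.congr_fun h0 _)
    (δ := fun i => β₀ (pairAt B i)) (by rw [listPoly_denseRep, ← hcomb, hβ₀']; exact hf)
  rw [listPoly_denseRep] at hγf
  have hγβ : coeffs γ = β₀ := (h.subset_and_eq_sum_iff hmin _).1
    ⟨(Finsupp.mem_supported _ _).1 (hcoeffs γ), hγf.trans (hcomb γ).symm⟩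
  refine ⟨r, P, toPairs B, (List.range B.length).map γ, _, ?_, hlen, hmin, hnodup, ?_, hmem, ?_, ?_,
    rfl, ?_⟩
  · rw [eval_build hP hB, hγ, eval_output, hlen, Nat.add_sub_cancel]
  · obtain ⟨-, hcard⟩ := powerSolutions_finite_and_ncard_le (f := f) hmin.2.1.1
    have hcoe : ((toPairs B).toFinset : Set (F × ℕ)) = S := by
      ext q
      rw [List.coe_toFinset]
      exact hmem q
    rwa [← hS, ← hcoe, Set.ncard_coe_finset, List.toFinset_card_of_nodup hnodup] at hcard
  · simp [toPairs]
  · rw [hpairs, List.zipWith_map, List.zipWith_self]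
    exact hγf
  · rw [nonzeroTerms, hpairs, List.zip_map']
    refine (List.perm_ext_iff_of_nodup (List.Nodup.filter _ ?_) (List.nodup_ofFn.2 ?_)).2 ?_
    · rw [hpairs] at hnodup
      refine List.Nodup.of_map Prod.snd ?_
      rw [List.map_map]
      exact hnodup
    · intro i j hij
      exact h.nodes_distinct (congrArg (fun t => t.2.1) hij)
    · rintro ⟨c, q⟩
      have hinj' : Set.InjOn (fun i => (a i, e i)) (Finset.univ : Finset (Fin s)) :=
        h.pairs_injective.injOn
      rw [List.mem_filter, List.mem_ofFn]
      by_cases hc : c = 0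
      · refine iff_of_false (fun hm => by simp [hc] at hm) ?_
        rintro ⟨i, hi⟩
        exact h.coeff_ne_zero i ((congrArg Prod.fst hi).trans hc)
      · have h1 := exists_iff_sum_single_apply hinj γ (x := q) hc
        have h2 := exists_iff_sum_single_apply hinj' α (x := q) hc
        have h3 : (∑ i ∈ Finset.range B.length, Finsupp.single (pairAt B i) (γ i)) = β₀ := hγβ
        rw [h3, hβ₀, ← h2] at h1
        simp only [List.mem_map, List.mem_range, Finset.mem_range, Finset.mem_univ, true_and,
          Prod.mk.injEq, decide_eq_true_eq, ne_eq] at h1 ⊢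
        constructor
        · rintro ⟨⟨i, hi, h4, h5⟩, -⟩
          obtain ⟨j, hj, hj'⟩ := h1.1 ⟨i, hi, h5, h4⟩
          exact ⟨j, hj', hj⟩
        · rintro ⟨j, hj⟩
          obtain ⟨i, hi, h4, h5⟩ := h1.2 ⟨j, hj.2, hj.1⟩
          exact ⟨⟨i, hi, h5, h4⟩, hc⟩

end Build

end AffinePowers

theorem theorem4p3 :
    -- the decomposition is optimal, and the method recovers it from any SDE of minimal order
    (∀ (F : Type u) [Field F] [CharZero F] (f : F[X]) (s : ℕ) (α a : Fin s → F) (e : Fin s → ℕ),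
      IsBigExponentDecomposition f s α a e →
        affPow f = s ∧
        ∀ (r : ℕ) (P : ℕ → F[X]), IsMinimalSDE f r P →
          (powerSolutions f r P).Finite ∧ (powerSolutions f r P).ncard ≤ r ∧
          ∀ β : F × ℕ →₀ F,
            ((β.support : Set (F × ℕ)) ⊆ powerSolutions f r P ∧
              f = β.sum (fun q c => C c * (X - C q.1) ^ q.2)) ↔
            β = ∑ i, Finsupp.single (a i, e i) (α i)) ∧
    -- a polynomial time algorithm carries out the method
    ∃ (Build : Prog (.list .fld) buildTy) (p : ℕ[X]),
      ∀ (F : Type u) [Field F] [CharZero F] (R : List F → List F), IsRootFinder R →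
        (∀ l : List F, Build.steps (F := F) R l ≤ p.eval l.length) ∧
        ∀ (f : F[X]) (s : ℕ) (α a : Fin s → F) (e : Fin s → ℕ),
          IsBigExponentDecomposition f s α a e →
          ∃ (r : ℕ) (P : List (List F)) (B : List (F × ℕ)) (β : List F) (T : List (F × F × ℕ)),
            Build.eval (F := F) R (denseRep (F := F) f) = encodeOutput r P B β T ∧
            -- step 1
            P.length = r + 1 ∧
            IsMinimalSDE f r (fun i => listPoly (P.getD i [])) ∧
            -- step 2
            B.Nodup ∧ B.length ≤ r ∧
            (∀ q : F × ℕ,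
              q ∈ B ↔ q ∈ powerSolutions f r (fun i => listPoly (P.getD i []))) ∧
            -- step 3
            β.length = B.length ∧
            f = (List.zipWith (fun c q => C c * (X - C q.1) ^ q.2) β B).sum ∧
            -- step 4
            T = nonzeroTerms β B ∧ T.Perm (List.ofFn (fun i => (α i, a i, e i))) := by
  refine ⟨fun F _ _ f s α a e h => ⟨h.affPow_eq, fun r P hP => ?_⟩, ?_⟩
  · obtain ⟨hfin, hcard⟩ := powerSolutions_finite_and_ncard_le (f := f) hP.2.1.1
    refine ⟨hfin, hcard, fun β => ?_⟩
    rw [← h.subset_and_eq_sum_iff hP β, Finsupp.linearCombination_apply]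
    simp only [smul_eq_C_mul]
    rfl
  · obtain ⟨k, hk⟩ := (inferInstance : PolyTime.{u} Prog.build).exists_boundedBy
    refine ⟨Prog.build, (X + 2) ^ k, fun F _ _ R hR => ⟨fun l => ?_, fun f s α a e h =>
      build_spec hR h⟩⟩
    have := (hk F R hR l).1
    rw [mag_fldList] at this
    simpa using this
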